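/- Let $m\ge 1$. For $b\in\mathbb C$ put $(b)_t=b(b+1)\cdots(b+t-1)$, $(b)_0=1$, and for a partition $\tau=(t_1\ge\cdots\ge t_m\ge 0)$ of $t$ into at most $m$ parts put $(\beta)_\tau=\prod_{i=1}^m\bigl(\beta-\tfrac12(i-1)\bigr)_{t_i}$. Let $C_\tau$ denote the zonal polynomial of $\tau$ on complex symmetric $m\times m$ matrices: the component of $(\operatorname{tr}X)^t$ in the space $V_\tau$ spanned by the functions $X\mapsto\Delta_\tau(LXL^{\mathsf T})$, $L\in GL_m(\mathbb R)$, in the decomposition $\bigoplus_\tau V_\tau$ of the homogeneous polynomials of degree $t$, where $\Delta_\tau(X)=\prod_{i=1}^m(\det X_{[i]})^{t_i-t_{i+1}}$, $X_{[i]}$ is the leading $i\times i$ block and $t_{m+1}=0$; in particular $\sum_\tau C_\tau(X)=(\operatorname{tr}X)^t$. For a sequence $f(t)$ of complex numbers define $${}_1P_1(f(t):a;c;X)=\sum_{t=0}^\infty\frac{f(t)}{t!}\sum_{\tau}\frac{(a)_\tau}{(c)_\tau}C_\tau(X),$$ the inner sum being over all partitions $\tau$ of $t$ into at most $m$ parts.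 Let $X$ be a complex symmetric $m\times m$ matrix whose real part is positive definite, with eigenvalues $\lambda_1,\dots,\lambda_m$ (with multiplicity), and let $a,c\in\mathbb C$ with $\operatorname{Re}(a)>\frac12(m-1)$ and $\operatorname{Re}(c)>\frac12(m-1)$. Let $b,d\in\mathbb C$; non-integral powers are taken on the principal branch, $\arg\in(-\pi,\pi]$. 1. If $|d|>\sum_i|\lambda_i|$, the series ${}_1P_1\bigl((b)_t d^{-b-t}:a;c;X\bigr)$ converges absolutely (as a series in $t$). 2. If $|d-\operatorname{tr}X|>\sum_i|\lambda_i|$, the series ${}_1P_1\bigl((b)_t(d-\operatorname{tr}X)^{-t}:c-a;c;-X\bigr)$ converges absolutely (as a series in $t$). 3. Suppose that $d\ne0$, $d\neq\operatorname{tr}X$, that both series converge absolutely (as series in $t$), and that either $b$ is an integer or $\arg(d)+\arg\bigl(1-\operatorname{tr}(X)/d\bigr)\in(-\pi,\pi]$. Then the Kummer–Pearson VII relation holds: $${}_1P_1\bigl((b)_t d^{-b-t}:a;c;X\bigr)=(d-\operatorname{tr}X)^{-b}\,{}_1P_1\bigl((b)_t(d-\operatorname{tr}X)^{-t}:c-a;c;-X\bigr).$$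 -/

import Mathlib

open scoped Matrix MatrixGroups

noncomputable section

namespace KummerPearson

/-- The space of complex symmetric `m × m` matrices. -/
def SymMat (m : ℕ) : Submodule ℂ (Matrix (Fin m) (Fin m) ℂ) where
  carrier := {X | X.IsSymm}
  zero_mem' := Matrix.isSymm_zero
  add_mem' := fun hX hY => hX.add hY
  smul_mem' := fun k _ hX => hX.smul k

/-- The congruence action `X ↦ L X Lᵀ` of `GL(m, ℝ)` on complex symmetric matrices. -/
def congruence {m : ℕ} (L : GL (Fin m) ℝ) (X : SymMat m) : Matrix (Fin m) (Fin m) ℂ :=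
  (L : Matrix (Fin m) (Fin m) ℝ).map Complex.ofReal * (X : Matrix (Fin m) (Fin m) ℂ) *
    ((L : Matrix (Fin m) (Fin m) ℝ).map Complex.ofReal)ᵀ

/-- The partitions `τ = (t₁ ≥ t₂ ≥ ⋯ ≥ t_m ≥ 0)` of `t` into at most `m` (nonzero) parts. -/
def partitions (m t : ℕ) : Finset (Fin m → ℕ) :=
  open Classical in (Finset.univ.piAntidiag t).filter Antitone

/-- The leading principal minor on the rows and columns `0, …, i`. -/
def leadingMinor {m : ℕ} (X : Matrix (Fin m) (Fin m) ℂ) (i : Fin m) : ℂ :=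
  (X.submatrix (Fin.castLE (Nat.succ_le_of_lt i.isLt))
    (Fin.castLE (Nat.succ_le_of_lt i.isLt))).det

/-- The part following the `i`-th one, with `t_{m+1} = 0`. -/
def nextPart {m : ℕ} (τ : Fin m → ℕ) (i : Fin m) : ℕ :=
  if h : (i : ℕ) + 1 < m then τ ⟨(i : ℕ) + 1, h⟩ else 0

/-- The generalized power `Δ_τ(X) = ∏ᵢ (i-th leading principal minor) ^ (tᵢ - tᵢ₊₁)`, the highest
weight vector of type `2τ` in the polynomial functions on symmetric matrices. -/
def generalizedPower {m : ℕ} (τ : Fin m → ℕ) (X : Matrix (Fin m) (Fin m) ℂ) : ℂ :=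
  ∏ i, leadingMinor X i ^ (τ i - nextPart τ i)

/-- The irreducible `GL(m)`-invariant space `V_τ` of homogeneous polynomial functions on symmetric
matrices: the span of the translates of `Δ_τ`. -/
def zonalSpace {m : ℕ} (τ : Fin m → ℕ) : Submodule ℂ (SymMat m → ℂ) :=
  Submodule.span ℂ
    (Set.range fun L : GL (Fin m) ℝ => fun X : SymMat m => generalizedPower τ (congruence L X))

/-- `C` is the decomposition of `(tr X) ^ t` along the direct sum `⨁_τ V_τ` of all homogeneous
polynomial functions of degree `t` on symmetric matrices. -/
def IsZonalDecomposition (m t : ℕ) (C : (Fin m → ℕ) → SymMat m → ℂ) : Prop :=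
  (∀ τ ∈ partitions m t, C τ ∈ zonalSpace τ) ∧
    ∀ X : SymMat m,
      ∑ τ ∈ partitions m t, C τ X = (X : Matrix (Fin m) (Fin m) ℂ).trace ^ t

open Classical in
/-- The zonal polynomial `C_τ`: the component of `(tr X) ^ t` in `V_τ`, where `t = t₁ + ⋯ + t_m`.
In particular `∑_τ C_τ(X) = (tr X) ^ t`. -/
def zonal {m : ℕ} (τ : Fin m → ℕ) : SymMat m → ℂ :=
  if h : ∃ C, IsZonalDecomposition m (∑ i, τ i) C then h.choose τ else 0

/-- The rising factorial `(b)_t = b (b + 1) ⋯ (b + t - 1)`. -/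
def rising (b : ℂ) (t : ℕ) : ℂ := ∏ j ∈ Finset.range t, (b + j)

/-- `(β)_τ = ∏_{i=1}^m (β - (i - 1) / 2)_{tᵢ}`; here indices start at `0`. -/
def risingPartition {m : ℕ} (β : ℂ) (τ : Fin m → ℕ) : ℂ :=
  ∏ i : Fin m, rising (β - ((i : ℕ) : ℂ) / 2) (τ i)

/-- The `t`-th term of the series `₁P₁(f(t) : a; c; X)`. -/
def oneP1Term {m : ℕ} (f : ℕ → ℂ) (a c : ℂ) (X : SymMat m) (t : ℕ) : ℂ :=
  f t / (t.factorial : ℂ) *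
    ∑ τ ∈ partitions m t, risingPartition a τ / risingPartition c τ * zonal τ X

/-- The series `₁P₁(f(t) : a; c; X) = ∑_t f(t) / t! ∑_τ (a)_τ / (c)_τ C_τ(X)`. -/
def oneP1 {m : ℕ} (f : ℕ → ℂ) (a c : ℂ) (X : SymMat m) : ℂ :=
  ∑' t, oneP1Term f a c X t

/-- The sum of the absolute values of the eigenvalues of `X`, counted with multiplicity. -/
def absEigenvalueSum {m : ℕ} (X : SymMat m) : ℝ :=
  ((X : Matrix (Fin m) (Fin m) ℂ).charpoly.roots.map fun z => ‖z‖).sum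

end KummerPearson

end

/-! The relation is Kummer's transformation `₁F₁(a; c; X) = e^{tr X} ₁F₁(c - a; c; -X)`, split into
homogeneous parts and resummed with weights. If `K_t(a)` is `t!` times the part of degree `t` of
`₁F₁(a; c; ·)`, Kummer reads `K_t(a) = ∑_k (-1)^k (t choose k) (tr X)^(t-k) K_k(c - a)`
(`kummerPoly_eq`). Inserting this, exchanging the sums and summing the binomial series in `j = t -
k` turns `d^(-b-t)` into `(d - tr X)^(-b-k)`.

Zonal polynomials are reached by averaging over a Gaussian matrix `Z`. For `f ∈ V_τ` one has `E f(Z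
N Zᵀ) = f(1) ζ_τ(N)` (`integral_zonalSpace`): `Δ_τ` is multiplicative under lower triangular
congruence, and an orthogonal factor is absorbed by `Z`. For square `Z`, `ζ_τ` is itself an
orthogonally invariant element of `V_τ` (`zonalMean`), and `C_τ` is a multiple of it (`zonal_eq`).
Gaussian integration by parts gives `ζ_τ(1_n) = 2^t (n/2)_τ` (`zeta_one`).

Kummer follows from the operator `R_c = c (x₁ + ⋯ + x_m) + ∑ xᵢ² ∂ᵢ`. Under the map multiplying the
`τ`-component by `(c)_τ`, multiplication by the trace becomes `R_c` (`RisingImage.raise`). For `c =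
n/2` this comes from averaging `tr(W Wᵀ) ζ_τ(W Wᵀ)` in two ways; both sides are polynomial in `c`,
so it holds for all `c`. As `∑ xᵢ² ∂ᵢ` is a derivation, multiplication by `R_a g` is `R_c ∘ g - g ∘
R_{c-a}`; iterating from `g = 1` gives a binomial expansion (`sum_raise_pow`), which is Kummer after
undoing `(c)_τ`.

For convergence, on diagonal matrices `ζ_τ` has nonnegative coefficients by Cauchy–Binet, and the
coefficient of `ζ_τ` in `(tr X)^t` is nonnegative because a suitable kernel is a sum of squares
(`traceCoeff_nonneg`). Hence `∑_τ |C_τ(X)| ≤ (∑ |λᵢ|)^t`, while `(a)_τ / (c)_τ` is `O(r^t)` for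
every `r > 1`.

The exchange of sums is legitimate only for large arguments. A variable `x` is therefore put in
place of `1`; the identity holds for large `|x|`, continues analytically along a ray down to `x =
1`, and survives in the limit because both series converge absolutely at the endpoint
(`tsum_rising_eq`). -/

noncomputable section

namespace KummerPearson

open MeasureTheory ProbabilityTheory

/-! ### Polynomial functions -/

/-- The algebra of polynomial functions in a family of coordinate functions `v`. -/
def polyAlg {σ Ω : Type*} (v : σ → Ω → ℂ) : Subalgebra ℂ (Ω → ℂ) :=
  Algebra.adjoin ℂ (Set.range v)

lemma mem_polyAlg {σ Ω : Type*} {v : σ → Ω → ℂ} {f : Ω → ℂ} :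
    f ∈ polyAlg v ↔ ∃ p : MvPolynomial σ ℂ, ∀ ω, f ω = MvPolynomial.eval (fun i => v i ω) p := by
  have key : ∀ (p : MvPolynomial σ ℂ) ω,
      MvPolynomial.aeval v p ω = MvPolynomial.eval (fun i => v i ω) p := by
    intro p ω
    induction p using MvPolynomial.induction_on with
    | C a => simp
    | add p q hp hq => simp [hp, hq]
    | mul_X p i hp => simp [hp]
  rw [polyAlg, Algebra.adjoin_range_eq_range_aeval]
  constructor
  · rintro ⟨p, rfl⟩
    exact ⟨p, fun ω => key p ω⟩
  · rintro ⟨p, hp⟩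
    exact ⟨p, funext fun ω => (key p ω).trans (hp ω).symm⟩

lemma coord_mem_polyAlg {σ Ω : Type*} (v : σ → Ω → ℂ) (i : σ) : v i ∈ polyAlg v :=
  Algebra.subset_adjoin ⟨i, rfl⟩

lemma const_mem {Ω : Type*} (A : Subalgebra ℂ (Ω → ℂ)) (c : ℂ) : (fun _ => c) ∈ A :=
  A.algebraMap_mem c

lemma sum_fun_mem {Ω ι : Type*} (A : Subalgebra ℂ (Ω → ℂ)) (s : Finset ι) {f : ι → Ω → ℂ}
    (h : ∀ i ∈ s, f i ∈ A) : (fun ω => ∑ i ∈ s, f i ω) ∈ A := by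
  have := A.sum_mem h
  rwa [show (∑ i ∈ s, f i) = fun ω => ∑ i ∈ s, f i ω by ext; simp] at this

lemma prod_fun_mem {Ω ι : Type*} (A : Subalgebra ℂ (Ω → ℂ)) (s : Finset ι) {f : ι → Ω → ℂ}
    (h : ∀ i ∈ s, f i ∈ A) : (fun ω => ∏ i ∈ s, f i ω) ∈ A := by
  have := A.prod_mem h
  rwa [show (∏ i ∈ s, f i) = fun ω => ∏ i ∈ s, f i ω by ext; simp] at this

lemma mul_matrix_mem {Ω l m n : Type*} [Fintype m] (A : Subalgebra ℂ (Ω → ℂ))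
    {M : Ω → Matrix l m ℂ} {N : Ω → Matrix m n ℂ} (hM : ∀ i j, (fun ω => M ω i j) ∈ A)
    (hN : ∀ i j, (fun ω => N ω i j) ∈ A) (i : l) (j : n) : (fun ω => (M ω * N ω) i j) ∈ A := by
  simp only [Matrix.mul_apply]
  exact sum_fun_mem A _ fun k _ => A.mul_mem (hM i k) (hN k j)

lemma mul_mul_matrix_mem {Ω l m n k : Type*} [Fintype m] [Fintype n] (A : Subalgebra ℂ (Ω → ℂ))
    (M : Ω → Matrix l m ℂ) (N : Ω → Matrix m n ℂ) (P : Ω → Matrix n k ℂ)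
    (hM : ∀ i j, (fun ω => M ω i j) ∈ A) (hN : ∀ i j, (fun ω => N ω i j) ∈ A)
    (hP : ∀ i j, (fun ω => P ω i j) ∈ A) (i : l) (j : k) : (fun ω => (M ω * N ω * P ω) i j) ∈ A :=
  mul_matrix_mem (M := fun ω => M ω * N ω) (N := P) A (mul_matrix_mem A hM hN) hP i j

lemma det_mem {Ω n : Type*} [Fintype n] [DecidableEq n] (A : Subalgebra ℂ (Ω → ℂ))
    {M : Ω → Matrix n n ℂ} (hM : ∀ i j, (fun ω => M ω i j) ∈ A) : (fun ω => (M ω).det) ∈ A := by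
  simp only [Matrix.det_apply']
  exact sum_fun_mem A _ fun σ _ =>
    A.mul_mem (const_mem A _) (prod_fun_mem A _ fun i _ => hM (σ i) i)

lemma leadingMinor_mem {Ω : Type*} {m : ℕ} (A : Subalgebra ℂ (Ω → ℂ))
    {M : Ω → Matrix (Fin m) (Fin m) ℂ} (hM : ∀ i j, (fun ω => M ω i j) ∈ A) (i : Fin m) :
    (fun ω => leadingMinor (M ω) i) ∈ A :=
  det_mem A fun _ _ => hM _ _

lemma generalizedPower_mem {Ω : Type*} {m : ℕ} (A : Subalgebra ℂ (Ω → ℂ)) (τ : Fin m → ℕ)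
    {M : Ω → Matrix (Fin m) (Fin m) ℂ} (hM : ∀ i j, (fun ω => M ω i j) ∈ A) :
    (fun ω => generalizedPower τ (M ω)) ∈ A :=
  prod_fun_mem A _ fun i _ => A.pow_mem (leadingMinor_mem A hM i) _

/-- A polynomial function of two groups of variables is a finite sum of products. -/
lemma exists_sum_mul_of_mem_polyAlg {σ₁ σ₂ Ω₁ Ω₂ : Type*} {v₁ : σ₁ → Ω₁ → ℂ} {v₂ : σ₂ → Ω₂ → ℂ}
    {F : Ω₁ × Ω₂ → ℂ}
    (hF : F ∈ polyAlg (Sum.elim (fun i ω => v₁ i ω.1) (fun j ω => v₂ j ω.2) :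
      σ₁ ⊕ σ₂ → Ω₁ × Ω₂ → ℂ)) :
    ∃ (s : Finset ((σ₁ ⊕ σ₂) →₀ ℕ)) (u : ((σ₁ ⊕ σ₂) →₀ ℕ) → Ω₁ → ℂ)
      (w : ((σ₁ ⊕ σ₂) →₀ ℕ) → Ω₂ → ℂ),
      (∀ k, u k ∈ polyAlg v₁) ∧ (∀ k, w k ∈ polyAlg v₂) ∧
        ∀ a b, F (a, b) = ∑ k ∈ s, u k a * w k b := by
  classical
  obtain ⟨p, hp⟩ := mem_polyAlg.1 hF
  refine ⟨p.support,
    fun k a => p.coeff k * ∏ i ∈ k.support.toLeft, v₁ i a ^ k (Sum.inl i),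
    fun k b => ∏ j ∈ k.support.toRight, v₂ j b ^ k (Sum.inr j), fun k => ?_, fun k => ?_, ?_⟩
  · exact Subalgebra.mul_mem _ (const_mem _ _)
      (prod_fun_mem _ _ fun i _ => Subalgebra.pow_mem _ (coord_mem_polyAlg _ _) _)
  · exact prod_fun_mem _ _ fun i _ => Subalgebra.pow_mem _ (coord_mem_polyAlg _ _) _
  · intro a b
    rw [hp, MvPolynomial.eval_eq]
    refine Finset.sum_congr rfl fun k _ => ?_
    rw [mul_assoc]
    congr 1
    conv_lhs => rw [← Finset.toLeft_disjSum_toRight (u := k.support)]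
    rw [Finset.prod_disjSum]
    rfl

/-! ### The Gaussian measure: moments, integration by parts, orthogonal invariance -/

/-- The coordinates of a real vector, as complex numbers. -/
def realCoord (ι : Type*) : ι → (ι → ℝ) → ℂ := fun i z => (z i : ℂ)

/-- The standard Gaussian measure on `ι → ℝ`. -/
def gauss (ι : Type*) [Fintype ι] : Measure (ι → ℝ) := Measure.pi fun _ => gaussianReal 0 1

instance (ι : Type*) [Fintype ι] : IsProbabilityMeasure (gauss ι) := by
  unfold gauss; infer_instance

instance (ι : Type*) [Fintype ι] : (gauss ι).IsOpenPosMeasure := by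
  have : (gaussianReal 0 1).IsOpenPosMeasure :=
    (gaussianReal_absolutelyContinuous' 0 one_ne_zero).isOpenPosMeasure
  unfold gauss; infer_instance

lemma integrable_pow_gaussianReal (k : ℕ) : Integrable (fun x : ℝ => x ^ k) (gaussianReal 0 1) := by
  have h := (memLp_id_gaussianReal (μ := 0) (v := 1) k).integrable_norm_pow'
  rw [← integrable_norm_iff (by fun_prop)]
  simpa using h

/-- Integration by parts against the density `φ`, using `φ'(x) = -x φ(x)`. For `k = 0` the truncated
exponent `k - 1` is harmless because of the factor `k`. -/
lemma gaussian_moment_succ (k : ℕ) :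
    ∫ x : ℝ, x ^ (k + 1) ∂(gaussianReal 0 1) = k * ∫ x : ℝ, x ^ (k - 1) ∂(gaussianReal 0 1) := by
  have hintg : ∀ k : ℕ, Integrable fun x : ℝ => x ^ k * gaussianPDFReal 0 1 x := by
    intro k
    have h := integrable_pow_gaussianReal k
    rw [gaussianReal_of_var_ne_zero _ one_ne_zero,
      integrable_withDensity_iff_integrable_smul' (measurable_gaussianPDF _ _)
        (ae_of_all _ fun _ => gaussianPDF_lt_top)] at h
    refine h.congr (ae_of_all _ fun x => ?_)
    simp [toReal_gaussianPDF, mul_comm]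
  have hd : ∀ x : ℝ, HasDerivAt (gaussianPDFReal 0 1) (-x * gaussianPDFReal 0 1 x) x := by
    intro x
    have hg : gaussianPDFReal 0 1 = fun y => (√(2 * Real.pi))⁻¹ * Real.exp (-y ^ 2 / 2) := by
      ext y; simp [gaussianPDFReal_def]
    have h1 : HasDerivAt (fun x : ℝ => -x ^ 2 / 2) (-x) x := by
      have := ((hasDerivAt_pow 2 x).neg).div_const 2
      refine this.congr_deriv ?_
      norm_num
      ring
    have h2 := (h1.exp).const_mul (√(2 * Real.pi))⁻¹
    rw [hg]
    exact h2.congr_deriv (by ring)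
  have ibp := integral_mul_deriv_eq_deriv_mul_of_integrable (u := fun x : ℝ => x ^ k)
    (u' := fun x => k * x ^ (k - 1)) (v := gaussianPDFReal 0 1)
    (v' := fun x => -x * gaussianPDFReal 0 1 x) (fun x _ => by simpa using hasDerivAt_pow k x)
    (fun x _ => hd x)
    ((hintg (k + 1)).neg.congr (ae_of_all _ fun x => by simp; ring))
    (((hintg (k - 1)).const_mul (k : ℝ)).congr (ae_of_all _ fun x => by simp; ring)) (hintg k)
  rw [integral_gaussianReal_eq_integral_smul one_ne_zero,
    integral_gaussianReal_eq_integral_smul one_ne_zero]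
  have e1 : ∫ x : ℝ, x ^ k * (-x * gaussianPDFReal 0 1 x)
      = -∫ x, gaussianPDFReal 0 1 x • x ^ (k + 1) := by
    rw [← integral_neg]; congr 1; ext x; simp; ring
  have e2 : ∫ x : ℝ, (k * x ^ (k - 1)) * gaussianPDFReal 0 1 x
      = k * ∫ x, gaussianPDFReal 0 1 x • x ^ (k - 1) := by
    rw [← integral_const_mul]; congr 1; ext x; simp; ring
  rw [e1, e2] at ibp
  linarith

section Expectation
variable {ι : Type*} [Fintype ι]

lemma eval_monomial_real (α : ι →₀ ℕ) (c : ℂ) (z : ι → ℝ) :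
    MvPolynomial.eval (fun i => (z i : ℂ)) (MvPolynomial.monomial α c)
      = c * ∏ i, ((z i ^ α i : ℝ) : ℂ) := by
  rw [MvPolynomial.eval_monomial, Finsupp.prod_fintype _ _ (by simp)]
  simp

lemma integrable_monomial (α : ι →₀ ℕ) :
    Integrable (fun z : ι → ℝ => ∏ i, ((z i ^ α i : ℝ) : ℂ)) (gauss ι) :=
  Integrable.fintype_prod (f := fun i (x : ℝ) => ((x ^ α i : ℝ) : ℂ))
    fun i => (integrable_pow_gaussianReal (α i)).ofReal

lemma integrable_eval (p : MvPolynomial ι ℂ) :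
    Integrable (fun z : ι → ℝ => MvPolynomial.eval (fun i => (z i : ℂ)) p) (gauss ι) := by
  induction p using MvPolynomial.induction_on' with
  | monomial α c =>
    simp only [eval_monomial_real]
    exact (integrable_monomial α).const_mul c
  | add p q hp hq =>
    simp only [map_add]
    exact hp.add hq

lemma integrable_of_mem_polyAlg {f : (ι → ℝ) → ℂ} (hf : f ∈ polyAlg (realCoord ι)) :
    Integrable f (gauss ι) := by
  obtain ⟨p, hp⟩ := mem_polyAlg.1 hf
  exact (integrable_eval p).congr (ae_of_all _ fun z => (hp z).symm)

/-- The Gaussian expectation of a polynomial. -/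
def expect (ι : Type*) [Fintype ι] : MvPolynomial ι ℂ →ₗ[ℂ] ℂ where
  toFun p := ∫ z, MvPolynomial.eval (fun i => (z i : ℂ)) p ∂(gauss ι)
  map_add' p q := by
    simp only [map_add]
    exact integral_add (integrable_eval p) (integrable_eval q)
  map_smul' c p := by
    simp only [MvPolynomial.smul_eval, RingHom.id_apply, smul_eq_mul]
    exact integral_const_mul _ _

lemma expect_apply (p : MvPolynomial ι ℂ) :
    expect ι p = ∫ z, MvPolynomial.eval (fun i => (z i : ℂ)) p ∂(gauss ι) := rfl

/-- The product of the Gaussian moments of orders `α i`. -/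
def moments (α : ι →₀ ℕ) : ℂ := ∏ i, ((∫ x : ℝ, x ^ α i ∂(gaussianReal 0 1) : ℝ) : ℂ)

lemma expect_monomial (α : ι →₀ ℕ) (c : ℂ) :
    expect ι (MvPolynomial.monomial α c) = c * moments α := by
  rw [expect_apply]
  simp only [eval_monomial_real]
  rw [integral_const_mul, gauss,
    integral_fintype_prod_eq_prod (f := fun i (x : ℝ) => ((x ^ α i : ℝ) : ℂ))]
  simp only [integral_complex_ofReal, moments]

lemma moments_add_single (α : ι →₀ ℕ) (i : ι) :
    moments (α + Finsupp.single i 1) = α i * moments (α - Finsupp.single i 1) := by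
  classical
  rw [moments, moments, ← Finset.mul_prod_erase _ _ (Finset.mem_univ i),
    ← Finset.mul_prod_erase _ _ (Finset.mem_univ i), ← mul_assoc]
  congr 1
  · simp only [Finsupp.add_apply, Finsupp.single_eq_same, gaussian_moment_succ, Finsupp.tsub_apply]
    push_cast; rfl
  · refine Finset.prod_congr rfl fun j hj => ?_
    have : i ≠ j := (Finset.ne_of_mem_erase hj).symm
    simp [this]

/-- Gaussian integration by parts. -/
lemma expect_X_mul (i : ι) (p : MvPolynomial ι ℂ) :
    expect ι (MvPolynomial.X i * p) = expect ι (MvPolynomial.pderiv i p) := by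
  induction p using MvPolynomial.induction_on' with
  | monomial α c =>
    rw [MvPolynomial.pderiv_monomial, expect_monomial, MvPolynomial.X, MvPolynomial.monomial_mul,
      expect_monomial, add_comm, moments_add_single]
    ring
  | add p q hp hq => simp [mul_add, hp, hq]

end Expectation

/-- Invariance of the Gaussian measure under linear maps preserving the sum of squares. -/
lemma integral_comp_isometry {ι : Type*} [Fintype ι] (A : (ι → ℝ) →ₗ[ℝ] (ι → ℝ))
    (hA : ∀ z, ∑ i, A z i ^ 2 = ∑ i, z i ^ 2) (f : (ι → ℝ) → ℂ) :
    ∫ z, f (A z) ∂(gauss ι) = ∫ z, f z ∂(gauss ι) := by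
  classical
  let e := WithLp.linearEquiv 2 ℝ (ι → ℝ)
  let B : EuclideanSpace ℝ ι →ₗᵢ[ℝ] EuclideanSpace ℝ ι :=
    { toLinearMap := e.symm.toLinearMap ∘ₗ A ∘ₗ e.toLinearMap
      norm_map' := fun x => by
        have := hA (WithLp.ofLp x)
        rw [EuclideanSpace.norm_eq, EuclideanSpace.norm_eq]
        simpa [e] using congrArg Real.sqrt this }
  let B' : EuclideanSpace ℝ ι ≃ₗᵢ[ℝ] EuclideanSpace ℝ ι := B.toLinearIsometryEquiv rfl
  have hmp : MeasurePreserving A (gauss ι) (gauss ι) := by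
    have h1 := stdGaussian_map B'
    rw [← map_pi_eq_stdGaussian, Measure.map_map (by fun_prop) (by fun_prop)] at h1
    have h2 := congrArg (Measure.map (WithLp.ofLp : EuclideanSpace ℝ ι → ι → ℝ)) h1
    rw [Measure.map_map (by fun_prop) (by fun_prop), Measure.map_map (by fun_prop) (by fun_prop)]
      at h2
    refine ⟨A.continuous_of_finiteDimensional.measurable, ?_⟩
    have e1 : ((WithLp.ofLp : EuclideanSpace ℝ ι → ι → ℝ) ∘ B' ∘ WithLp.toLp 2) = A := by
      ext x i; rfl
    have e2 : ((WithLp.ofLp : EuclideanSpace ℝ ι → ι → ℝ) ∘ WithLp.toLp 2) = id := rfl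
    rw [e1, e2, Measure.map_id] at h2
    exact h2
  -- Injectivity makes `A` a closed embedding, so the change of variables needs no measurability of
  -- `f`.
  have hinj : Function.Injective A := by
    intro x y hxy
    have : e.symm x = e.symm y := B.injective (by simp [B, hxy])
    exact e.symm.injective this
  exact hmp.integral_comp
    (LinearMap.isClosedEmbedding_of_injective (LinearMap.ker_eq_bot.2 hinj)).measurableEmbedding f

/-! ### Generalized powers under triangular congruence -/

lemma submatrix_lower_mul {m k : ℕ} {β R : Type*} [CommRing R] (hk : k ≤ m)
    {T : Matrix (Fin m) (Fin m) R} (hT : ∀ i j, i < j → T i j = 0) (N : Matrix (Fin m) β R) :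
    (T * N).submatrix (Fin.castLE hk) id
      = T.submatrix (Fin.castLE hk) (Fin.castLE hk) * N.submatrix (Fin.castLE hk) id := by
  ext a b
  simp only [Matrix.submatrix_apply, Matrix.mul_apply, id]
  symm
  refine Fintype.sum_of_injective (Fin.castLE hk) (Fin.castLE_injective hk) _ _ ?_ fun _ => rfl
  intro j hj
  rw [hT, zero_mul]
  rw [Fin.lt_def]
  by_contra h
  exact hj ⟨⟨j, lt_of_le_of_lt (not_lt.1 h) a.2⟩, by ext; simp⟩

lemma submatrix_conj_lower {m k : ℕ} {R : Type*} [CommRing R] (hk : k ≤ m)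
    {T : Matrix (Fin m) (Fin m) R} (hT : ∀ i j, i < j → T i j = 0)
    (M : Matrix (Fin m) (Fin m) R) :
    (T * M * Tᵀ).submatrix (Fin.castLE hk) (Fin.castLE hk)
      = T.submatrix (Fin.castLE hk) (Fin.castLE hk) * M.submatrix (Fin.castLE hk) (Fin.castLE hk)
        * (T.submatrix (Fin.castLE hk) (Fin.castLE hk))ᵀ := by
  have h1 := submatrix_lower_mul hk hT (M * Tᵀ)
  have h2 := congrArg Matrix.transpose (submatrix_lower_mul hk hT Mᵀ)
  rw [Matrix.mul_assoc, Matrix.mul_assoc]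
  have h3 : (T * (M * Tᵀ)).submatrix (Fin.castLE hk) (Fin.castLE hk)
      = ((T * (M * Tᵀ)).submatrix (Fin.castLE hk) id).submatrix id (Fin.castLE hk) := by simp
  rw [h3, h1]
  have h4 : (M * Tᵀ).submatrix id (Fin.castLE hk)
      = M.submatrix id (Fin.castLE hk) * (T.submatrix (Fin.castLE hk) (Fin.castLE hk))ᵀ := by
    have : (M * Tᵀ) = (T * Mᵀ)ᵀ := by simp
    rw [this, ← Matrix.transpose_submatrix, h2]
    rw [Matrix.transpose_mul, Matrix.transpose_submatrix, Matrix.transpose_transpose]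
  ext a b
  have h5 := fun c => congrFun (congrFun h4 c) b
  simp only [Matrix.submatrix_apply, id] at h5
  simp only [Matrix.submatrix_apply, Matrix.mul_apply (N := (M * Tᵀ).submatrix _ _), id, h5,
    Matrix.mul_apply (M := T.submatrix _ _)]
  rfl

/-- Leading blocks multiply under lower triangular congruence. The factor `det(T_[i])²` is written
as a minor of `T Tᵀ`, which is unchanged when an orthogonal matrix is appended to `T` on the right.
-/
lemma leadingMinor_conj_lower {m : ℕ} {T : Matrix (Fin m) (Fin m) ℂ}
    (hT : ∀ i j, i < j → T i j = 0) (M : Matrix (Fin m) (Fin m) ℂ) (i : Fin m) :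
    leadingMinor (T * M * Tᵀ) i = leadingMinor (T * Tᵀ) i * leadingMinor M i := by
  have h := submatrix_conj_lower (Nat.succ_le_of_lt i.isLt) hT M
  have h1 := submatrix_conj_lower (Nat.succ_le_of_lt i.isLt) hT 1
  rw [Matrix.mul_one, Matrix.submatrix_one _ (Fin.castLE_injective _), Matrix.mul_one] at h1
  rw [leadingMinor, leadingMinor, leadingMinor, h, h1]
  simp only [Matrix.det_mul, Matrix.det_transpose]
  ring

lemma generalizedPower_conj_lower {m : ℕ} (τ : Fin m → ℕ) {T : Matrix (Fin m) (Fin m) ℂ}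
    (hT : ∀ i j, i < j → T i j = 0) (M : Matrix (Fin m) (Fin m) ℂ) :
    generalizedPower τ (T * M * Tᵀ) = generalizedPower τ (T * Tᵀ) * generalizedPower τ M := by
  simp only [generalizedPower, leadingMinor_conj_lower hT, mul_pow, Finset.prod_mul_distrib]

/-- Every real square matrix is the product of a lower triangular and an orthogonal matrix. -/
lemma exists_lower_mul_orthogonal {m : ℕ} (L : Matrix (Fin m) (Fin m) ℝ) :
    ∃ T O : Matrix (Fin m) (Fin m) ℝ, (∀ i j, i < j → T i j = 0) ∧ O * Oᵀ = 1 ∧ L = T * O := by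
  let f : Fin m → EuclideanSpace ℝ (Fin m) := fun i => WithLp.toLp 2 (L i)
  have h : Module.finrank ℝ (EuclideanSpace ℝ (Fin m)) = Fintype.card (Fin m) := by simp
  let b := InnerProductSpace.gramSchmidtOrthonormalBasis h f
  refine ⟨Matrix.of fun i j => inner ℝ (b j) (f i), Matrix.of fun j k => b j k,
    fun i j hij => InnerProductSpace.gramSchmidtOrthonormalBasis_inv_triangular h f hij, ?_, ?_⟩
  · ext i j
    have := b.inner_eq_ite j i
    rw [PiLp.inner_apply] at this
    simp only [Matrix.mul_apply, Matrix.of_apply, Matrix.transpose_apply, Matrix.one_apply]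
    rw [show (if i = j then (1 : ℝ) else 0) = if j = i then 1 else 0 by simp [eq_comm], ← this]
    refine Finset.sum_congr rfl fun k _ => by simp
  · ext i k
    have := congrArg (fun v : EuclideanSpace ℝ (Fin m) => v k) (b.sum_repr' (f i))
    simp only [Matrix.mul_apply, Matrix.of_apply]
    simpa [f] using this.symm

/-! ### Determinant identities: Cauchy–Binet and bordered determinants -/

lemma det_mul_eq_sum {n m R : Type*} [Fintype n] [DecidableEq n] [Fintype m] [DecidableEq m]
    [CommRing R] (A : Matrix n m R) (B : Matrix m n R) :
    (A * B).det = ∑ f : n → m, (∏ k, A k (f k)) * (B.submatrix f id).det := by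
  have h : A * B = fun k => ∑ j, A k j • B j := by
    ext k l; simp [Matrix.mul_apply]
  have := (Matrix.detRowAlternating (n := n) (R := R)).toMultilinearMap.map_sum
    (fun k j => A k j • B j)
  calc (A * B).det = Matrix.detRowAlternating (A * B) := rfl
    _ = _ := by
      rw [h]
      refine this.trans (Finset.sum_congr rfl fun f _ => ?_)
      rw [MultilinearMap.map_smul_univ]
      rfl

/-- The Cauchy–Binet formula, summed over all families of columns. -/
lemma factorial_mul_det_mul {n m R : Type*} [Fintype n] [DecidableEq n] [Fintype m] [DecidableEq m]
    [CommRing R] (A : Matrix n m R) (B : Matrix m n R) :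
    ((Fintype.card n).factorial : R) * (A * B).det
      = ∑ f : n → m, (A.submatrix id f).det * (B.submatrix f id).det := by
  -- Relabelling the columns by `σ` gives one expansion for each permutation; adding all of them
  -- assembles the determinant of `A.submatrix id f`.
  have hσ : ∀ σ : Equiv.Perm n, (A * B).det = ∑ f : n → m,
      ((Equiv.Perm.sign σ : ℤ) : R) * (∏ k, A (σ k) (f k)) * (B.submatrix f id).det := by
    intro σ
    rw [det_mul_eq_sum]
    rw [← (Equiv.arrowCongr σ (Equiv.refl m)).sum_comp]
    refine Finset.sum_congr rfl fun f _ => ?_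
    have e1 : ∏ k, A k ((Equiv.arrowCongr σ (Equiv.refl m)) f k) = ∏ k, A (σ k) (f k) := by
      rw [← Equiv.prod_comp σ]; simp
    have e2 : (B.submatrix f id) = (B.submatrix ((Equiv.arrowCongr σ (Equiv.refl m)) f) id).submatrix
        σ id := by
      ext; simp
    have e3 : ((Equiv.Perm.sign σ : ℤ) : R) * ((Equiv.Perm.sign σ : ℤ) : R) = 1 := by
      rw [← Int.cast_mul, ← Units.val_mul, Int.units_mul_self]; simp
    rw [e1, e2, Matrix.det_permute]
    linear_combination (-(∏ k, A (σ k) (f k)) *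
      (B.submatrix ((Equiv.arrowCongr σ (Equiv.refl m)) f) id).det) * e3
  rw [← Fintype.card_perm, ← nsmul_eq_mul, ← Finset.card_univ, ← Finset.sum_const,
    Finset.sum_congr rfl fun σ _ => hσ σ, Finset.sum_comm]
  refine Finset.sum_congr rfl fun f _ => ?_
  rw [Matrix.det_apply' (A.submatrix id f), Finset.sum_mul]
  rfl

/-- The minors of `A` enter as squares; for real `A` this is the source of all positivity below. -/
lemma factorial_mul_det_conj_diagonal {r m : ℕ} {R : Type*} [CommRing R]
    (A : Matrix (Fin r) (Fin m) R) (x : Fin m → R) :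
    (r.factorial : R) * (A * Matrix.diagonal x * Aᵀ).det
      = ∑ f : Fin r → Fin m, (A.submatrix id f).det ^ 2 * ∏ k, x (f k) := by
  have := factorial_mul_det_mul (A * Matrix.diagonal x) Aᵀ
  rw [Fintype.card_fin] at this
  rw [this]
  refine Finset.sum_congr rfl fun f _ => ?_
  have e1 : (A * Matrix.diagonal x).submatrix id f
      = A.submatrix id f * Matrix.diagonal fun k => x (f k) := by
    ext i j; simp [Matrix.mul_diagonal]
  rw [e1, Matrix.det_mul, Matrix.det_diagonal, ← Matrix.transpose_submatrix, Matrix.det_transpose]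
  ring

/-- A Schur complement without division: multiplying by a block triangular matrix built from the
adjugate introduces a power of `det A` on both sides, cancelled by regularity. -/
lemma det_fromBlocks_of_isRegular {n R : Type*} [Fintype n] [DecidableEq n] [CommRing R]
    (A : Matrix n n R) (hA : IsRegular A.det) (u : Matrix n Unit R) (v : Matrix Unit n R)
    (d : Matrix Unit Unit R) :
    (Matrix.fromBlocks A u v d).det = A.det * d.det - (v * A.adjugate * u).det := by
  have h1 : Matrix.fromBlocks A u v d * Matrix.fromBlocks A.adjugate (-(A.adjugate * u)) 0
      (A.det • 1) = Matrix.fromBlocks (A.det • 1) 0 (v * A.adjugate)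
        (A.det • d - v * A.adjugate * u) := by
    rw [Matrix.fromBlocks_multiply]
    congr 1
    · simp [Matrix.mul_adjugate]
    · simp [← Matrix.mul_assoc, Matrix.mul_adjugate]
    · simp
    · simp [← Matrix.mul_assoc]; abel
  have h2 := congrArg Matrix.det h1
  rw [Matrix.det_mul, Matrix.det_fromBlocks_zero₂₁, Matrix.det_fromBlocks_zero₁₂] at h2
  have h3 : A.adjugate.det * A.det = A.det ^ Fintype.card n := by
    rw [← Matrix.det_mul, Matrix.adjugate_mul, Matrix.det_smul, Matrix.det_one, mul_one]
  simp only [Matrix.det_unique, Matrix.smul_apply, Matrix.one_apply, Matrix.sub_apply, smul_eq_mul,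
    Matrix.det_smul, Matrix.det_one, mul_one, if_true] at h2 ⊢
  rw [h3, mul_comm] at h2
  exact (hA.pow _).left h2

/-- Regularity is removed by passing to `A + X` over the polynomial ring, whose determinant is
monic, and then setting `X = 0`. -/
lemma det_fromBlocks_unit {n R : Type*} [Fintype n] [DecidableEq n] [CommRing R]
    (A : Matrix n n R) (u : Matrix n Unit R) (v : Matrix Unit n R) (d : Matrix Unit Unit R) :
    (Matrix.fromBlocks A u v d).det = A.det * d.det - (v * A.adjugate * u).det := by
  let A' : Matrix n n (Polynomial R) := A.map Polynomial.C + (Polynomial.X : Polynomial R) • 1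
  have hA' : IsRegular A'.det := by
    refine Polynomial.Monic.isRegular ?_
    simp only [A', Polynomial.Monic.def, ← Polynomial.leadingCoeff_det_X_one_add_C A, add_comm]
  let φ := Polynomial.evalRingHom (0 : R)
  have h := congrArg φ (det_fromBlocks_of_isRegular A' hA' (u.map Polynomial.C)
    (v.map Polynomial.C) (d.map Polynomial.C))
  have eA : φ.mapMatrix A' = A := by ext; simp [A', φ]
  have e1 : φ.mapMatrix (Matrix.fromBlocks A' (u.map Polynomial.C) (v.map Polynomial.C)
      (d.map Polynomial.C)) = Matrix.fromBlocks A u v d := by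
    ext i j
    rcases i with i | i <;> rcases j with j | j <;> simp [A', φ]
  have ed : φ.mapMatrix (d.map Polynomial.C) = d := by ext; simp [φ]
  rw [map_sub, map_mul, RingHom.map_det, RingHom.map_det, RingHom.map_det, RingHom.map_det, e1, eA,
    ed] at h
  rw [h]
  congr 2
  have eu : (u.map Polynomial.C).map φ = u := by ext; simp [φ]
  have ev : (v.map Polynomial.C).map φ = v := by ext; simp [φ]
  rw [RingHom.mapMatrix_apply, Matrix.map_mul, Matrix.map_mul, eu, ev, ← RingHom.mapMatrix_apply,
    RingHom.map_adjugate, eA]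

/-- Expansion of a determinant along its last row and column. -/
lemma det_bordered {r : ℕ} {R : Type*} [CommRing R] (M : Matrix (Fin (r + 1)) (Fin (r + 1)) R) :
    M.det = (M.submatrix Fin.castSucc Fin.castSucc).det * M (Fin.last r) (Fin.last r)
      - ∑ a, ∑ b, M (Fin.last r) (Fin.castSucc a)
        * (M.submatrix Fin.castSucc Fin.castSucc).adjugate a b * M (Fin.castSucc b) (Fin.last r) := by
  let e : Fin r ⊕ Unit ≃ Fin (r + 1) :=
    (finSuccEquivLast.trans (Equiv.optionEquivSumPUnit (Fin r))).symm
  have he1 : ∀ a, e (Sum.inl a) = Fin.castSucc a := fun a => by simp [e]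
  have he2 : ∀ a, e (Sum.inr a) = Fin.last r := fun a => by simp [e]
  rw [← Matrix.det_submatrix_equiv_self e M]
  have : M.submatrix e e = Matrix.fromBlocks (M.submatrix Fin.castSucc Fin.castSucc)
      (Matrix.of fun a _ => M (Fin.castSucc a) (Fin.last r))
      (Matrix.of fun _ a => M (Fin.last r) (Fin.castSucc a))
      (Matrix.of fun _ _ => M (Fin.last r) (Fin.last r)) := by
    ext i j
    rcases i with i | i <;> rcases j with j | j <;> simp [he1, he2]
  rw [this, det_fromBlocks_unit]
  simp only [Matrix.det_unique, Matrix.of_apply]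
  congr 1
  simp only [Matrix.mul_apply, Matrix.of_apply, Finset.sum_mul]
  rw [Finset.sum_comm]

/-! ### Gaussian congruences and the mean value property of `V_τ` -/

/-- A real matrix, given by its entries, as a complex matrix. -/
def gmat {m n : ℕ} (z : Fin m × Fin n → ℝ) : Matrix (Fin m) (Fin n) ℂ :=
  Matrix.of fun i j => (z (i, j) : ℂ)

/-- The congruence `X ↦ Z X Zᵀ` of symmetric matrices by a rectangular matrix. -/
def symCong {m n : ℕ} (Z : Matrix (Fin m) (Fin n) ℂ) (X : SymMat n) : SymMat m :=
  ⟨Z * (X : Matrix (Fin n) (Fin n) ℂ) * Zᵀ, by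
    have hX : (X : Matrix (Fin n) (Fin n) ℂ)ᵀ = X := X.2
    change (Z * (X : Matrix (Fin n) (Fin n) ℂ) * Zᵀ)ᵀ = _
    rw [Matrix.transpose_mul, Matrix.transpose_mul, Matrix.transpose_transpose, hX,
      Matrix.mul_assoc]⟩

lemma coe_symCong {m n : ℕ} (Z : Matrix (Fin m) (Fin n) ℂ) (X : SymMat n) :
    (symCong Z X : Matrix (Fin m) (Fin m) ℂ) = Z * (X : Matrix (Fin n) (Fin n) ℂ) * Zᵀ := rfl

lemma symCong_mul {l m n : ℕ} (Y : Matrix (Fin l) (Fin m) ℂ) (Z : Matrix (Fin m) (Fin n) ℂ)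
    (X : SymMat n) : symCong (Y * Z) X = symCong Y (symCong Z X) := by
  apply Subtype.ext
  simp only [coe_symCong, Matrix.transpose_mul, Matrix.mul_assoc]

/-- Diagonal matrices as symmetric matrices. -/
def symDiag {m : ℕ} (x : Fin m → ℂ) : SymMat m :=
  ⟨Matrix.diagonal x, Matrix.diagonal_transpose x⟩

lemma coe_symDiag {m : ℕ} (x : Fin m → ℂ) :
    (symDiag x : Matrix (Fin m) (Fin m) ℂ) = Matrix.diagonal x := rfl

lemma coe_symDiag_one {m : ℕ} :
    (symDiag (fun _ => 1) : SymMat m) = (1 : Matrix (Fin m) (Fin m) ℂ) := by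
  simp [coe_symDiag]

/-- The entries of a symmetric matrix. -/
def symCoord (m : ℕ) : Fin m × Fin m → SymMat m → ℂ :=
  fun ij X => (X : Matrix (Fin m) (Fin m) ℂ) ij.1 ij.2

lemma zonalSpace_le_polyAlg {m : ℕ} (τ : Fin m → ℕ) {f : SymMat m → ℂ} (hf : f ∈ zonalSpace τ) :
    f ∈ polyAlg (symCoord m) := by
  have : zonalSpace τ ≤ Subalgebra.toSubmodule (polyAlg (symCoord m)) := by
    refine Submodule.span_le.2 ?_
    rintro _ ⟨L, rfl⟩
    refine generalizedPower_mem _ τ fun i j => ?_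
    exact mul_mul_matrix_mem _ (fun _ => (L : Matrix (Fin m) (Fin m) ℝ).map Complex.ofReal)
      (fun X : SymMat m => (X : Matrix (Fin m) (Fin m) ℂ))
      (fun _ => ((L : Matrix (Fin m) (Fin m) ℝ).map Complex.ofReal)ᵀ)
      (fun i j => const_mem _ _) (fun i j => coord_mem_polyAlg (symCoord m) (i, j))
      (fun i j => const_mem _ _) i j
  exact this hf

/-- Polynomial functions of a symmetric matrix become polynomial functions of any parameter on
which the entries depend polynomially. -/
lemma comp_mem_of_mem_polyAlg {Ω : Type*} {m : ℕ} (A : Subalgebra ℂ (Ω → ℂ)) {f : SymMat m → ℂ}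
    (hf : f ∈ polyAlg (symCoord m)) {Y : Ω → SymMat m}
    (hY : ∀ i j, (fun ω => (Y ω : Matrix (Fin m) (Fin m) ℂ) i j) ∈ A) :
    (fun ω => f (Y ω)) ∈ A := by
  let φ : (SymMat m → ℂ) →ₐ[ℂ] (Ω → ℂ) :=
    { toFun := fun f ω => f (Y ω)
      map_one' := rfl
      map_mul' := fun _ _ => rfl
      map_zero' := rfl
      map_add' := fun _ _ => rfl
      commutes' := fun _ => rfl }
  have key : f ∈ A.comap φ := by
    refine Algebra.adjoin_le ?_ hf
    rintro _ ⟨ij, rfl⟩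
    exact hY ij.1 ij.2
  exact key

lemma gmat_mem {m n : ℕ} (i : Fin m) (j : Fin n) :
    (fun z : Fin m × Fin n → ℝ => gmat z i j) ∈ polyAlg (realCoord (Fin m × Fin n)) :=
  coord_mem_polyAlg (realCoord (Fin m × Fin n)) (i, j)

lemma symCong_gmat_mem {m n : ℕ} (N : SymMat n) (i j : Fin m) :
    (fun z : Fin m × Fin n → ℝ => (symCong (gmat z) N : Matrix (Fin m) (Fin m) ℂ) i j) ∈
      polyAlg (realCoord (Fin m × Fin n)) :=
  mul_mul_matrix_mem _ (fun z => gmat z) (fun _ => (N : Matrix (Fin n) (Fin n) ℂ))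
    (fun z => (gmat z)ᵀ) gmat_mem (fun _ _ => const_mem _ _) (fun i j => gmat_mem j i) i j

lemma integrable_comp_symCong {k m n : ℕ} {f : SymMat k → ℂ} (hf : f ∈ polyAlg (symCoord k))
    (L : Matrix (Fin k) (Fin m) ℂ) (N : SymMat n) :
    Integrable (fun z : Fin m × Fin n → ℝ => f (symCong L (symCong (gmat z) N)))
      (gauss (Fin m × Fin n)) := by
  refine integrable_of_mem_polyAlg
    (comp_mem_of_mem_polyAlg (polyAlg (realCoord (Fin m × Fin n))) hf
      (Y := fun z => symCong L (symCong (gmat z) N)) fun i j => ?_)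
  have := mul_mul_matrix_mem (polyAlg (realCoord (Fin m × Fin n))) (fun _ => L)
    (fun z => (symCong (gmat z) N : Matrix (Fin m) (Fin m) ℂ)) (fun _ => Lᵀ)
    (fun _ _ => const_mem _ _) (fun i j => symCong_gmat_mem N i j) (fun _ _ => const_mem _ _) i j
  exact this

/-- The mean of `Δ_τ(Z N Zᵀ)` for a Gaussian matrix `Z`. -/
def zeta {m n : ℕ} (τ : Fin m → ℕ) (N : SymMat n) : ℂ :=
  ∫ z, generalizedPower τ (symCong (gmat z) N : Matrix (Fin m) (Fin m) ℂ)
    ∂(gauss (Fin m × Fin n))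

lemma sum_sq_left_orthogonal {m n : ℕ} {O : Matrix (Fin m) (Fin m) ℝ} (hO : O * Oᵀ = 1)
    (Z : Matrix (Fin m) (Fin n) ℝ) :
    ∑ ij : Fin m × Fin n, (O * Z) ij.1 ij.2 ^ 2 = ∑ ij : Fin m × Fin n, Z ij.1 ij.2 ^ 2 := by
  have h : ∀ M : Matrix (Fin m) (Fin n) ℝ,
      ∑ ij : Fin m × Fin n, M ij.1 ij.2 ^ 2 = (Mᵀ * M).trace := by
    intro M
    rw [Fintype.sum_prod_type, Finset.sum_comm]
    simp [Matrix.trace, Matrix.mul_apply, sq]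
  rw [h, h, Matrix.transpose_mul, Matrix.mul_assoc, ← Matrix.mul_assoc Oᵀ,
    mul_eq_one_comm.1 hO, Matrix.one_mul]

lemma integral_left_orthogonal {m n : ℕ} {O : Matrix (Fin m) (Fin m) ℝ} (hO : O * Oᵀ = 1)
    (F : Matrix (Fin m) (Fin n) ℂ → ℂ) :
    ∫ z, F (O.map Complex.ofReal * gmat z) ∂(gauss (Fin m × Fin n))
      = ∫ z, F (gmat z) ∂(gauss (Fin m × Fin n)) := by
  let A : (Fin m × Fin n → ℝ) →ₗ[ℝ] (Fin m × Fin n → ℝ) :=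
    { toFun := fun z ij => (O * Matrix.of fun i j => z (i, j)) ij.1 ij.2
      map_add' := fun x y => by
        ext ij; simp [Matrix.mul_apply, mul_add, Finset.sum_add_distrib]
      map_smul' := fun c x => by
        ext ij; simp [Matrix.mul_apply, Finset.mul_sum, mul_left_comm] }
  have h := integral_comp_isometry A (fun z => sum_sq_left_orthogonal hO _) (fun z => F (gmat z))
  rw [← h]
  refine integral_congr_ae (ae_of_all _ fun z => congrArg F ?_)
  ext i j
  simp [gmat, A, Matrix.mul_apply]

lemma integral_transpose {m n : ℕ} (F : Matrix (Fin m) (Fin n) ℂ → ℂ) :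
    ∫ z, F (gmat z)ᵀ ∂(gauss (Fin n × Fin m)) = ∫ z, F (gmat z) ∂(gauss (Fin m × Fin n)) := by
  have h := measurePreserving_piCongrLeft (fun _ : Fin m × Fin n => gaussianReal 0 1)
    (Equiv.prodComm (Fin n) (Fin m))
  have h2 := h.integral_comp' (fun z : Fin m × Fin n → ℝ => F (gmat z))
  rw [gauss, gauss, ← h2]
  refine integral_congr_ae (ae_of_all _ fun z => congrArg F ?_)
  ext i j
  rw [Matrix.transpose_apply, gmat, gmat, Matrix.of_apply, Matrix.of_apply]
  exact congrArg _ (Equiv.piCongrLeft_apply_apply (fun _ => ℝ) (Equiv.prodComm (Fin n) (Fin m)) z (j, i)).symm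

lemma integral_right_orthogonal {m n : ℕ} {O : Matrix (Fin n) (Fin n) ℝ} (hO : O * Oᵀ = 1)
    (F : Matrix (Fin m) (Fin n) ℂ → ℂ) :
    ∫ z, F (gmat z * O.map Complex.ofReal) ∂(gauss (Fin m × Fin n))
      = ∫ z, F (gmat z) ∂(gauss (Fin m × Fin n)) := by
  have hO' : Oᵀ * (Oᵀ)ᵀ = 1 := by rw [Matrix.transpose_transpose]; exact mul_eq_one_comm.1 hO
  rw [← integral_transpose F, ← integral_transpose fun Z => F (Z * O.map Complex.ofReal),
    ← integral_left_orthogonal hO' fun Z => F Zᵀ]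
  refine integral_congr_ae (ae_of_all _ fun z => congrArg F ?_)
  rw [Matrix.transpose_mul, Matrix.transpose_map, Matrix.transpose_transpose]

/-- The mean of `f(Z N Zᵀ)` for `f = Δ_τ(L · Lᵀ)`. -/
lemma integral_generalizedPower_conj {m n : ℕ} (τ : Fin m → ℕ) (L : Matrix (Fin m) (Fin m) ℝ)
    (N : SymMat n) :
    ∫ z, generalizedPower τ (L.map Complex.ofReal *
        (symCong (gmat z) N : Matrix (Fin m) (Fin m) ℂ) * (L.map Complex.ofReal)ᵀ)
        ∂(gauss (Fin m × Fin n))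
      = generalizedPower τ (L.map Complex.ofReal * (L.map Complex.ofReal)ᵀ) * zeta τ N := by
  obtain ⟨T, O, hT, hO, rfl⟩ := exists_lower_mul_orthogonal L
  have hT' : ∀ i j, i < j → T.map Complex.ofReal i j = 0 := fun i j h => by simp [hT i j h]
  have hO' : O.map Complex.ofReal * (O.map Complex.ofReal)ᵀ = 1 := by
    rw [← Matrix.transpose_map]
    have := congrArg (Complex.ofRealHom.mapMatrix) hO
    rw [map_mul, map_one] at this
    exact this
  have hmap : (T * O).map Complex.ofReal = T.map Complex.ofReal * O.map Complex.ofReal :=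
    map_mul (Complex.ofRealHom.mapMatrix) T O
  -- Invariance lets `O` be inserted in the integral for `ζ_τ`; the two integrands then differ only
  -- by the congruence with `T`, which pulls out as a constant.
  rw [zeta, ← integral_left_orthogonal hO fun Z => generalizedPower τ (symCong Z N), hmap,
    ← integral_const_mul]
  refine integral_congr_ae (ae_of_all _ fun z => ?_)
  simp only [coe_symCong]
  have e1 : T.map Complex.ofReal * O.map Complex.ofReal *
      (T.map Complex.ofReal * O.map Complex.ofReal)ᵀ = T.map Complex.ofReal * (T.map Complex.ofReal)ᵀ := by
    rw [Matrix.transpose_mul, Matrix.mul_assoc, ← Matrix.mul_assoc _ _ (T.map Complex.ofReal)ᵀ, hO',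
      Matrix.one_mul]
  rw [e1, ← generalizedPower_conj_lower τ hT']
  simp only [Matrix.transpose_mul, Matrix.mul_assoc]

/-- The mean value property of the elements of `V_τ`. -/
lemma integral_zonalSpace {m n : ℕ} {τ : Fin m → ℕ} {f : SymMat m → ℂ} (hf : f ∈ zonalSpace τ)
    (N : SymMat n) :
    ∫ z, f (symCong (gmat z) N) ∂(gauss (Fin m × Fin n)) = f (symDiag fun _ => 1) * zeta τ N := by
  have hintg : ∀ f ∈ zonalSpace τ, Integrable (fun z : Fin m × Fin n → ℝ => f (symCong (gmat z) N))
      (gauss (Fin m × Fin n)) := fun f hf =>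
    integrable_of_mem_polyAlg (comp_mem_of_mem_polyAlg _ (zonalSpace_le_polyAlg τ hf)
      (symCong_gmat_mem N))
  refine Submodule.span_induction (p := fun f _ =>
    ∫ z, f (symCong (gmat z) N) ∂(gauss (Fin m × Fin n)) = f (symDiag fun _ => 1) * zeta τ N)
    ?_ ?_ ?_ ?_ hf
  · rintro _ ⟨L, rfl⟩
    simp only [congruence]
    rw [integral_generalizedPower_conj, coe_symDiag_one, Matrix.mul_one]
  · simp
  · intro f g hf hg h1 h2
    simp only [Pi.add_apply]
    rw [integral_add (hintg f hf) (hintg g hg), h1, h2]; ring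
  · intro c f _ h
    simp only [Pi.smul_apply, smul_eq_mul]
    rw [integral_const_mul, h]; ring

/-- Stability of `V_τ` under congruence moves the mean value property from the identity to any `L
Lᵀ`. -/
lemma comp_symCong_mem_zonalSpace {m : ℕ} {τ : Fin m → ℕ} {f : SymMat m → ℂ}
    (hf : f ∈ zonalSpace τ) (L : GL (Fin m) ℝ) :
    (fun X => f (symCong ((L : Matrix (Fin m) (Fin m) ℝ).map Complex.ofReal) X)) ∈ zonalSpace τ := by
  refine Submodule.span_induction (p := fun f _ =>
    (fun X => f (symCong ((L : Matrix (Fin m) (Fin m) ℝ).map Complex.ofReal) X)) ∈ zonalSpace τ)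
    ?_ ?_ ?_ ?_ hf
  · rintro _ ⟨K, rfl⟩
    refine Submodule.subset_span ⟨K * L, ?_⟩
    ext X
    simp only [congruence, coe_symCong]
    have : ((K * L : GL (Fin m) ℝ) : Matrix (Fin m) (Fin m) ℝ).map Complex.ofReal
        = (K : Matrix (Fin m) (Fin m) ℝ).map Complex.ofReal
          * (L : Matrix (Fin m) (Fin m) ℝ).map Complex.ofReal :=
      map_mul (Complex.ofRealHom.mapMatrix) _ _
    rw [this]
    simp only [Matrix.transpose_mul, Matrix.mul_assoc]
  · exact Submodule.zero_mem _
  · intro f g _ _ h1 h2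
    exact Submodule.add_mem _ h1 h2
  · intro c f _ h
    exact Submodule.smul_mem _ c h

/-- The mean value property at `L Lᵀ`. -/
lemma integral_zonalSpace_conj {m n : ℕ} {τ : Fin m → ℕ} {f : SymMat m → ℂ} (hf : f ∈ zonalSpace τ)
    (L : GL (Fin m) ℝ) (N : SymMat n) :
    ∫ z, f (symCong ((L : Matrix (Fin m) (Fin m) ℝ).map Complex.ofReal) (symCong (gmat z) N))
        ∂(gauss (Fin m × Fin n))
      = f (symCong ((L : Matrix (Fin m) (Fin m) ℝ).map Complex.ofReal) (symDiag fun _ => 1))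
        * zeta τ N :=
  integral_zonalSpace (comp_symCong_mem_zonalSpace hf L) N

/-! ### Moments of Gram determinants, row by row -/

section GramMinors
variable (m n : ℕ)

/-- The entries of the generic `m × n` matrix, extended by zero rows. -/
def genEntry (a : ℕ) (j : Fin n) : MvPolynomial (Fin m × Fin n) ℂ :=
  if h : a < m then MvPolynomial.X (⟨a, h⟩, j) else 0

/-- The first `r` rows of the generic matrix. -/
def genRows (r : ℕ) : Matrix (Fin r) (Fin n) (MvPolynomial (Fin m × Fin n) ℂ) :=
  Matrix.of fun a j => genEntry m n a j

/-- The Gram determinant of the first `r` rows of the generic matrix. -/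
def gramMinor (r : ℕ) : MvPolynomial (Fin m × Fin n) ℂ :=
  (genRows m n r * (genRows m n r)ᵀ).det

/-- The subalgebra of polynomials in the first `r` rows. -/
def rowAlg (r : ℕ) : Subalgebra ℂ (MvPolynomial (Fin m × Fin n) ℂ) :=
  Algebra.adjoin ℂ {p | ∃ a < r, ∃ j, p = genEntry m n a j}

/-- The quadratic form in the next row whose value is the next Gram determinant. -/
def gramForm (r : ℕ) : Matrix (Fin n) (Fin n) (MvPolynomial (Fin m × Fin n) ℂ) :=
  gramMinor m n r • 1
    - (genRows m n r)ᵀ * (genRows m n r * (genRows m n r)ᵀ).adjugate * genRows m n r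

variable {m n}

lemma genEntry_mem_rowAlg {r a : ℕ} (ha : a < r) (j : Fin n) :
    genEntry m n a j ∈ rowAlg m n r :=
  Algebra.subset_adjoin ⟨a, ha, j, rfl⟩

lemma rowAlg_mono {r s : ℕ} (h : r ≤ s) : rowAlg m n r ≤ rowAlg m n s :=
  Algebra.adjoin_mono fun _ ⟨a, ha, j, hp⟩ => ⟨a, ha.trans_le h, j, hp⟩

/-- Once the Gram matrix is lifted to the subalgebra, its determinant and adjugate visibly involve
the first `r` rows only. -/
lemma exists_lift_gram (r : ℕ) : ∃ A : Matrix (Fin r) (Fin r) (rowAlg m n r),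
    (rowAlg m n r).val.toRingHom.mapMatrix A = genRows m n r * (genRows m n r)ᵀ := by
  let W : Matrix (Fin r) (Fin n) (rowAlg m n r) :=
    Matrix.of fun a j => ⟨genEntry m n a j, genEntry_mem_rowAlg a.2 j⟩
  refine ⟨W * Wᵀ, ?_⟩
  ext1 a b
  simp [Matrix.mul_apply, W, genRows]

lemma gramMinor_mem (r : ℕ) : gramMinor m n r ∈ rowAlg m n r := by
  obtain ⟨A, hA⟩ := exists_lift_gram (m := m) (n := n) r
  rw [gramMinor, ← hA, ← RingHom.map_det]
  exact A.det.2

lemma gramForm_mem (r : ℕ) (j l : Fin n) : gramForm m n r j l ∈ rowAlg m n r := by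
  obtain ⟨A, hA⟩ := exists_lift_gram (m := m) (n := n) r
  have hadj : ∀ a b, (genRows m n r * (genRows m n r)ᵀ).adjugate a b ∈ rowAlg m n r := by
    intro a b
    rw [← hA, ← RingHom.map_adjugate]
    exact (A.adjugate a b).2
  rw [gramForm, Matrix.sub_apply, Matrix.smul_apply]
  refine Subalgebra.sub_mem _ (Subalgebra.mul_mem _ (gramMinor_mem r) ?_) ?_
  · rw [Matrix.one_apply]
    split_ifs
    exacts [Subalgebra.one_mem _, Subalgebra.zero_mem _]
  · simp only [Matrix.mul_apply, Matrix.transpose_apply]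
    exact Subalgebra.sum_mem _ fun b _ => Subalgebra.mul_mem _ (Subalgebra.sum_mem _ fun a _ =>
      Subalgebra.mul_mem _ (genEntry_mem_rowAlg a.2 j) (hadj a b)) (genEntry_mem_rowAlg b.2 l)

lemma pderiv_eq_zero_of_mem_rowAlg {r : ℕ} (hr : r < m) (j : Fin n)
    {p : MvPolynomial (Fin m × Fin n) ℂ} (hp : p ∈ rowAlg m n r) :
    MvPolynomial.pderiv (⟨r, hr⟩, j) p = 0 := by
  have : Set.EqOn (MvPolynomial.pderiv (R := ℂ) ((⟨r, hr⟩ : Fin m), j))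
      (0 : Derivation ℂ (MvPolynomial (Fin m × Fin n) ℂ) (MvPolynomial (Fin m × Fin n) ℂ))
      (rowAlg m n r) := by
    refine Derivation.eqOn_adjoin ?_
    rintro _ ⟨a, ha, l, rfl⟩
    have ham : a < m := ha.trans hr
    rw [genEntry, dif_pos ham, MvPolynomial.pderiv_X_of_ne]
    · rfl
    · intro h
      simp only [Prod.mk.injEq, Fin.mk.injEq] at h
      omega
  exact this hp

lemma gramForm_transpose (r : ℕ) : (gramForm m n r)ᵀ = gramForm m n r := by
  have h : ((genRows m n r * (genRows m n r)ᵀ).adjugate)ᵀ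
      = (genRows m n r * (genRows m n r)ᵀ).adjugate := by
    rw [Matrix.adjugate_transpose, Matrix.transpose_mul, Matrix.transpose_transpose]
  rw [gramForm, Matrix.transpose_sub, Matrix.transpose_smul, Matrix.transpose_one,
    Matrix.transpose_mul, Matrix.transpose_mul, Matrix.transpose_transpose, h, Matrix.mul_assoc]

/-- `gramForm` is `gramMinor` times the orthogonal projection onto the complement of the span of the
first `r` rows, with denominators cleared. This identity and `trace_gramForm` express its
idempotence and its rank `n - r`. -/
lemma gramForm_mul_self (r : ℕ) :
    gramForm m n r * gramForm m n r = gramMinor m n r • gramForm m n r := by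
  have h : genRows m n r * (genRows m n r)ᵀ * (genRows m n r * (genRows m n r)ᵀ).adjugate
      = gramMinor m n r • 1 := Matrix.mul_adjugate _
  have hP : (genRows m n r)ᵀ * (genRows m n r * (genRows m n r)ᵀ).adjugate * genRows m n r *
      ((genRows m n r)ᵀ * (genRows m n r * (genRows m n r)ᵀ).adjugate * genRows m n r)
      = gramMinor m n r •
        ((genRows m n r)ᵀ * (genRows m n r * (genRows m n r)ᵀ).adjugate * genRows m n r) := by
    calc _ = (genRows m n r)ᵀ * (genRows m n r * (genRows m n r)ᵀ).adjugate *
        (genRows m n r * (genRows m n r)ᵀ * (genRows m n r * (genRows m n r)ᵀ).adjugate)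
          * genRows m n r := by simp only [Matrix.mul_assoc]
      _ = _ := by rw [h]; simp [Matrix.mul_assoc]
  rw [gramForm]
  generalize (genRows m n r)ᵀ * (genRows m n r * (genRows m n r)ᵀ).adjugate * genRows m n r = P
    at hP ⊢
  rw [sub_mul, mul_sub, mul_sub, hP]
  simp [smul_sub]

lemma trace_gramForm (r : ℕ) :
    (gramForm m n r).trace = ((n : ℂ) - r) • gramMinor m n r := by
  rw [gramForm, Matrix.trace_sub, Matrix.trace_smul, Matrix.trace_one, Matrix.mul_assoc,
    Matrix.trace_mul_comm, Matrix.mul_assoc, Matrix.adjugate_mul, Matrix.trace_smul,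
    Matrix.trace_one, gramMinor]
  simp only [Fintype.card_fin, smul_eq_mul, MvPolynomial.smul_eq_C_mul, map_sub, map_natCast]
  ring

/-- The bordered determinant formula: the new Gram determinant is the old one times the squared
distance of the new row from the span of the earlier rows. -/
lemma gramMinor_succ (r : ℕ) :
    gramMinor m n (r + 1)
      = ∑ j, ∑ l, genEntry m n r j * gramForm m n r j l * genEntry m n r l := by
  have hsub : (genRows m n (r + 1) * (genRows m n (r + 1))ᵀ).submatrix Fin.castSucc Fin.castSucc
      = genRows m n r * (genRows m n r)ᵀ := by
    ext1 a b; simp [Matrix.mul_apply, genRows]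
  rw [gramMinor, det_bordered, hsub, ← gramMinor]
  generalize hB : (genRows m n r * (genRows m n r)ᵀ).adjugate = B
  set W := genRows m n r with hW
  set v : Fin n → MvPolynomial (Fin m × Fin n) ℂ := genEntry m n r with hv
  have hu : ∀ a, ∑ j, v j * W a j = (W *ᵥ v) a := fun a => by
    simp [Matrix.mulVec, dotProduct, mul_comm]
  have hl : ∀ a : Fin r, (genRows m n (r + 1) * (genRows m n (r + 1))ᵀ) (Fin.last r)
      (Fin.castSucc a) = (W *ᵥ v) a := fun a => by
    rw [← hu]; simp [Matrix.mul_apply, genRows, hW, hv]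
  have hl' : ∀ a : Fin r, (genRows m n (r + 1) * (genRows m n (r + 1))ᵀ) (Fin.castSucc a)
      (Fin.last r) = (W *ᵥ v) a := fun a => by
    rw [← hu]; simp [Matrix.mul_apply, genRows, hW, hv, mul_comm]
  have hll : (genRows m n (r + 1) * (genRows m n (r + 1))ᵀ) (Fin.last r) (Fin.last r) = v ⬝ᵥ v := by
    simp [Matrix.mul_apply, genRows, hv, dotProduct]
  simp only [hl, hl', hll]
  have e1 : ∑ a, ∑ b, (W *ᵥ v) a * B a b * (W *ᵥ v) b = v ⬝ᵥ ((Wᵀ * B * W) *ᵥ v) := by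
    rw [← Matrix.mulVec_mulVec, ← Matrix.mulVec_mulVec, Matrix.dotProduct_mulVec,
      Matrix.vecMul_transpose]
    simp [dotProduct, Matrix.mulVec, Finset.mul_sum, mul_assoc]
  have e2 : ∑ j, ∑ l, v j * gramForm m n r j l * v l = v ⬝ᵥ (gramForm m n r *ᵥ v) := by
    simp [dotProduct, Matrix.mulVec, Finset.mul_sum, mul_assoc]
  rw [e1, e2, gramForm, ← hW, hB, Matrix.sub_mulVec, dotProduct_sub, Matrix.smul_mulVec,
    Matrix.one_mulVec, dotProduct_smul, smul_eq_mul]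

lemma derivation_mul_pow_mul {R : Type*} [CommRing R] [Algebra ℂ R] (D : Derivation ℂ R R)
    {A B q h : R} (k : ℕ) (hA : D A = B) (hq : D q = 2 * A) (hh : D h = 0) :
    D (A * (q ^ k * h)) = B * (q ^ k * h) + (2 * k : ℂ) • (A * A * (q ^ (k - 1) * h)) := by
  rw [Derivation.leibniz, Derivation.leibniz, Derivation.leibniz_pow, hA, hq, hh]
  simp only [nsmul_eq_mul, smul_eq_mul, Algebra.smul_def (_ : ℂ), map_mul, map_natCast, map_ofNat]
  ring

/-- Gaussian integration by parts in the row following the first `r` rows. -/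
lemma expect_gramMinor_pow_succ {r : ℕ} (hr : r < m) (k : ℕ) {h : MvPolynomial (Fin m × Fin n) ℂ}
    (hh : h ∈ rowAlg m n r) :
    expect _ (gramMinor m n (r + 1) ^ (k + 1) * h)
      = ((n : ℂ) - r + 2 * k) * expect _ (gramMinor m n (r + 1) ^ k * (gramMinor m n r * h)) := by
  set q := gramMinor m n (r + 1) with hq
  set Q := gramForm m n r with hQ
  have hx : ∀ j, genEntry m n r j = MvPolynomial.X (⟨r, hr⟩, j) := fun j => dif_pos hr
  let v : Fin n → MvPolynomial (Fin m × Fin n) ℂ := genEntry m n r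
  let D : Fin n → Derivation ℂ (MvPolynomial (Fin m × Fin n) ℂ) (MvPolynomial (Fin m × Fin n) ℂ) :=
    fun j => MvPolynomial.pderiv (⟨r, hr⟩, j)
  have hDv : ∀ j l, D j (v l) = (1 : Matrix (Fin n) (Fin n) _) j l := by
    intro j l
    simp only [D, v, hx, MvPolynomial.pderiv_X, Matrix.one_apply, Pi.single_apply]
    simp [eq_comm]
  have hDQ : ∀ j a b, D j (Q a b) = 0 := fun j a b =>
    pderiv_eq_zero_of_mem_rowAlg hr j (gramForm_mem r a b)
  have hDh : ∀ j, D j h = 0 := fun j => pderiv_eq_zero_of_mem_rowAlg hr j hh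
  have hqv : q = ∑ j, v j * (Q *ᵥ v) j := by
    rw [hq, gramMinor_succ]
    simp [Matrix.mulVec, dotProduct, Finset.mul_sum, mul_assoc, v, hQ]
  have hsymm : ∀ a b, Q a b = Q b a := fun a b => congrFun (congrFun (gramForm_transpose r) b) a
  have hDQv : ∀ j a, D j ((Q *ᵥ v) a) = Q a j := by
    intro j a
    simp [Matrix.mulVec, dotProduct, hDQ, hDv, Matrix.one_apply]
  have hDq : ∀ j, D j q = 2 * (Q *ᵥ v) j := by
    intro j
    rw [hqv]
    simp only [map_sum, Derivation.leibniz, hDQv, hDv, smul_eq_mul, Finset.sum_add_distrib]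
    have : ∑ a, v a * Q a j = (Q *ᵥ v) j := by
      simp only [Matrix.mulVec, dotProduct]
      exact Finset.sum_congr rfl fun a _ => by rw [hsymm, mul_comm]
    rw [this]
    simp [Matrix.one_apply, two_mul]
  have hQv : ∑ j, (Q *ᵥ v) j * (Q *ᵥ v) j = gramMinor m n r * q := by
    have e : (Q *ᵥ v) ⬝ᵥ (Q *ᵥ v) = v ⬝ᵥ ((Q * Q) *ᵥ v) := by
      conv_lhs => rw [show Q *ᵥ v = v ᵥ* Qᵀ from (Matrix.vecMul_transpose Q v).symm]
      rw [← Matrix.mulVec_mulVec, Matrix.dotProduct_mulVec, hQ, gramForm_transpose,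
        show gramForm m n r *ᵥ v = v ᵥ* gramForm m n r by
          conv_rhs => rw [← gramForm_transpose, Matrix.vecMul_transpose]]
    change (Q *ᵥ v) ⬝ᵥ (Q *ᵥ v) = _
    rw [e, hQ, gramForm_mul_self, Matrix.smul_mulVec, dotProduct_smul, hqv, smul_eq_mul]
    rfl
  have htr : ∑ j, Q j j = ((n : ℂ) - r) • gramMinor m n r := trace_gramForm r
  -- The coordinate `v j` is traded for `∂/∂v j`. Summed over `j`, the first term yields the trace
  -- `(n - r) gramMinor`, the second `2k |Q v|² = 2k gramMinor · q`.
  have step : ∀ j, expect _ (v j * ((Q *ᵥ v) j * (q ^ k * h)))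
      = expect _ (Q j j * (q ^ k * h)
        + (2 * k : ℂ) • ((Q *ᵥ v) j * (Q *ᵥ v) j * (q ^ (k - 1) * h))) := by
    intro j
    have : v j = MvPolynomial.X (⟨r, hr⟩, j) := hx j
    rw [this, expect_X_mul]
    refine congrArg _ ?_
    exact derivation_mul_pow_mul (D j) k (hDQv j j) (hDq j) (hDh j)
  -- For `k = 0` the exponent `k - 1` is truncated, but the scalar `2 * k` vanishes.
  have hpow : (2 * k : ℂ) • (gramMinor m n r * q * (q ^ (k - 1) * h))
      = (2 * k : ℂ) • (q ^ k * (gramMinor m n r * h)) := by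
    rcases k with _ | k
    · simp
    · rw [Nat.add_sub_cancel, show gramMinor m n r * q * (q ^ k * h)
        = q ^ (k + 1) * (gramMinor m n r * h) by ring]
  calc expect _ (q ^ (k + 1) * h) = ∑ j, expect _ (v j * ((Q *ᵥ v) j * (q ^ k * h))) := by
        rw [← map_sum]
        refine congrArg _ ?_
        rw [pow_succ', mul_assoc]
        conv_lhs => enter [1]; rw [hqv]
        rw [Finset.sum_mul]
        exact Finset.sum_congr rfl fun j _ => by ring
    _ = expect _ (((n : ℂ) - r) • gramMinor m n r * (q ^ k * h)
        + (2 * k : ℂ) • (gramMinor m n r * q * (q ^ (k - 1) * h))) := by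
      rw [Finset.sum_congr rfl fun j _ => step j, ← map_sum, Finset.sum_add_distrib,
        ← Finset.sum_mul, htr, ← Finset.smul_sum, ← Finset.sum_mul, hQv]
    _ = _ := by
      rw [hpow, smul_mul_assoc, map_add, map_smul, map_smul, smul_eq_mul, smul_eq_mul,
        show gramMinor m n r * (q ^ k * h) = q ^ k * (gramMinor m n r * h) by ring]
      ring

/-- Each integration by parts exchanges one factor `gramMinor (r + 1)` for `gramMinor r`, which
joins `h`; hence the induction is over all `h` in the earlier rows. -/
lemma expect_gramMinor_pow {r : ℕ} (hr : r < m) (k : ℕ) {h : MvPolynomial (Fin m × Fin n) ℂ}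
    (hh : h ∈ rowAlg m n r) :
    expect _ (gramMinor m n (r + 1) ^ k * h)
      = (∏ j ∈ Finset.range k, ((n : ℂ) - r + 2 * j)) * expect _ (gramMinor m n r ^ k * h) := by
  induction k generalizing h with
  | zero => simp
  | succ k ih =>
    rw [expect_gramMinor_pow_succ hr k hh, ih (Subalgebra.mul_mem _ (gramMinor_mem r) hh),
      Finset.prod_range_succ, pow_succ]
    simp only [mul_assoc, mul_left_comm]

/-- Peeling off the last row: the exponents `t (r + 1)` and `t r - t (r + 1)` combine to `t r`, and
integrating that row out leaves `gramMinor r ^ t r`, the same shape with one row fewer. -/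
lemma expect_gramMinor_prod {t : ℕ → ℕ} (ht : Antitone t) {r : ℕ} (hr : r ≤ m) :
    expect _ (gramMinor m n r ^ t r * ∏ i ∈ Finset.range r, gramMinor m n (i + 1) ^ (t i - t (i + 1)))
      = ∏ i ∈ Finset.range r, ∏ j ∈ Finset.range (t i), ((n : ℂ) - i + 2 * j) := by
  induction r with
  | zero =>
    have : gramMinor m n 0 = 1 := by simp [gramMinor]
    simp only [this, one_pow, Finset.range_zero, Finset.prod_empty, mul_one]
    rw [expect_apply]; simp
  | succ r ih =>
    rw [Finset.prod_range_succ, ← mul_assoc, mul_right_comm, ← pow_add,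
      Nat.add_sub_cancel' (ht (Nat.le_succ r)), expect_gramMinor_pow hr, ih (Nat.le_of_succ_le hr),
      Finset.prod_range_succ, mul_comm]
    refine Subalgebra.prod_mem _ fun i hi => Subalgebra.pow_mem _ ?_ _
    exact rowAlg_mono (Finset.mem_range.1 hi) (gramMinor_mem (i + 1))

end GramMinors

/-- A partition as a sequence. -/
def extendPart {m : ℕ} (τ : Fin m → ℕ) (i : ℕ) : ℕ := if h : i < m then τ ⟨i, h⟩ else 0

lemma antitone_extendPart {m : ℕ} {τ : Fin m → ℕ} (hτ : Antitone τ) : Antitone (extendPart τ) := by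
  intro i j hij
  unfold extendPart
  split_ifs with h1 h2
  · exact hτ (by simpa using hij)
  · omega
  · exact Nat.zero_le _
  · exact le_rfl

lemma two_pow_mul_rising (β : ℂ) (k : ℕ) :
    2 ^ k * rising (β / 2) k = ∏ j ∈ Finset.range k, (β + 2 * j) := by
  rw [rising, ← Finset.card_range k, ← Finset.prod_const, Finset.card_range, ← Finset.prod_mul_distrib]
  exact Finset.prod_congr rfl fun j _ => by ring

/-- The mean of `Δ_τ(Z Zᵀ)` for a Gaussian `m × n` matrix `Z`. -/
lemma zeta_one {m : ℕ} (n : ℕ) {τ : Fin m → ℕ} (hτ : Antitone τ) :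
    zeta τ (symDiag (fun _ => 1) : SymMat n) = 2 ^ (∑ i, τ i) * risingPartition ((n : ℂ) / 2) τ := by
  have h := expect_gramMinor_prod (m := m) (n := n) (antitone_extendPart hτ) (le_refl m)
  have h0 : extendPart τ m = 0 := dif_neg (lt_irrefl m)
  rw [h0, pow_zero, one_mul, expect_apply] at h
  rw [zeta, risingPartition, ← Finset.prod_pow_eq_pow_sum, ← Finset.prod_mul_distrib]
  have hr : ∏ i : Fin m, 2 ^ τ i * rising ((n : ℂ) / 2 - ((i : ℕ) : ℂ) / 2) (τ i)
      = ∏ i ∈ Finset.range m, ∏ j ∈ Finset.range (extendPart τ i), ((n : ℂ) - i + 2 * j) := by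
    rw [Finset.prod_range]
    refine Finset.prod_congr rfl fun i _ => ?_
    rw [← sub_div, two_pow_mul_rising, extendPart, dif_pos i.2]
  rw [hr, ← h]
  refine integral_congr_ae (ae_of_all _ fun z => ?_)
  simp only [generalizedPower, map_prod, map_pow, Finset.prod_range]
  refine Finset.prod_congr rfl fun i _ => ?_
  have e1 : extendPart τ i = τ i := dif_pos i.2
  have e2 : extendPart τ (i + 1) = nextPart τ i := rfl
  rw [e1, e2]
  congr 1
  rw [leadingMinor, gramMinor, RingHom.map_det]
  congr 1
  ext a b
  have hab : ∀ a : Fin (i + 1), (a : ℕ) < m := fun a => lt_of_lt_of_le a.2 i.2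
  simp [coe_symCong, coe_symDiag, Matrix.mul_apply, genRows, genEntry, gmat, hab, Fin.castLE]

/-! ### Polynomial identities from positive real points -/

lemma infinite_ofReal_image_Ioi : (Complex.ofReal '' Set.Ioi (0 : ℝ)).Infinite :=
  (Set.Ioi_infinite 0).image Complex.ofReal_injective.injOn

lemma mvPolynomial_ext_pos {σ : Type*} {p q : MvPolynomial σ ℂ}
    (h : ∀ z : σ → ℝ, (∀ i, 0 < z i) →
      MvPolynomial.eval (fun i => (z i : ℂ)) p = MvPolynomial.eval (fun i => (z i : ℂ)) q) :
    p = q := by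
  refine MvPolynomial.funext_set (fun _ => Complex.ofReal '' Set.Ioi (0 : ℝ))
    (fun _ => infinite_ofReal_image_Ioi) fun x hx => ?_
  choose z hz hzx using fun i => hx i (Set.mem_univ i)
  obtain rfl : (fun i => (z i : ℂ)) = x := funext hzx
  exact h z hz

lemma mvPolynomial_ext_real {σ : Type*} {p q : MvPolynomial σ ℂ}
    (h : ∀ z : σ → ℝ,
      MvPolynomial.eval (fun i => (z i : ℂ)) p = MvPolynomial.eval (fun i => (z i : ℂ)) q) :
    p = q :=
  mvPolynomial_ext_pos fun z _ => h z

lemma map_ofReal_diagonal {m : ℕ} (μ : Fin m → ℝ) :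
    Complex.ofRealHom.mapMatrix (Matrix.diagonal μ) = Matrix.diagonal fun i => (μ i : ℂ) := by
  ext i j
  rw [RingHom.mapMatrix_apply, Matrix.map_apply, Matrix.diagonal_apply, Matrix.diagonal_apply]
  split_ifs <;> simp

/-- A polynomial function on symmetric matrices vanishes if it does so on positive definite real
matrices. -/
lemma eq_zero_of_eq_zero_on_posDef {m : ℕ} {f : SymMat m → ℂ} (hf : f ∈ polyAlg (symCoord m))
    (h : ∀ O : Matrix (Fin m) (Fin m) ℝ, O * Oᵀ = 1 → ∀ μ : Fin m → ℝ, (∀ i, 0 < μ i) →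
      f (symCong (O.map Complex.ofReal) (symDiag fun i => (μ i : ℂ))) = 0) : f = 0 := by
  -- For fixed `O` the function is polynomial in the eigenvalues, so it vanishes for all `μ`, not
  -- only positive ones.
  have h1 : ∀ O : Matrix (Fin m) (Fin m) ℝ, O * Oᵀ = 1 → ∀ μ : Fin m → ℂ,
      f (symCong (O.map Complex.ofReal) (symDiag μ)) = 0 := by
    intro O hO
    let v : Fin m → (Fin m → ℂ) → ℂ := fun i x => x i
    have hmem : (fun μ : Fin m → ℂ => f (symCong (O.map Complex.ofReal) (symDiag μ))) ∈
        polyAlg v := by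
      refine comp_mem_of_mem_polyAlg _ hf fun i j => ?_
      have := mul_mul_matrix_mem (polyAlg v) (fun _ => O.map Complex.ofReal)
        (fun μ => Matrix.diagonal μ) (fun _ => (O.map Complex.ofReal)ᵀ)
        (fun _ _ => const_mem _ _) (fun i j => ?_) (fun _ _ => const_mem _ _) i j
      · exact this
      · by_cases hij : i = j
        · subst hij
          simp only [Matrix.diagonal_apply_eq]
          exact coord_mem_polyAlg v i
        · simp only [Matrix.diagonal_apply_ne _ hij]
          exact const_mem _ _
    obtain ⟨p, hp⟩ := mem_polyAlg.1 hmem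
    have : p = 0 := mvPolynomial_ext_pos fun z hz => by
      rw [map_zero, ← h O hO z hz]
      exact (hp fun i => (z i : ℂ)).symm
    intro μ
    rw [hp, this, map_zero]
  obtain ⟨p, hp⟩ := mem_polyAlg.1 hf
  -- Entries are read from the upper triangle, so that arbitrary real values define a symmetric
  -- matrix, to which the spectral theorem applies.
  let g : Fin m × Fin m → Fin m × Fin m := fun ij => (min ij.1 ij.2, max ij.1 ij.2)
  have hp0 : MvPolynomial.rename g p = 0 := by
    refine mvPolynomial_ext_real fun z => ?_
    rw [map_zero, MvPolynomial.eval_rename]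
    let Y : Matrix (Fin m) (Fin m) ℝ := Matrix.of fun i j => z (g (i, j))
    have hY : Y.IsHermitian := by
      ext i j
      simp [Y, g, min_comm, max_comm]
    let O : Matrix (Fin m) (Fin m) ℝ := hY.eigenvectorUnitary
    have hO : O * Oᵀ = 1 := by
      have := Unitary.coe_mul_star_self hY.eigenvectorUnitary
      simpa [Matrix.star_eq_conjTranspose] using this
    have hYO : Y = O * Matrix.diagonal hY.eigenvalues * Oᵀ := by
      conv_lhs => rw [hY.spectral_theorem, Unitary.conjStarAlgAut_apply]
      simp [O, Matrix.star_eq_conjTranspose]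
    rw [← h1 O hO fun i => (hY.eigenvalues i : ℂ), hp]
    refine congrArg (fun v => MvPolynomial.eval v p) (funext fun ij => ?_)
    have hYc : Y.map Complex.ofReal = O.map Complex.ofReal *
        Matrix.diagonal (fun i => (hY.eigenvalues i : ℂ)) * (O.map Complex.ofReal)ᵀ := by
      have := congrArg (Complex.ofRealHom.mapMatrix) hYO
      rw [map_mul, map_mul, map_ofReal_diagonal] at this
      exact this
    simp only [symCoord, coe_symCong, coe_symDiag, ← hYc]
    rfl
  ext X
  have := congrArg (MvPolynomial.eval fun ij => symCoord m ij X) hp0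
  rw [MvPolynomial.eval_rename, map_zero] at this
  rw [hp, Pi.zero_apply, ← this]
  refine congrArg (fun v => MvPolynomial.eval v p) (funext fun ij => ?_)
  have hX : ∀ i j, (X : Matrix (Fin m) (Fin m) ℂ) i j = (X : Matrix (Fin m) (Fin m) ℂ) j i :=
    fun i j => congrFun (congrFun X.2 j) i
  simp only [symCoord, Function.comp, g]
  rcases le_total ij.1 ij.2 with hij | hij
  · rw [min_eq_left hij, max_eq_right hij]
  · rw [min_eq_right hij, max_eq_left hij, hX]

/-- The matrix `L = O √μ` as an element of `GL(m, ℝ)`. -/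
lemma exists_GL_of_orthogonal {m : ℕ} {O : Matrix (Fin m) (Fin m) ℝ} (hO : O * Oᵀ = 1)
    {μ : Fin m → ℝ} (hμ : ∀ i, 0 < μ i) :
    ∃ L : GL (Fin m) ℝ, symCong ((L : Matrix (Fin m) (Fin m) ℝ).map Complex.ofReal)
      (symDiag fun _ => 1) = symCong (O.map Complex.ofReal) (symDiag fun i => (μ i : ℂ)) := by
  have hdet : (O * Matrix.diagonal fun i => √(μ i)).det ≠ 0 := by
    rw [Matrix.det_mul, Matrix.det_diagonal]
    refine mul_ne_zero (fun h => ?_) (Finset.prod_ne_zero_iff.2 fun i _ =>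
      (Real.sqrt_pos.2 (hμ i)).ne')
    have := congrArg Matrix.det hO
    rw [Matrix.det_mul, h] at this
    simp at this
  refine ⟨Matrix.GeneralLinearGroup.mkOfDetNeZero _ hdet, ?_⟩
  have e : ((Matrix.GeneralLinearGroup.mkOfDetNeZero _ hdet : GL (Fin m) ℝ) :
      Matrix (Fin m) (Fin m) ℝ).map Complex.ofReal
      = O.map Complex.ofReal * Matrix.diagonal fun i => ((√(μ i) : ℝ) : ℂ) := by
    have := map_mul (Complex.ofRealHom.mapMatrix) O (Matrix.diagonal fun i => √(μ i))
    rw [map_ofReal_diagonal] at this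
    exact this
  rw [e, symCong_mul]
  congr 1
  apply Subtype.ext
  simp only [coe_symCong, coe_symDiag, Matrix.diagonal_transpose, Matrix.diagonal_mul_diagonal]
  congr 1
  ext i
  rw [mul_one, ← Complex.ofReal_mul, Real.mul_self_sqrt (hμ i).le]

/-! ### The orthogonally invariant element of `V_τ` and its symmetric polynomial -/

lemma joint_mem_polyAlg {m n : ℕ} (τ : Fin m → ℕ) :
    (fun ω : (Fin m × Fin n → ℝ) × SymMat n =>
      generalizedPower τ (symCong (gmat ω.1) ω.2 : Matrix (Fin m) (Fin m) ℂ)) ∈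
    polyAlg (Sum.elim (fun i ω => realCoord (Fin m × Fin n) i ω.1) (fun j ω => symCoord n j ω.2) :
      (Fin m × Fin n) ⊕ (Fin n × Fin n) → (Fin m × Fin n → ℝ) × SymMat n → ℂ) := by
  set V := (Sum.elim (fun i ω => realCoord (Fin m × Fin n) i ω.1) (fun j ω => symCoord n j ω.2) :
      (Fin m × Fin n) ⊕ (Fin n × Fin n) → (Fin m × Fin n → ℝ) × SymMat n → ℂ)
  refine generalizedPower_mem _ τ fun i j => ?_
  have := mul_mul_matrix_mem (polyAlg V) (fun ω => gmat ω.1)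
    (fun ω => (ω.2 : Matrix (Fin n) (Fin n) ℂ)) (fun ω => (gmat ω.1)ᵀ)
    (fun i j => coord_mem_polyAlg V (Sum.inl (i, j))) (fun i j => coord_mem_polyAlg V (Sum.inr (i, j)))
    (fun i j => coord_mem_polyAlg V (Sum.inl (j, i))) i j
  exact this

/-- Separating `z` from `X` replaces the integral by a finite combination of functions of `X`; it
makes `ζ_τ` polynomial and lets a linear functional pass under the integral. -/
lemma exists_zeta_expansion {m n : ℕ} (τ : Fin m → ℕ) :
    ∃ (K : Type) (s : Finset K) (u : K → (Fin m × Fin n → ℝ) → ℂ) (w : K → SymMat n → ℂ),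
      (∀ k, u k ∈ polyAlg (realCoord (Fin m × Fin n))) ∧ (∀ k, w k ∈ polyAlg (symCoord n)) ∧
      (∀ z X, generalizedPower τ (symCong (gmat z) X : Matrix (Fin m) (Fin m) ℂ)
        = ∑ k ∈ s, u k z * w k X) ∧
      ∀ X : SymMat n, zeta τ X = ∑ k ∈ s, (∫ z, u k z ∂(gauss (Fin m × Fin n))) * w k X := by
  obtain ⟨s, u, w, hu, hw, h⟩ := exists_sum_mul_of_mem_polyAlg (joint_mem_polyAlg (n := n) τ)
  refine ⟨_, s, u, w, hu, hw, h, fun X => ?_⟩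
  have h' : ∀ z, generalizedPower τ (symCong (gmat z) X : Matrix (Fin m) (Fin m) ℂ)
      = ∑ k ∈ s, u k z * w k X := fun z => h z X
  rw [zeta]
  simp only [h']
  rw [integral_finsetSum _ fun k _ => (integrable_of_mem_polyAlg (hu k)).mul_const _]
  exact Finset.sum_congr rfl fun k _ => integral_mul_const _ _

lemma zeta_mem_polyAlg {m n : ℕ} (τ : Fin m → ℕ) :
    (fun X : SymMat n => zeta τ X) ∈ polyAlg (symCoord n) := by
  obtain ⟨K, s, u, w, -, hw, -, h⟩ := exists_zeta_expansion (n := n) τ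
  simp only [h]
  exact sum_fun_mem _ _ fun k _ => Subalgebra.mul_mem _ (const_mem _ _) (hw k)

/-- The orthogonally invariant element of `V_τ` obtained by Gaussian averaging. -/
def zonalMean {m : ℕ} (τ : Fin m → ℕ) (X : SymMat m) : ℂ := zeta τ X

/-- Otherwise a functional `φ` kills `V_τ` but not `zonalMean τ`. Then `P(z) = φ(Δ_τ(Z · Zᵀ))` is a
polynomial in `z` vanishing whenever `Z` is invertible, so `P det Z = 0` and `P = 0`; yet the mean
of `P` is `φ(zonalMean τ)`. -/
lemma zonalMean_mem_zonalSpace {m : ℕ} (τ : Fin m → ℕ) : zonalMean τ ∈ zonalSpace τ := by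
  by_contra hcon
  obtain ⟨φ, hφ, hker⟩ := Submodule.exists_le_ker_of_notMem hcon
  obtain ⟨K, s, u, w, hu, hw, h1, h2⟩ := exists_zeta_expansion (m := m) (n := m) τ
  let P : (Fin m × Fin m → ℝ) → ℂ := fun z => ∑ k ∈ s, u k z * φ (w k)
  have hP : P ∈ polyAlg (realCoord (Fin m × Fin m)) :=
    sum_fun_mem _ _ fun k _ => Subalgebra.mul_mem _ (hu k) (const_mem _ _)
  have hPφ : ∀ z, P z = φ (fun X => generalizedPower τ (symCong (gmat z) X)) := by
    intro z
    have : (fun X => generalizedPower τ (symCong (gmat z) X : Matrix (Fin m) (Fin m) ℂ))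
        = ∑ k ∈ s, u k z • w k := by
      ext X; rw [h1]; simp
    rw [this, map_sum]
    simp [P]
  have hP0 : ∀ z, (gmat z).det ≠ 0 → P z = 0 := by
    intro z hz
    let A : Matrix (Fin m) (Fin m) ℝ := Matrix.of fun i j => z (i, j)
    have hA : A.map Complex.ofReal = gmat z := rfl
    have hdet : A.det ≠ 0 := by
      intro h0
      apply hz
      have : (A.map Complex.ofReal).det = ((A.det : ℝ) : ℂ) :=
        (RingHom.map_det Complex.ofRealHom A).symm
      rw [← hA, this, h0, Complex.ofReal_zero]
    rw [hPφ]
    refine hker (Submodule.subset_span ⟨Matrix.GeneralLinearGroup.mkOfDetNeZero A hdet, ?_⟩)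
    rfl
  obtain ⟨p, hp⟩ := mem_polyAlg.1 hP
  obtain ⟨q, hq⟩ := mem_polyAlg.1 (det_mem (polyAlg (realCoord (Fin m × Fin m)))
    (M := fun z => gmat z) gmat_mem)
  have hpq : q * p = 0 := mvPolynomial_ext_real fun z => by
    rw [map_mul, map_zero]
    by_cases hz : (gmat z).det = 0
    · rw [show MvPolynomial.eval (fun i => (z i : ℂ)) q = 0 from (hq z).symm.trans hz, zero_mul]
    · rw [show MvPolynomial.eval (fun i => (z i : ℂ)) p = 0 from (hp z).symm.trans (hP0 z hz),
        mul_zero]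
  have hq0 : q ≠ 0 := by
    rintro rfl
    have := hq fun ij => if ij.1 = ij.2 then 1 else 0
    have e : gmat (fun ij : Fin m × Fin m => if ij.1 = ij.2 then (1 : ℝ) else 0) = 1 := by
      ext i j; simp only [gmat, Matrix.of_apply, Matrix.one_apply]; split_ifs <;> simp
    rw [e, Matrix.det_one, map_zero] at this
    exact one_ne_zero this
  have hp0 : p = 0 := (mul_eq_zero.1 hpq).resolve_left hq0
  apply hφ
  have hz : zonalMean τ = ∑ k ∈ s, (∫ z, u k z ∂(gauss (Fin m × Fin m))) • w k := by
    ext X; rw [zonalMean, h2]; simp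
  have hintg : ∫ z, P z ∂(gauss (Fin m × Fin m)) = 0 := by
    have : P = fun _ => 0 := by ext z; rw [hp, hp0, map_zero]
    rw [this]; simp
  rw [hz, map_sum, ← hintg, integral_finsetSum _ fun k _ =>
    (integrable_of_mem_polyAlg (hu k)).mul_const _]
  exact Finset.sum_congr rfl fun k _ => by rw [map_smul, integral_mul_const, smul_eq_mul]

lemma zonalMean_orthogonal {m : ℕ} (τ : Fin m → ℕ) {O : Matrix (Fin m) (Fin m) ℝ} (hO : O * Oᵀ = 1)
    (X : SymMat m) : zonalMean τ (symCong (O.map Complex.ofReal) X) = zonalMean τ X := by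
  rw [zonalMean, zonalMean, zeta, zeta,
    ← integral_right_orthogonal hO fun Z : Matrix (Fin m) (Fin m) ℂ =>
      generalizedPower τ (symCong Z X : Matrix (Fin m) (Fin m) ℂ)]
  refine integral_congr_ae (ae_of_all _ fun z => ?_)
  simp only [symCong_mul]

lemma exists_zonalPoly {m : ℕ} (τ : Fin m → ℕ) :
    ∃ p : MvPolynomial (Fin m) ℂ, ∀ x, MvPolynomial.eval x p = zonalMean τ (symDiag x) := by
  let v : Fin m → (Fin m → ℂ) → ℂ := fun i x => x i
  have : (fun x : Fin m → ℂ => zonalMean τ (symDiag x)) ∈ polyAlg v := by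
    refine comp_mem_of_mem_polyAlg _ (zeta_mem_polyAlg τ) fun i j => ?_
    simp only [coe_symDiag]
    by_cases hij : i = j
    · subst hij
      simp only [Matrix.diagonal_apply_eq]
      exact coord_mem_polyAlg v i
    · simp only [Matrix.diagonal_apply_ne _ hij]
      exact const_mem _ _
  obtain ⟨p, hp⟩ := mem_polyAlg.1 this
  exact ⟨p, fun x => (hp x).symm⟩

/-- The symmetric polynomial giving `zonalMean τ` on diagonal matrices. -/
def zonalPoly {m : ℕ} (τ : Fin m → ℕ) : MvPolynomial (Fin m) ℂ := (exists_zonalPoly τ).choose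

lemma eval_zonalPoly {m : ℕ} (τ : Fin m → ℕ) (x : Fin m → ℂ) :
    MvPolynomial.eval x (zonalPoly τ) = zonalMean τ (symDiag x) :=
  (exists_zonalPoly τ).choose_spec x

lemma zonalPoly_isSymmetric {m : ℕ} (τ : Fin m → ℕ) : (zonalPoly τ).IsSymmetric := by
  intro π
  refine MvPolynomial.funext fun x => ?_
  rw [MvPolynomial.eval_rename, eval_zonalPoly, eval_zonalPoly]
  -- The permutation matrix of `π`: symmetry is a special case of orthogonal invariance.
  let O : Matrix (Fin m) (Fin m) ℝ := Matrix.of fun i j => if π i = j then 1 else 0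
  have hO : O * Oᵀ = 1 := by
    ext i j
    simp [O, Matrix.mul_apply, Matrix.one_apply]
  rw [← zonalMean_orthogonal τ hO (symDiag x)]
  refine congrArg (zonalMean τ) (Subtype.ext ?_)
  ext i j
  simp only [coe_symCong, coe_symDiag, Matrix.mul_apply, O, Matrix.map_apply,
    Matrix.of_apply, Matrix.transpose_apply, Matrix.diagonal_apply, apply_ite Complex.ofReal,
    Complex.ofReal_one, Complex.ofReal_zero]
  simp [eq_comm]
  split_ifs with h
  · rw [h]
  · rfl

/-- The telescoping identity `∏ᵢ (x₀ ⋯ xᵢ) ^ (tᵢ - tᵢ₊₁) = ∏ᵢ xᵢ ^ tᵢ`. -/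
lemma prod_range_prod_pow_sub {M : Type*} [CommMonoid M] {t : ℕ → ℕ} (ht : Antitone t) (x : ℕ → M)
    (r : ℕ) : (∏ k ∈ Finset.range r, x k) ^ t r *
      ∏ i ∈ Finset.range r, (∏ k ∈ Finset.range (i + 1), x k) ^ (t i - t (i + 1))
      = ∏ i ∈ Finset.range r, x i ^ t i := by
  induction r with
  | zero => simp
  | succ r ih =>
    rw [Finset.prod_range_succ (fun i => (∏ k ∈ Finset.range (i + 1), x k) ^ (t i - t (i + 1))),
      mul_comm (∏ i ∈ Finset.range r, _), ← mul_assoc, ← pow_add,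
      Nat.add_sub_cancel' (ht (Nat.le_succ r)), Finset.prod_range_succ, mul_pow, mul_right_comm, ih,
      Finset.prod_range_succ]

lemma prod_prod_castLE_pow {m : ℕ} {M : Type*} [CommMonoid M] {τ : Fin m → ℕ} (hτ : Antitone τ)
    (x : Fin m → M) :
    ∏ i : Fin m, (∏ k : Fin (i + 1), x (Fin.castLE (Nat.succ_le_of_lt i.isLt) k)) ^
      (τ i - nextPart τ i) = ∏ i, x i ^ τ i := by
  let y : ℕ → M := fun i => if h : i < m then x ⟨i, h⟩ else 1
  have h := prod_range_prod_pow_sub (antitone_extendPart hτ) y m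
  rw [show extendPart τ m = 0 from dif_neg (lt_irrefl m), pow_zero, one_mul, Finset.prod_range,
    Finset.prod_range] at h
  convert h using 2 with i _ i _
  · rw [Finset.prod_range, show extendPart τ i = τ i from dif_pos i.2]
    congr 1
    refine Finset.prod_congr rfl fun k _ => ?_
    have hk : (k : ℕ) < m := lt_of_lt_of_le k.2 i.2
    simp only [y, dif_pos hk]
    rfl
  · rw [show extendPart τ i = τ i from dif_pos i.2]
    simp [y]

lemma generalizedPower_smul {m : ℕ} {τ : Fin m → ℕ} (hτ : Antitone τ) (c : ℂ)
    (M : Matrix (Fin m) (Fin m) ℂ) :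
    generalizedPower τ (c • M) = c ^ (∑ i, τ i) * generalizedPower τ M := by
  rw [← Finset.prod_pow_eq_pow_sum, ← prod_prod_castLE_pow hτ, generalizedPower, generalizedPower,
    ← Finset.prod_mul_distrib]
  refine Finset.prod_congr rfl fun i _ => ?_
  rw [← mul_pow, leadingMinor, leadingMinor, Matrix.submatrix_smul, Pi.smul_apply, Pi.smul_apply,
    Matrix.det_smul]
  simp

lemma zonalMean_smul {m : ℕ} {τ : Fin m → ℕ} (hτ : Antitone τ) (c : ℂ) (X : SymMat m) :
    zonalMean τ (c • X) = c ^ (∑ i, τ i) * zonalMean τ X := by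
  rw [zonalMean, zonalMean, zeta, zeta, ← integral_const_mul]
  refine integral_congr_ae (ae_of_all _ fun z => ?_)
  simp only [← generalizedPower_smul hτ]
  simp [coe_symCong]

lemma coeff_bind₁_C_mul_X {σ : Type*} (c : ℂ) (p : MvPolynomial σ ℂ) (α : σ →₀ ℕ) :
    (MvPolynomial.bind₁ (fun i => MvPolynomial.C c * MvPolynomial.X i) p).coeff α
      = c ^ α.degree * p.coeff α := by
  classical
  induction p using MvPolynomial.induction_on' with
  | monomial β a =>
    have : MvPolynomial.bind₁ (fun i => MvPolynomial.C c * MvPolynomial.X i)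
        (MvPolynomial.monomial β a) = MvPolynomial.C (c ^ β.degree) * MvPolynomial.monomial β a := by
      rw [MvPolynomial.bind₁_monomial, MvPolynomial.monomial_eq (s := β) (a := a)]
      simp only [mul_pow, Finset.prod_mul_distrib, Finset.prod_pow_eq_pow_sum, map_pow,
        Finsupp.prod, Finsupp.degree_apply]
      ring
    rw [this, MvPolynomial.coeff_C_mul, MvPolynomial.coeff_monomial]
    split_ifs with h
    · rw [h]
    · simp
  | add p q hp hq => simp [hp, hq, mul_add]

/-- One dilation suffices: each monomial that occurs satisfies `2 ^ degree = 2 ^ t`. -/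
lemma isHomogeneous_of_eval_two {σ : Type*} {p : MvPolynomial σ ℂ} {t : ℕ}
    (h : ∀ x : σ → ℂ, MvPolynomial.eval (fun i => 2 * x i) p = 2 ^ t * MvPolynomial.eval x p) :
    p.IsHomogeneous t := by
  have hb : MvPolynomial.bind₁ (fun i => MvPolynomial.C 2 * MvPolynomial.X i) p
      = MvPolynomial.C (2 ^ t) * p := by
    refine MvPolynomial.funext fun x => ?_
    rw [map_mul, MvPolynomial.eval_C, ← h]
    simp only [MvPolynomial.eval, MvPolynomial.eval₂Hom_bind₁]
    simp
  intro α hα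
  have hc := congrArg (MvPolynomial.coeff α) hb
  rw [coeff_bind₁_C_mul_X, MvPolynomial.coeff_C_mul] at hc
  have h2 : (2 : ℂ) ^ α.degree = 2 ^ t := mul_right_cancel₀ hα hc
  have h3 : α.degree = t := by
    have : (2 : ℕ) ^ α.degree = 2 ^ t := by exact_mod_cast h2
    exact Nat.pow_right_injective le_rfl this
  rw [← h3, Finsupp.degree_eq_weight_one]
  rfl

lemma zonalPoly_isHomogeneous {m : ℕ} {τ : Fin m → ℕ} (hτ : Antitone τ) :
    (zonalPoly τ).IsHomogeneous (∑ i, τ i) := by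
  refine isHomogeneous_of_eval_two fun x => ?_
  rw [eval_zonalPoly, eval_zonalPoly, ← zonalMean_smul hτ]
  refine congrArg (zonalMean τ) (Subtype.ext ?_)
  ext i j
  simp [coe_symDiag, Matrix.diagonal_apply]

/-! ### Invariant polynomials as functions of the eigenvalues -/

/-- Enumeration of the eigenvalues. -/
lemma exists_eigenvalues {m : ℕ} (X : Matrix (Fin m) (Fin m) ℂ) :
    ∃ ev : Fin m → ℂ, X.charpoly.roots = Finset.univ.val.map ev := by
  have hcard : X.charpoly.roots.card = m := by
    rw [Polynomial.splits_iff_card_roots.1 (IsAlgClosed.splits _)]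
    simp [Matrix.charpoly_natDegree_eq_dim]
  obtain ⟨l, hl⟩ := Quot.exists_rep X.charpoly.roots
  have hlen : l.length = m := by rw [← hcard, ← hl]; rfl
  subst hlen
  refine ⟨l.get, ?_⟩
  rw [← hl]
  simp

/-- An orthogonally invariant polynomial function is a symmetric function of the eigenvalues. -/
lemma eq_eval_eigenvalues {m : ℕ} {f : SymMat m → ℂ} (hf : f ∈ polyAlg (symCoord m))
    (hinv : ∀ O : Matrix (Fin m) (Fin m) ℝ, O * Oᵀ = 1 → ∀ X,
      f (symCong (O.map Complex.ofReal) X) = f X)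
    {p : MvPolynomial (Fin m) ℂ} (hp : p.IsSymmetric)
    (hfp : ∀ x, MvPolynomial.eval x p = f (symDiag x)) (X : SymMat m) {ev : Fin m → ℂ}
    (hev : (X : Matrix (Fin m) (Fin m) ℂ).charpoly.roots = Finset.univ.val.map ev) :
    f X = MvPolynomial.eval ev p := by
  -- A complex symmetric matrix need not be diagonalizable, so the comparison goes through the
  -- coefficients of the characteristic polynomial, which are polynomial in the entries and equal
  -- the elementary symmetric functions up to sign.
  obtain ⟨q, hq⟩ := MvPolynomial.esymmAlgHom_surjective ℂ (σ := Fin m) (n := m) (by simp) ⟨p, hp⟩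
  have hq' : p = MvPolynomial.aeval (fun i : Fin m => MvPolynomial.esymm (Fin m) ℂ (i + 1)) q := by
    have := congrArg (MvPolynomial.symmetricSubalgebra (Fin m) ℂ).val hq
    rw [MvPolynomial.esymmAlgHom, ← AlgHom.comp_apply, MvPolynomial.comp_aeval] at this
    exact this.symm
  let c : SymMat m → Fin m → ℂ := fun X i =>
    (-1) ^ ((i : ℕ) + 1) * (X : Matrix (Fin m) (Fin m) ℂ).charpoly.coeff (m - (i + 1))
  have hc : ∀ (X : SymMat m) (ev : Fin m → ℂ),
      (X : Matrix (Fin m) (Fin m) ℂ).charpoly.roots = Finset.univ.val.map ev →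
      MvPolynomial.eval (c X) q = MvPolynomial.eval ev p := by
    intro X ev hev
    have hE : ∀ i : Fin m, MvPolynomial.eval ev (MvPolynomial.esymm (Fin m) ℂ (i + 1)) = c X i := by
      intro i
      have h1 : MvPolynomial.eval ev (MvPolynomial.esymm (Fin m) ℂ (i + 1))
          = (Finset.univ.val.map ev).esymm (i + 1) :=
        MvPolynomial.aeval_esymm_eq_multiset_esymm (Fin m) ℂ ((i : ℕ) + 1) ev
      have hdeg : (X : Matrix (Fin m) (Fin m) ℂ).charpoly.natDegree = m := by
        simp [Matrix.charpoly_natDegree_eq_dim]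
      have h2 := Polynomial.coeff_eq_esymm_roots_of_splits
        (IsAlgClosed.splits (X : Matrix (Fin m) (Fin m) ℂ).charpoly) (k := m - (i + 1))
        (by rw [hdeg]; omega)
      rw [hdeg, (Matrix.charpoly_monic _).leadingCoeff, one_mul,
        show m - (m - ((i : ℕ) + 1)) = i + 1 by omega, hev] at h2
      simp only [c]
      rw [h2, ← mul_assoc, ← mul_pow]
      simpa using h1
    rw [hq']
    clear hq hq'
    induction q using MvPolynomial.induction_on with
    | C a => simp
    | add p q hp hq => simp [hp, hq]
    | mul_X p i hp => simp [hp, hE]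
  have hmem : (fun X => MvPolynomial.eval (c X) q) ∈ polyAlg (symCoord m) := by
    simp only [MvPolynomial.eval_eq]
    refine sum_fun_mem _ _ fun α _ => Subalgebra.mul_mem _ (const_mem _ _)
      (prod_fun_mem _ _ fun i _ => Subalgebra.pow_mem _ (Subalgebra.mul_mem _ (const_mem _ _) ?_) _)
    refine mem_polyAlg.2 ⟨(Matrix.charpoly.univ ℂ (Fin m)).coeff (m - (i + 1)), fun X => ?_⟩
    exact (Matrix.charpoly.univ_coeff_eval₂Hom (Fin m) (RingHom.id ℂ)
      (fun ij => symCoord m ij X) (m - (i + 1))).symm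
  -- Both sides are polynomial in `X` and agree at `O diag(μ) Oᵀ`.
  have hzero : (fun X => f X - MvPolynomial.eval (c X) q) = 0 := by
    refine eq_zero_of_eq_zero_on_posDef (Subalgebra.sub_mem _ hf hmem) fun O hO μ _ => ?_
    rw [hinv O hO, ← hfp, hc _ (fun i => (μ i : ℂ)), sub_self]
    have hO' : (O.map Complex.ofReal)ᵀ * O.map Complex.ofReal = 1 := by
      have := congrArg (Complex.ofRealHom.mapMatrix) (mul_eq_one_comm.1 hO)
      rw [map_mul, map_one] at this
      exact this
    rw [coe_symCong, coe_symDiag, Matrix.charpoly_mul_comm, ← Matrix.mul_assoc, hO', Matrix.one_mul,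
      Matrix.charpoly_diagonal, Polynomial.roots_prod _ _
        (Finset.prod_ne_zero_iff.2 fun i _ => Polynomial.X_sub_C_ne_zero _)]
    simp
  have := congrFun hzero X
  simp only [Pi.zero_apply, sub_eq_zero] at this
  rw [this, hc X ev hev]

lemma zonalMean_eq_eval {m : ℕ} (τ : Fin m → ℕ) (X : SymMat m) {ev : Fin m → ℂ}
    (hev : (X : Matrix (Fin m) (Fin m) ℂ).charpoly.roots = Finset.univ.val.map ev) :
    zonalMean τ X = MvPolynomial.eval ev (zonalPoly τ) :=
  eq_eval_eigenvalues (zeta_mem_polyAlg τ) (fun _ hO X => zonalMean_orthogonal τ hO X)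
    (zonalPoly_isSymmetric τ) (eval_zonalPoly τ) X hev

/-! ### Positivity and leading terms on diagonal matrices -/

section Minors
variable {m : ℕ}

/-- The Cauchy–Binet weight of a family of columns in a leading minor. -/
def minorWeight (z : Fin m × Fin m → ℝ) (i : Fin m) (f : Fin (i + 1) → Fin m) : ℝ :=
  (Matrix.of fun a b => z (Fin.castLE (Nat.succ_le_of_lt i.isLt) a, f b) :
    Matrix (Fin (i + 1)) (Fin (i + 1)) ℝ).det ^ 2 / ((i : ℕ) + 1).factorial

lemma minorWeight_nonneg (z : Fin m × Fin m → ℝ) (i : Fin m) (f : Fin (i + 1) → Fin m) :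
    0 ≤ minorWeight z i f := by
  unfold minorWeight; positivity

lemma minorWeight_eq_zero (z : Fin m × Fin m → ℝ) (i : Fin m) {f : Fin (i + 1) → Fin m}
    (hf : ¬Function.Injective f) : minorWeight z i f = 0 := by
  simp only [Function.Injective, not_forall] at hf
  obtain ⟨a, b, hab, hne⟩ := hf
  rw [minorWeight, Matrix.det_zero_of_column_eq hne fun k => by simp [hab]]
  simp

lemma leadingMinor_eq_sum (z : Fin m × Fin m → ℝ) (x : Fin m → ℂ) (i : Fin m) :
    leadingMinor (symCong (gmat z) (symDiag x) : Matrix (Fin m) (Fin m) ℂ) i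
      = ∑ f : Fin (i + 1) → Fin m, (minorWeight z i f : ℂ) * ∏ k, x (f k) := by
  let A : Matrix (Fin (i + 1)) (Fin m) ℂ :=
    (gmat z).submatrix (Fin.castLE (Nat.succ_le_of_lt i.isLt)) id
  have h := factorial_mul_det_conj_diagonal A x
  have e : leadingMinor (symCong (gmat z) (symDiag x) : Matrix (Fin m) (Fin m) ℂ) i
      = (A * Matrix.diagonal x * Aᵀ).det := by
    rw [leadingMinor, coe_symCong, coe_symDiag]
    congr 1
  have hfac : ((((i : ℕ) + 1).factorial : ℕ) : ℂ) ≠ 0 := Nat.cast_ne_zero.2 (Nat.factorial_ne_zero _)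
  rw [e, ← mul_right_inj' hfac, h, Finset.mul_sum]
  refine Finset.sum_congr rfl fun f _ => ?_
  have hd : (A.submatrix id f).det = (((Matrix.of fun a b =>
      z (Fin.castLE (Nat.succ_le_of_lt i.isLt) a, f b) :
      Matrix (Fin (i + 1)) (Fin (i + 1)) ℝ).det : ℝ) : ℂ) :=
    (RingHom.map_det Complex.ofRealHom (Matrix.of fun a b =>
      z (Fin.castLE (Nat.succ_le_of_lt i.isLt) a, f b))).symm
  rw [hd, minorWeight]
  push_cast
  field_simp

/-- The value of `Δ_τ(Z diag(x) Zᵀ)` for real `x`. -/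
def realPower (τ : Fin m → ℕ) (z : Fin m × Fin m → ℝ) (x : Fin m → ℝ) : ℝ :=
  ∏ i : Fin m, (∑ f : Fin (i + 1) → Fin m, minorWeight z i f * ∏ k, x (f k)) ^
    (τ i - nextPart τ i)

lemma generalizedPower_eq_realPower (τ : Fin m → ℕ) (z : Fin m × Fin m → ℝ) (x : Fin m → ℝ) :
    generalizedPower τ (symCong (gmat z) (symDiag fun i => (x i : ℂ)) : Matrix (Fin m) (Fin m) ℂ)
      = (realPower τ z x : ℂ) := by
  simp only [generalizedPower, leadingMinor_eq_sum, realPower]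
  push_cast
  rfl

/-- The triangle inequality for polynomials in `x` with nonnegative coefficients. -/
lemma norm_generalizedPower_le (τ : Fin m → ℕ) (z : Fin m × Fin m → ℝ) (x : Fin m → ℂ) :
    ‖generalizedPower τ (symCong (gmat z) (symDiag x) : Matrix (Fin m) (Fin m) ℂ)‖
      ≤ realPower τ z fun i => ‖x i‖ := by
  simp only [generalizedPower, leadingMinor_eq_sum, realPower, norm_prod, norm_pow]
  refine Finset.prod_le_prod (fun i _ => by positivity) fun i _ => ?_
  refine pow_le_pow_left₀ (norm_nonneg _) ?_ _
  refine (norm_sum_le _ _).trans (Finset.sum_le_sum fun f _ => ?_)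
  rw [norm_mul, norm_prod, Complex.norm_real, Real.norm_of_nonneg (minorWeight_nonneg z i f)]

lemma integrable_realPower (τ : Fin m → ℕ) (x : Fin m → ℝ) :
    Integrable (fun z => realPower τ z x) (gauss (Fin m × Fin m)) := by
  have h : Integrable (fun z : Fin m × Fin m → ℝ => generalizedPower τ
      (symCong (gmat z) (symDiag fun i => (x i : ℂ)) : Matrix (Fin m) (Fin m) ℂ))
      (gauss (Fin m × Fin m)) :=
    integrable_of_mem_polyAlg (generalizedPower_mem _ τ (symCong_gmat_mem _))
  simp only [generalizedPower_eq_realPower] at h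
  simpa using h.re

/-- The value of `zonalMean τ` at real diagonal matrices. -/
def realMean (τ : Fin m → ℕ) (x : Fin m → ℝ) : ℝ := ∫ z, realPower τ z x ∂(gauss (Fin m × Fin m))

lemma zonalMean_ofReal (τ : Fin m → ℕ) (x : Fin m → ℝ) :
    zonalMean τ (symDiag fun i => (x i : ℂ)) = (realMean τ x : ℂ) := by
  rw [zonalMean, zeta, realMean, ← integral_complex_ofReal]
  simp only [generalizedPower_eq_realPower]

lemma norm_zonalMean_le (τ : Fin m → ℕ) (x : Fin m → ℂ) :
    ‖zonalMean τ (symDiag x)‖ ≤ realMean τ fun i => ‖x i‖ := by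
  rw [zonalMean, zeta, realMean]
  exact norm_integral_le_of_norm_le (integrable_realPower τ _)
    (ae_of_all _ fun z => norm_generalizedPower_le τ z x)

lemma le_of_strictMono_fin {r : ℕ} {e : Fin r → Fin m} (he : StrictMono e) (k : Fin r) :
    (k : ℕ) ≤ e k := by
  obtain ⟨k, hk⟩ := k
  induction k with
  | zero => exact Nat.zero_le _
  | succ k ih =>
    have h1 := ih (Nat.lt_of_succ_lt hk)
    have h2 : e ⟨k, Nat.lt_of_succ_lt hk⟩ < e ⟨k + 1, hk⟩ := he (by simp)
    rw [Fin.lt_def] at h2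
    simp only at h1 ⊢
    omega

/-- Sort the image of `f`: its `k`-th smallest element is at least `k`, and `x` is decreasing. -/
lemma prod_le_prod_castLE {r : ℕ} (hr : r ≤ m) {x : Fin m → ℝ} (hx : Antitone x)
    (hx0 : ∀ i, 0 ≤ x i) {f : Fin r → Fin m} (hf : Function.Injective f) :
    ∏ k, x (f k) ≤ ∏ k, x (Fin.castLE hr k) := by
  classical
  let s : Finset (Fin m) := Finset.univ.image f
  have hs : s.card = r := by rw [Finset.card_image_of_injective _ hf]; simp
  have h1 : ∏ k, x (f k) = ∏ j ∈ s, x j := (Finset.prod_image fun a _ b _ h => hf h).symm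
  have h2 : ∏ j ∈ s, x j = ∏ k, x (s.orderEmbOfFin hs k) := by
    conv_lhs => rw [← Finset.image_orderEmbOfFin_univ s hs]
    exact Finset.prod_image fun a _ b _ h => (s.orderEmbOfFin hs).injective h
  rw [h1, h2]
  refine Finset.prod_le_prod (fun k _ => hx0 _) fun k _ => hx ?_
  exact le_of_strictMono_fin (s.orderEmbOfFin hs).strictMono k

/-- In each minor the product of the first variables dominates all others, repeated columns having
weight zero; these products telescope to `∏ xᵢ ^ τᵢ`. With `le_realPower` this says that `realMean
τ` grows exactly like that monomial. -/
lemma realPower_le {τ : Fin m → ℕ} (hτ : Antitone τ) (z : Fin m × Fin m → ℝ) {x : Fin m → ℝ}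
    (hx : Antitone x) (hx0 : ∀ i, 0 ≤ x i) :
    realPower τ z x ≤ realPower τ z (fun _ => 1) * ∏ i, x i ^ τ i := by
  rw [← prod_prod_castLE_pow hτ, realPower, realPower, ← Finset.prod_mul_distrib]
  have hnn : ∀ i : Fin m, 0 ≤ ∑ f : Fin (i + 1) → Fin m, minorWeight z i f * ∏ k, x (f k) :=
    fun i => Finset.sum_nonneg fun f _ =>
      mul_nonneg (minorWeight_nonneg z i f) (Finset.prod_nonneg fun _ _ => hx0 _)
  refine Finset.prod_le_prod (fun i _ => pow_nonneg (hnn i) _) fun i _ => ?_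
  rw [← mul_pow]
  refine pow_le_pow_left₀ (hnn i) ?_ _
  rw [Finset.sum_mul]
  refine Finset.sum_le_sum fun f _ => ?_
  simp only [Finset.prod_const_one, mul_one]
  by_cases hf : Function.Injective f
  · exact mul_le_mul_of_nonneg_left (prod_le_prod_castLE _ hx hx0 hf) (minorWeight_nonneg z i f)
  · simp [minorWeight_eq_zero z i hf]

/-- The leading coefficient of `realPower`. -/
def leadPower (τ : Fin m → ℕ) (z : Fin m × Fin m → ℝ) : ℝ :=
  ∏ i : Fin m, minorWeight z i (Fin.castLE (Nat.succ_le_of_lt i.isLt)) ^ (τ i - nextPart τ i)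

lemma leadPower_nonneg (τ : Fin m → ℕ) (z : Fin m × Fin m → ℝ) : 0 ≤ leadPower τ z :=
  Finset.prod_nonneg fun i _ => pow_nonneg (minorWeight_nonneg z i _) _

lemma le_realPower {τ : Fin m → ℕ} (hτ : Antitone τ) (z : Fin m × Fin m → ℝ) {x : Fin m → ℝ}
    (hx0 : ∀ i, 0 ≤ x i) : leadPower τ z * ∏ i, x i ^ τ i ≤ realPower τ z x := by
  rw [← prod_prod_castLE_pow hτ, realPower, leadPower, ← Finset.prod_mul_distrib]
  have hnn : ∀ (i : Fin m) (f : Fin (i + 1) → Fin m), 0 ≤ minorWeight z i f * ∏ k, x (f k) :=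
    fun i f => mul_nonneg (minorWeight_nonneg z i f) (Finset.prod_nonneg fun _ _ => hx0 _)
  refine Finset.prod_le_prod (fun i _ => ?_) fun i _ => ?_
  · rw [← mul_pow]
    exact pow_nonneg (hnn i _) _
  rw [← mul_pow]
  refine pow_le_pow_left₀ (hnn i _) ?_ _
  exact Finset.single_le_sum (f := fun f => minorWeight z i f * ∏ k, x (f k))
    (fun f _ => hnn i f) (Finset.mem_univ (Fin.castLE (Nat.succ_le_of_lt i.isLt)))

lemma continuous_leadPower (τ : Fin m → ℕ) : Continuous (leadPower τ) := by
  unfold leadPower minorWeight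
  refine continuous_finsetProd _ fun i _ => Continuous.pow (Continuous.div_const (Continuous.pow ?_ _) _) _
  refine Continuous.matrix_det (continuous_matrix fun a b => ?_)
  exact continuous_apply _

lemma integrable_leadPower {τ : Fin m → ℕ} (hτ : Antitone τ) :
    Integrable (leadPower τ) (gauss (Fin m × Fin m)) := by
  refine (integrable_realPower τ fun _ => 1).mono'
    (continuous_leadPower τ).aestronglyMeasurable (ae_of_all _ fun z => ?_)
  rw [Real.norm_of_nonneg (leadPower_nonneg τ z)]
  simpa using le_realPower hτ z (x := fun _ => 1) fun _ => zero_le_one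

/-- A continuous nonnegative function, positive at the identity matrix, where all leading minors are
`1`. -/
lemma integral_leadPower_pos {τ : Fin m → ℕ} (hτ : Antitone τ) :
    0 < ∫ z, leadPower τ z ∂(gauss (Fin m × Fin m)) := by
  refine integral_pos_of_integrable_nonneg_nonzero (continuous_leadPower τ)
    (integrable_leadPower hτ) (leadPower_nonneg τ) (x := fun ij => if ij.1 = ij.2 then 1 else 0) ?_
  refine Finset.prod_ne_zero_iff.2 fun i _ => pow_ne_zero _ ?_
  have : (Matrix.of fun a b => if Fin.castLE (Nat.succ_le_of_lt i.isLt) a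
      = Fin.castLE (Nat.succ_le_of_lt i.isLt) b then (1 : ℝ) else 0 :
      Matrix (Fin (i + 1)) (Fin (i + 1)) ℝ) = 1 := by
    ext a b
    simp [Matrix.one_apply]
  rw [minorWeight, this, Matrix.det_one]
  positivity

lemma realMean_le {τ : Fin m → ℕ} (hτ : Antitone τ) {x : Fin m → ℝ} (hx : Antitone x)
    (hx0 : ∀ i, 0 ≤ x i) : realMean τ x ≤ realMean τ (fun _ => 1) * ∏ i, x i ^ τ i := by
  rw [realMean, realMean, ← integral_mul_const]
  exact integral_mono (integrable_realPower τ x) ((integrable_realPower τ _).mul_const _)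
    fun z => realPower_le hτ z hx hx0

lemma le_realMean {τ : Fin m → ℕ} (hτ : Antitone τ) {x : Fin m → ℝ} (hx0 : ∀ i, 0 ≤ x i) :
    (∫ z, leadPower τ z ∂(gauss (Fin m × Fin m))) * ∏ i, x i ^ τ i ≤ realMean τ x := by
  rw [realMean, ← integral_mul_const]
  exact integral_mono ((integrable_leadPower hτ).mul_const _) (integrable_realPower τ x)
    fun z => le_realPower hτ z hx0

end Minors

/-! ### Independence, the basis of symmetric polynomials, and zonal polynomials -/

lemma mem_partitions {m t : ℕ} {τ : Fin m → ℕ} :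
    τ ∈ partitions m t ↔ ∑ i, τ i = t ∧ Antitone τ := by
  classical
  simp [partitions]

/-- The weight of a partition, injective on partitions of `t`. -/
def lexWeight {m : ℕ} (t : ℕ) (τ : Fin m → ℕ) : ℕ := ∑ i, τ i * (t + 1) ^ ((Fin.rev i : Fin m) : ℕ)

/-- The parts are at most `t`, so they are the digits of the weight in base `t + 1`. -/
lemma lexWeight_injOn (m t : ℕ) : Set.InjOn (lexWeight t) (partitions m t : Set (Fin m → ℕ)) := by
  intro τ hτ σ hσ h
  have hlt : ∀ τ ∈ partitions m t, ∀ i, τ i < t + 1 := by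
    intro τ hτ i
    rw [← (mem_partitions.1 hτ).1]
    exact Nat.lt_succ_of_le (Finset.single_le_sum (fun _ _ => Nat.zero_le _) (Finset.mem_univ i))
  have key : ∀ τ (hτ : τ ∈ partitions m t), lexWeight t τ
      = (finFunctionFinEquiv fun j : Fin m => (⟨τ (Fin.rev j), hlt τ hτ _⟩ : Fin (t + 1)) : ℕ) := by
    intro τ hτ
    rw [finFunctionFinEquiv_apply, lexWeight, ← Equiv.sum_comp Fin.revPerm]
    simp
  have h2 := finFunctionFinEquiv.injective (Fin.ext ((key τ hτ).symm.trans (h.trans (key σ hσ))))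
  ext i
  have := congrArg Fin.val (congrFun h2 (Fin.rev i))
  simpa using this

/-- The functions `zonalMean τ` are linearly independent on positive diagonal matrices. -/
lemma eq_zero_of_sum_realMean {m t : ℕ} (k : (Fin m → ℕ) → ℂ)
    (h : ∀ x : Fin m → ℝ, (∀ i, 0 < x i) → ∑ τ ∈ partitions m t, k τ * (realMean τ x : ℂ) = 0) :
    ∀ τ ∈ partitions m t, k τ = 0 := by
  classical
  by_contra hcon
  push Not at hcon
  obtain ⟨τ₀, hτ₀, hk₀⟩ := hcon
  -- The partition of greatest weight with nonzero coefficient dominates along a suitable curve.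
  obtain ⟨τ, hτS, hmax⟩ := Finset.exists_max_image ((partitions m t).filter fun τ => k τ ≠ 0)
    (lexWeight t) ⟨τ₀, Finset.mem_filter.2 ⟨hτ₀, hk₀⟩⟩
  obtain ⟨hτ, hkτ⟩ := Finset.mem_filter.1 hτS
  have hanti : ∀ τ ∈ partitions m t, Antitone τ := fun τ hτ => (mem_partitions.1 hτ).2
  set c := ∫ z, leadPower τ z ∂(gauss (Fin m × Fin m)) with hc
  have hc0 : 0 < c := integral_leadPower_pos (hanti τ hτ)
  set K := ∑ σ ∈ partitions m t, ‖k σ‖ * realMean σ (fun _ => 1) with hK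
  have hmean1 : ∀ σ ∈ partitions m t, 0 ≤ realMean σ (fun _ => 1) := fun σ hσ =>
    le_trans (by simpa using (integral_leadPower_pos (hanti σ hσ)).le)
      (le_realMean (hanti σ hσ) fun _ => zero_le_one)
  have hbound : ∀ s : ℝ, 1 ≤ s → ‖k τ‖ * c * s ≤ K := by
    intro s hs
    have hs0 : 0 < s := zero_lt_one.trans_le hs
    -- On this curve `∏ xᵢ ^ σᵢ = s ^ lexWeight σ`, so distinct partitions of `t` have different
    -- orders of growth in `s`.
    let x : Fin m → ℝ := fun i => s ^ ((t + 1) ^ ((Fin.rev i : Fin m) : ℕ))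
    have hx0 : ∀ i, 0 < x i := fun i => pow_pos hs0 _
    have hx : Antitone x := by
      intro i j hij
      refine pow_le_pow_right₀ hs (Nat.pow_le_pow_right (Nat.succ_pos t) ?_)
      exact Fin.rev_le_rev.2 hij
    have hprod : ∀ σ : Fin m → ℕ, ∏ i, x i ^ σ i = s ^ lexWeight t σ := by
      intro σ
      rw [lexWeight, ← Finset.prod_pow_eq_pow_sum]
      exact Finset.prod_congr rfl fun i _ => by rw [← pow_mul, mul_comm]
    have hnn : ∀ σ ∈ partitions m t, 0 ≤ realMean σ x := fun σ hσ =>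
      le_trans (mul_nonneg (integral_leadPower_pos (hanti σ hσ)).le
        (Finset.prod_nonneg fun i _ => pow_nonneg (hx0 i).le _))
        (le_realMean (hanti σ hσ) fun i => (hx0 i).le)
    have h1 : ‖k τ‖ * (c * s ^ lexWeight t τ) ≤ ‖k τ‖ * realMean τ x := by
      refine mul_le_mul_of_nonneg_left ?_ (norm_nonneg _)
      rw [← hprod]
      exact le_realMean (hanti τ hτ) fun i => (hx0 i).le
    have h2 : ‖k τ‖ * realMean τ x ≤ ∑ σ ∈ (partitions m t).erase τ, ‖k σ‖ * realMean σ x := by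
      have h3 := h x hx0
      rw [← Finset.add_sum_erase _ _ hτ] at h3
      have h4 : k τ * (realMean τ x : ℂ)
          = -∑ σ ∈ (partitions m t).erase τ, k σ * (realMean σ x : ℂ) := eq_neg_of_add_eq_zero_left h3
      have h5 := congrArg norm h4
      rw [norm_neg, norm_mul, Complex.norm_real, Real.norm_of_nonneg (hnn τ hτ)] at h5
      rw [h5]
      refine (norm_sum_le _ _).trans (Finset.sum_le_sum fun σ hσ => ?_)
      rw [norm_mul, Complex.norm_real, Real.norm_of_nonneg (hnn σ (Finset.mem_of_mem_erase hσ))]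
    have h6 : (∑ σ ∈ (partitions m t).erase τ, ‖k σ‖ * realMean σ x) * s
        ≤ K * s ^ lexWeight t τ := by
      rw [Finset.sum_mul]
      calc ∑ σ ∈ (partitions m t).erase τ, ‖k σ‖ * realMean σ x * s
          ≤ ∑ σ ∈ (partitions m t).erase τ, ‖k σ‖ * realMean σ (fun _ => 1) * s ^ lexWeight t τ := by
            refine Finset.sum_le_sum fun σ hσ => ?_
            have hσP := Finset.mem_of_mem_erase hσ
            by_cases hkσ : k σ = 0
            · simp [hkσ]
            have hlt : lexWeight t σ < lexWeight t τ :=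
              lt_of_le_of_ne (hmax σ (Finset.mem_filter.2 ⟨hσP, hkσ⟩)) fun he =>
                Finset.ne_of_mem_erase hσ (lexWeight_injOn m t hσP hτ he)
            rw [mul_assoc, mul_assoc]
            refine mul_le_mul_of_nonneg_left ?_ (norm_nonneg _)
            calc realMean σ x * s ≤ realMean σ (fun _ => 1) * s ^ lexWeight t σ * s := by
                  refine mul_le_mul_of_nonneg_right ?_ hs0.le
                  rw [← hprod]
                  exact realMean_le (hanti σ hσP) hx fun i => (hx0 i).le
              _ = realMean σ (fun _ => 1) * s ^ (lexWeight t σ + 1) := by rw [pow_succ]; ring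
              _ ≤ _ := mul_le_mul_of_nonneg_left (pow_le_pow_right₀ hs hlt) (hmean1 σ hσP)
        _ ≤ ∑ σ ∈ partitions m t, ‖k σ‖ * realMean σ (fun _ => 1) * s ^ lexWeight t τ := by
            refine Finset.sum_le_sum_of_subset_of_nonneg (Finset.erase_subset _ _) fun σ hσ _ => ?_
            exact mul_nonneg (mul_nonneg (norm_nonneg _) (hmean1 σ hσ)) (pow_nonneg hs0.le _)
        _ = K * s ^ lexWeight t τ := by rw [hK, Finset.sum_mul]
    have h7 : ‖k τ‖ * c * s * s ^ lexWeight t τ ≤ K * s ^ lexWeight t τ := by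
      refine le_trans ?_ h6
      calc ‖k τ‖ * c * s * s ^ lexWeight t τ = ‖k τ‖ * (c * s ^ lexWeight t τ) * s := by ring
        _ ≤ _ := mul_le_mul_of_nonneg_right (h1.trans h2) hs0.le
    exact le_of_mul_le_mul_right h7 (pow_pos hs0 _)
  have hpos : 0 < ‖k τ‖ * c := mul_pos (norm_pos_iff.2 hkτ) hc0
  -- Any `s` beyond `K / (‖k τ‖ * c)` contradicts the bound.
  obtain ⟨s, hs⟩ := exists_gt (max 1 (K / (‖k τ‖ * c)))
  have h1 := hbound s ((le_max_left _ _).trans hs.le)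
  have h2 : K < ‖k τ‖ * c * s := by
    rw [mul_comm]
    exact (div_lt_iff₀ hpos).1 ((le_max_right _ _).trans_lt hs)
  exact absurd h1 (not_le.2 h2)

lemma eval_zonalPoly_ofReal {m : ℕ} (τ : Fin m → ℕ) (x : Fin m → ℝ) :
    MvPolynomial.eval (fun i => (x i : ℂ)) (zonalPoly τ) = (realMean τ x : ℂ) := by
  rw [eval_zonalPoly, zonalMean_ofReal]

lemma eq_zero_of_sum_zonalPoly {m t : ℕ} (k : (Fin m → ℕ) → ℂ)
    (h : ∑ τ ∈ partitions m t, MvPolynomial.C (k τ) * zonalPoly τ = 0) :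
    ∀ τ ∈ partitions m t, k τ = 0 := by
  refine eq_zero_of_sum_realMean k fun x _ => ?_
  have := congrArg (MvPolynomial.eval fun i => (x i : ℂ)) h
  simpa [eval_zonalPoly_ofReal] using this

/-- By symmetry each coefficient equals the one at the sorted exponent, which is a partition. -/
lemma eq_zero_of_coeff_partitions {m t : ℕ} {p : MvPolynomial (Fin m) ℂ} (hs : p.IsSymmetric)
    (hh : p.IsHomogeneous t)
    (h : ∀ τ ∈ partitions m t, p.coeff (Finsupp.equivFunOnFinite.symm τ) = 0) : p = 0 := by
  ext α
  rw [MvPolynomial.coeff_zero]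
  by_contra hα
  have hdeg : ∑ i, α i = t := by
    have := hh hα
    rw [← this]
    simp [Finsupp.weight_apply, Finsupp.sum_fintype]
  let π : Equiv.Perm (Fin m) := (Fin.revPerm.trans (Tuple.sort α))
  have hanti : Antitone (fun i => α (π i)) := by
    intro i j hij
    exact Tuple.monotone_sort α (Fin.rev_le_rev.2 hij)
  have hmem : (fun i => α (π i)) ∈ partitions m t := by
    refine mem_partitions.2 ⟨?_, hanti⟩
    rw [← hdeg]
    exact Equiv.sum_comp π α
  have h1 := h _ hmem
  have h2 := MvPolynomial.coeff_rename_mapDomain π.symm π.symm.injective p α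
  rw [hs π.symm] at h2
  have h3 : Finsupp.mapDomain π.symm α = Finsupp.equivFunOnFinite.symm fun i => α (π i) := by
    ext i
    rw [Finsupp.mapDomain_equiv_apply]
    rfl
  rw [h3, h1] at h2
  exact hα h2.symm

/-- The polynomials `zonalPoly τ` span the symmetric homogeneous polynomials. -/
lemma exists_eq_sum_zonalPoly {m t : ℕ} {p : MvPolynomial (Fin m) ℂ} (hs : p.IsSymmetric)
    (hh : p.IsHomogeneous t) :
    ∃ k : (Fin m → ℕ) → ℂ, p = ∑ τ ∈ partitions m t, MvPolynomial.C (k τ) * zonalPoly τ := by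
  classical
  let ι : MvPolynomial (Fin m) ℂ →ₗ[ℂ] (partitions m t → ℂ) :=
    LinearMap.pi fun τ => MvPolynomial.lcoeff ℂ (Finsupp.equivFunOnFinite.symm τ.1)
  have hι : ∀ q : MvPolynomial (Fin m) ℂ, q.IsSymmetric → q.IsHomogeneous t → ι q = 0 → q = 0 := by
    intro q hq1 hq2 h0
    exact eq_zero_of_coeff_partitions hq1 hq2 fun τ hτ => congrFun h0 ⟨τ, hτ⟩
  have hsym : ∀ k : partitions m t → ℂ, (∑ τ, k τ • zonalPoly τ.1).IsSymmetric := fun k =>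
    Subalgebra.sum_mem (MvPolynomial.symmetricSubalgebra (Fin m) ℂ) fun τ _ =>
      Subalgebra.smul_mem _ (zonalPoly_isSymmetric τ.1) _
  have hhom : ∀ k : partitions m t → ℂ, (∑ τ, k τ • zonalPoly τ.1).IsHomogeneous t := fun k =>
    Submodule.sum_mem (MvPolynomial.homogeneousSubmodule (Fin m) ℂ t) fun τ _ =>
      Submodule.smul_mem _ _ (by
        have := zonalPoly_isHomogeneous (mem_partitions.1 τ.2).2
        rwa [(mem_partitions.1 τ.2).1] at this)
  have hli : LinearIndependent ℂ fun τ : partitions m t => ι (zonalPoly τ.1) := by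
    rw [Fintype.linearIndependent_iff]
    intro k hk τ
    have h0 : ∑ τ, k τ • zonalPoly τ.1 = 0 := by
      refine hι _ (hsym k) (hhom k) ?_
      rw [map_sum, ← hk]
      simp
    have := eq_zero_of_sum_zonalPoly (t := t) (fun τ => if h : τ ∈ partitions m t then k ⟨τ, h⟩ else 0)
      (by
        rw [← h0, ← Finset.sum_coe_sort]
        refine Finset.sum_congr rfl fun τ _ => ?_
        rw [dif_pos τ.2, MvPolynomial.smul_eq_C_mul]) τ τ.2
    simpa using this
  -- There are as many independent vectors as partitions, the dimension of the target of `ι`; they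
  -- span, and `ι` is injective on symmetric homogeneous polynomials.
  have htop := hli.span_eq_top_of_card_eq_finrank' (by simp)
  have hmem : ι p ∈ Submodule.span ℂ (Set.range fun τ : partitions m t => ι (zonalPoly τ.1)) := by
    rw [htop]; trivial
  obtain ⟨k, hk⟩ := (Submodule.mem_span_range_iff_exists_fun ℂ).1 hmem
  have hp : p - ∑ τ, k τ • zonalPoly τ.1 = 0 := by
    refine hι _ (Subalgebra.sub_mem (MvPolynomial.symmetricSubalgebra (Fin m) ℂ) hs (hsym k))
      (Submodule.sub_mem (MvPolynomial.homogeneousSubmodule (Fin m) ℂ t) hh (hhom k)) ?_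
    rw [map_sub, map_sum, ← hk]
    simp
  refine ⟨fun τ => if h : τ ∈ partitions m t then k ⟨τ, h⟩ else 0, ?_⟩
  rw [sub_eq_zero.1 hp, ← Finset.sum_coe_sort (partitions m t)]
  refine Finset.sum_congr rfl fun τ _ => ?_
  simp only [dif_pos τ.2, MvPolynomial.smul_eq_C_mul]

/-- The first power sum. -/
def powerSum (m : ℕ) : MvPolynomial (Fin m) ℂ := ∑ i, MvPolynomial.X i

lemma powerSum_isSymmetric (m : ℕ) : (powerSum m).IsSymmetric := by
  intro π
  simp only [powerSum, map_sum, MvPolynomial.rename_X]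
  exact Equiv.sum_comp π fun i => (MvPolynomial.X i : MvPolynomial (Fin m) ℂ)

lemma powerSum_isHomogeneous (m : ℕ) : (powerSum m).IsHomogeneous 1 :=
  MvPolynomial.IsHomogeneous.sum _ _ _ fun i _ => MvPolynomial.isHomogeneous_X ℂ i

lemma powerSum_pow_isSymmetric (m t : ℕ) : (powerSum m ^ t).IsSymmetric :=
  Subalgebra.pow_mem (MvPolynomial.symmetricSubalgebra (Fin m) ℂ) (powerSum_isSymmetric m) t

lemma powerSum_pow_isHomogeneous (m t : ℕ) : (powerSum m ^ t).IsHomogeneous t := by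
  simpa using (powerSum_isHomogeneous m).pow t

lemma eval_powerSum {m : ℕ} (x : Fin m → ℂ) : MvPolynomial.eval x (powerSum m) = ∑ i, x i := by
  simp [powerSum]

/-- The coefficients of `(x₁ + ⋯ + x_m) ^ t` in the basis `zonalPoly`. -/
def traceCoeff (m t : ℕ) : (Fin m → ℕ) → ℂ :=
  (exists_eq_sum_zonalPoly (powerSum_pow_isSymmetric m t) (powerSum_pow_isHomogeneous m t)).choose

lemma powerSum_pow_eq (m t : ℕ) : powerSum m ^ t
    = ∑ τ ∈ partitions m t, MvPolynomial.C (traceCoeff m t τ) * zonalPoly τ :=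
  (exists_eq_sum_zonalPoly (powerSum_pow_isSymmetric m t)
    (powerSum_pow_isHomogeneous m t)).choose_spec

lemma trace_eq_sum_eigenvalues {m : ℕ} {X : Matrix (Fin m) (Fin m) ℂ} {ev : Fin m → ℂ}
    (hev : X.charpoly.roots = Finset.univ.val.map ev) : X.trace = ∑ i, ev i := by
  rw [Matrix.trace_eq_sum_roots_charpoly_of_splits (IsAlgClosed.splits _), hev]
  rfl

lemma sum_traceCoeff_mul_zonalMean {m : ℕ} (t : ℕ) (X : SymMat m) :
    ∑ τ ∈ partitions m t, traceCoeff m t τ * zonalMean τ X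
      = (X : Matrix (Fin m) (Fin m) ℂ).trace ^ t := by
  obtain ⟨ev, hev⟩ := exists_eigenvalues (X : Matrix (Fin m) (Fin m) ℂ)
  rw [trace_eq_sum_eigenvalues hev, ← eval_powerSum, ← map_pow, powerSum_pow_eq, map_sum]
  refine Finset.sum_congr rfl fun τ _ => ?_
  rw [map_mul, MvPolynomial.eval_C, zonalMean_eq_eval τ X hev]

lemma isZonalDecomposition_traceCoeff (m t : ℕ) :
    IsZonalDecomposition m t fun τ X => traceCoeff m t τ * zonalMean τ X :=
  ⟨fun τ _ => Submodule.smul_mem _ _ (zonalMean_mem_zonalSpace τ),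
    fun X => sum_traceCoeff_mul_zonalMean t X⟩

/-- The spaces `V_τ` are independent. -/
lemma eq_zero_of_sum_zonalSpace {m t : ℕ} {D : (Fin m → ℕ) → SymMat m → ℂ}
    (hD : ∀ τ ∈ partitions m t, D τ ∈ zonalSpace τ)
    (h : ∀ X, ∑ τ ∈ partitions m t, D τ X = 0) : ∀ τ ∈ partitions m t, D τ = 0 := by
  intro τ hτ
  refine eq_zero_of_eq_zero_on_posDef (zonalSpace_le_polyAlg τ (hD τ hτ)) fun O hO μ hμ => ?_
  obtain ⟨L, hL⟩ := exists_GL_of_orthogonal hO hμ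
  rw [← hL]
  -- Averaging the relation over `L Z diag(x) Zᵀ Lᵀ` turns it into a relation among the `realMean τ
  -- x` with coefficients `D τ (L Lᵀ)`.
  refine eq_zero_of_sum_realMean (t := t)
    (fun τ => D τ (symCong ((L : Matrix (Fin m) (Fin m) ℝ).map Complex.ofReal) (symDiag fun _ => 1)))
    (fun x _ => ?_) τ hτ
  have h1 : ∀ σ ∈ partitions m t,
      D σ (symCong ((L : Matrix (Fin m) (Fin m) ℝ).map Complex.ofReal) (symDiag fun _ => 1))
        * (realMean σ x : ℂ)
      = ∫ z, D σ (symCong ((L : Matrix (Fin m) (Fin m) ℝ).map Complex.ofReal)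
        (symCong (gmat z) (symDiag fun i => (x i : ℂ)))) ∂(gauss (Fin m × Fin m)) := by
    intro σ hσ
    rw [integral_zonalSpace_conj (hD σ hσ), ← zonalMean_ofReal]
    rfl
  rw [Finset.sum_congr rfl h1, ← integral_finsetSum _ fun σ hσ =>
    integrable_comp_symCong (zonalSpace_le_polyAlg σ (hD σ hσ)) _ _]
  simp only [h, integral_zero]

lemma isZonalDecomposition_unique {m t : ℕ} {C C' : (Fin m → ℕ) → SymMat m → ℂ}
    (hC : IsZonalDecomposition m t C) (hC' : IsZonalDecomposition m t C') :
    ∀ τ ∈ partitions m t, C τ = C' τ := by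
  intro τ hτ
  have := eq_zero_of_sum_zonalSpace (D := fun τ => C τ - C' τ)
    (fun τ hτ => Submodule.sub_mem _ (hC.1 τ hτ) (hC'.1 τ hτ))
    (fun X => by simp [Finset.sum_sub_distrib, hC.2 X, hC'.2 X]) τ hτ
  exact sub_eq_zero.1 this

/-- The decomposition is unique, so the one chosen in the definition of `zonal` is the explicit one.
-/
lemma zonal_eq {m t : ℕ} {τ : Fin m → ℕ} (hτ : τ ∈ partitions m t) (X : SymMat m) :
    zonal τ X = traceCoeff m t τ * zonalMean τ X := by
  obtain ⟨rfl, hanti⟩ := mem_partitions.1 hτ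
  have hex : ∃ C, IsZonalDecomposition m (∑ i, τ i) C := ⟨_, isZonalDecomposition_traceCoeff m _⟩
  rw [zonal, dif_pos hex]
  exact congrFun (isZonalDecomposition_unique hex.choose_spec
    (isZonalDecomposition_traceCoeff m _) τ hτ) X

lemma realMean_one_pos {m : ℕ} {τ : Fin m → ℕ} (hτ : Antitone τ) : 0 < realMean τ fun _ => 1 :=
  lt_of_lt_of_le (by simpa using integral_leadPower_pos hτ)
    (le_realMean hτ (x := fun _ => 1) fun _ => zero_le_one)

/-! ### Nonnegativity of the coefficients of zonal polynomials -/

/-- The mean of a product of entries of `Z diag(x) Zᵀ`. -/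
def entryMean {m t : ℕ} (w : Fin t → Fin m × Fin m) (x : Fin m → ℝ) : ℝ :=
  ∫ z : Fin m × Fin m → ℝ, ∏ s, ∑ k, z ((w s).1, k) * x k * z ((w s).2, k)
    ∂(gauss (Fin m × Fin m))

lemma entryMean_eq {m t : ℕ} (w : Fin t → Fin m × Fin m) (x : Fin m → ℝ) :
    ∫ z, ∏ s, (symCong (gmat z) (symDiag fun i => (x i : ℂ)) : Matrix (Fin m) (Fin m) ℂ)
      (w s).1 (w s).2 ∂(gauss (Fin m × Fin m)) = (entryMean w x : ℂ) := by
  rw [entryMean, ← integral_complex_ofReal]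
  refine integral_congr_ae (ae_of_all _ fun z => ?_)
  simp [coe_symCong, coe_symDiag, Matrix.mul_apply, gmat, Matrix.diagonal_apply]

lemma symCong_gmat_transpose_mem {m n : ℕ} (N : SymMat m) (i j : Fin n) :
    (fun z : Fin m × Fin n → ℝ => (symCong (gmat z)ᵀ N : Matrix (Fin n) (Fin n) ℂ) i j) ∈
      polyAlg (realCoord (Fin m × Fin n)) := by
  simp only [coe_symCong]
  exact mul_mul_matrix_mem (polyAlg (realCoord (Fin m × Fin n))) (fun z => (gmat z)ᵀ)
    (fun _ => (N : Matrix (Fin m) (Fin m) ℂ)) (fun z => (gmat z)ᵀᵀ) (fun i j => gmat_mem j i)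
    (fun i j => const_mem _ _) (fun i j => gmat_mem i j) i j

/-- The kernel expansion behind the positivity of the coefficients of zonal polynomials. -/
lemma sum_traceCoeff_kernel {m t : ℕ} (x y : Fin m → ℝ) (hx : ∀ i, 0 < x i) :
    ∑ τ ∈ partitions m t, traceCoeff m t τ * (realMean τ (fun _ => 1) : ℂ) *
        ((realMean τ x : ℂ) * (realMean τ y : ℂ))
      = ∑ w : Fin t → Fin m × Fin m, (entryMean w x : ℂ) * (entryMean w y : ℂ) := by
  -- `L = diag(√x)`, so that `L Lᵀ = diag(x)`. The kernel is the mean of `tr(L Z (Z' diag(y) Z'ᵀ) Zᵀ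
  -- Lᵀ) ^ t` over independent `Z` and `Z'`.
  let L : GL (Fin m) ℝ := Matrix.GeneralLinearGroup.mkOfDetNeZero
    (Matrix.diagonal fun i => Real.sqrt (x i)) (by
      rw [Matrix.det_diagonal]
      exact Finset.prod_ne_zero_iff.2 fun i _ => (Real.sqrt_pos.2 (hx i)).ne')
  have hLc : (L : Matrix (Fin m) (Fin m) ℝ).map Complex.ofReal
      = Matrix.diagonal fun i => ((Real.sqrt (x i) : ℝ) : ℂ) := map_ofReal_diagonal _
  have hsq : ∀ i, ((Real.sqrt (x i) : ℝ) : ℂ) * ((Real.sqrt (x i) : ℝ) : ℂ) = x i := fun i => by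
    rw [← Complex.ofReal_mul, Real.mul_self_sqrt (hx i).le]
  have hL1 : symCong ((L : Matrix (Fin m) (Fin m) ℝ).map Complex.ofReal) (symDiag fun _ => 1)
      = symDiag fun i => (x i : ℂ) := by
    apply Subtype.ext
    simp [coe_symCong, coe_symDiag, hLc, hsq]
  have hLL : ((L : Matrix (Fin m) (Fin m) ℝ).map Complex.ofReal)ᵀ *
      (L : Matrix (Fin m) (Fin m) ℝ).map Complex.ofReal = Matrix.diagonal fun i => (x i : ℂ) := by
    simp [hLc, hsq]
  clear hLc hsq
  set Lc := (L : Matrix (Fin m) (Fin m) ℝ).map Complex.ofReal with hLc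
  have hmean : ∀ (τ : Fin m → ℕ) (v : Fin m → ℝ),
      zeta τ (symDiag fun i => (v i : ℂ)) = (realMean τ v : ℂ) := fun τ v => zonalMean_ofReal τ v
  have hone : ∀ τ : Fin m → ℕ, zonalMean τ (symDiag fun _ => 1) = (realMean τ (fun _ => 1) : ℂ) :=
    fun τ => by rw [← zonalMean_ofReal]; simp
  set Y : (Fin m × Fin m → ℝ) → SymMat m := fun z => symCong (gmat z) (symDiag fun i => (y i : ℂ))
  -- The average over `Z`, for fixed `N`. The trace is the pairing `∑ (Zᵀ diag(x) Z)ᵢⱼ Nᵢⱼ`; its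
  -- `t`-th power expands over words of index pairs, which separates `x` from `N`.
  have hinner : ∀ N : SymMat m, ∑ τ ∈ partitions m t, traceCoeff m t τ *
      ((realMean τ x : ℂ) * zonalMean τ N)
      = ∑ w : Fin t → Fin m × Fin m, (entryMean w x : ℂ) *
        ∏ s, (N : Matrix (Fin m) (Fin m) ℂ) (w s).1 (w s).2 := by
    intro N
    have h1 : ∀ τ ∈ partitions m t, traceCoeff m t τ * ((realMean τ x : ℂ) * zonalMean τ N)
        = ∫ z, traceCoeff m t τ * zonalMean τ (symCong Lc (symCong (gmat z) N))
          ∂(gauss (Fin m × Fin m)) := by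
      intro τ _
      rw [integral_const_mul, integral_zonalSpace_conj (zonalMean_mem_zonalSpace τ), ← hLc, hL1,
        zonalMean_ofReal]
      rfl
    have hintg : ∀ τ : Fin m → ℕ, Integrable (fun z => traceCoeff m t τ *
        zonalMean τ (symCong Lc (symCong (gmat z) N))) (gauss (Fin m × Fin m)) := fun τ =>
      (integrable_comp_symCong (zonalSpace_le_polyAlg τ (zonalMean_mem_zonalSpace τ)) _ _).const_mul _
    rw [Finset.sum_congr rfl h1, ← integral_finsetSum _ fun τ _ => hintg τ]
    simp only [sum_traceCoeff_mul_zonalMean]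
    have htr : ∀ z : Fin m × Fin m → ℝ,
        (symCong Lc (symCong (gmat z) N) : Matrix (Fin m) (Fin m) ℂ).trace ^ t
        = ∑ w : Fin t → Fin m × Fin m,
          (∏ s, (symCong (gmat z)ᵀ (symDiag fun i => (x i : ℂ)) : Matrix (Fin m) (Fin m) ℂ)
            (w s).1 (w s).2) * ∏ s, (N : Matrix (Fin m) (Fin m) ℂ) (w s).1 (w s).2 := by
      intro z
      have e1 : (symCong Lc (symCong (gmat z) N) : Matrix (Fin m) (Fin m) ℂ).trace
          = ∑ ij : Fin m × Fin m, (symCong (gmat z)ᵀ (symDiag fun i => (x i : ℂ)) :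
            Matrix (Fin m) (Fin m) ℂ) ij.1 ij.2 * (N : Matrix (Fin m) (Fin m) ℂ) ij.1 ij.2 := by
        have hN : (N : Matrix (Fin m) (Fin m) ℂ)ᵀ = N := N.2
        have e2 : (symCong Lc (symCong (gmat z) N) : Matrix (Fin m) (Fin m) ℂ).trace
            = ((symCong (gmat z)ᵀ (symDiag fun i => (x i : ℂ)) : Matrix (Fin m) (Fin m) ℂ)
              * (N : Matrix (Fin m) (Fin m) ℂ)).trace := by
          simp only [coe_symCong, coe_symDiag, ← hLL, Matrix.transpose_transpose]
          rw [Matrix.trace_mul_comm]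
          rw [← Matrix.mul_assoc, ← Matrix.mul_assoc, ← Matrix.mul_assoc, Matrix.trace_mul_comm]
          simp only [Matrix.mul_assoc]
        rw [e2, Matrix.trace, Fintype.sum_prod_type]
        refine Finset.sum_congr rfl fun i _ => ?_
        rw [Matrix.diag_apply, Matrix.mul_apply]
        refine Finset.sum_congr rfl fun j _ => ?_
        conv_lhs => rw [← hN, Matrix.transpose_apply]
      rw [e1, Fintype.sum_pow]
      exact Finset.sum_congr rfl fun w _ => Finset.prod_mul_distrib
    simp only [htr]
    rw [integral_finsetSum]
    · refine Finset.sum_congr rfl fun w _ => ?_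
      rw [integral_mul_const, integral_transpose (n := m) (fun Z : Matrix (Fin m) (Fin m) ℂ =>
        ∏ s, (symCong Z (symDiag fun i => (x i : ℂ)) : Matrix (Fin m) (Fin m) ℂ)
          (w s).1 (w s).2), entryMean_eq]
    · intro w _
      refine Integrable.mul_const (integrable_of_mem_polyAlg (prod_fun_mem _ _ fun s _ => ?_)) _
      exact symCong_gmat_transpose_mem _ _ _
  have houter : ∀ τ ∈ partitions m t, traceCoeff m t τ * (realMean τ (fun _ => 1) : ℂ) *
        ((realMean τ x : ℂ) * (realMean τ y : ℂ))
      = ∫ z, traceCoeff m t τ * ((realMean τ x : ℂ) * zonalMean τ (Y z))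
        ∂(gauss (Fin m × Fin m)) := by
    intro τ _
    rw [integral_const_mul, integral_const_mul, integral_zonalSpace (zonalMean_mem_zonalSpace τ),
      hone, hmean]
    ring
  have hintY : ∀ τ : Fin m → ℕ, Integrable (fun z => zonalMean τ (Y z)) (gauss (Fin m × Fin m)) :=
    fun τ => integrable_of_mem_polyAlg (comp_mem_of_mem_polyAlg _ (zeta_mem_polyAlg τ)
      (symCong_gmat_mem _))
  rw [Finset.sum_congr rfl houter, ← integral_finsetSum _ fun τ _ =>
    ((hintY τ).const_mul _).const_mul _]
  simp only [hinner]
  rw [integral_finsetSum]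
  · refine Finset.sum_congr rfl fun w _ => ?_
    rw [integral_const_mul, entryMean_eq]
  · intro w _
    refine Integrable.const_mul (integrable_of_mem_polyAlg (prod_fun_mem _ _ fun s _ => ?_)) _
    exact symCong_gmat_mem _ _ _

/-- The coefficients of the zonal polynomials are nonnegative. -/
lemma traceCoeff_nonneg {m t : ℕ} {τ : Fin m → ℕ} (hτ : τ ∈ partitions m t) :
    ∃ r : ℝ, 0 ≤ r ∧ traceCoeff m t τ = r := by
  classical
  let V : {x : Fin m → ℝ // ∀ i, 0 < x i} → (partitions m t → ℝ) := fun x σ => realMean σ.1 x.1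
  -- A functional vanishing on all these vectors would be a linear relation among the functions
  -- `realMean σ`.
  have hspan : Submodule.span ℝ (Set.range V) = ⊤ := by
    by_contra hne
    obtain ⟨φ, hφ0, hφ⟩ := Submodule.exists_le_ker_of_lt_top _ (lt_top_iff_ne_top.2 hne)
    apply hφ0
    have hk : ∀ σ : partitions m t, φ (Pi.single σ 1) = 0 := by
      have h0 := eq_zero_of_sum_realMean (t := t) (m := m)
        (fun σ => if h : σ ∈ partitions m t then (φ (Pi.single ⟨σ, h⟩ 1) : ℂ) else 0) (by
          intro x hx
          have h1 : φ (V ⟨x, hx⟩) = 0 := hφ (Submodule.subset_span ⟨⟨x, hx⟩, rfl⟩)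
          rw [LinearMap.pi_apply_eq_sum_univ] at h1
          rw [← Finset.sum_coe_sort]
          have h2 := congrArg Complex.ofReal h1
          push_cast at h2
          rw [← h2]
          refine Finset.sum_congr rfl fun σ _ => ?_
          rw [dif_pos σ.2]
          simp only [V, smul_eq_mul]
          push_cast
          rw [mul_comm]
          congr 4
          ext j
          simp [Pi.single_apply, eq_comm])
      intro σ
      have := h0 σ σ.2
      rw [dif_pos σ.2] at this
      exact_mod_cast this
    refine LinearMap.pi_ext' fun σ => LinearMap.ext_ring ?_
    simpa using hk σ
  have hmem : (Pi.single ⟨τ, hτ⟩ 1 : partitions m t → ℝ) ∈ Submodule.span ℝ (Set.range V) := by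
    rw [hspan]; trivial
  obtain ⟨c, hc⟩ := Finsupp.mem_span_range_iff_exists_finsupp.1 hmem
  have hdual : ∀ σ ∈ partitions m t, ∑ x ∈ c.support, c x * realMean σ x.1 = if σ = τ then 1 else 0 := by
    intro σ hσ
    have := congrFun hc ⟨σ, hσ⟩
    simpa [Finsupp.sum, V, Pi.single_apply] using this
  -- The weights `c` pick out the component `τ`; applied in both variables of the kernel, they leave
  -- a single term on one side and a sum of squares on the other.
  have key : traceCoeff m t τ * (realMean τ (fun _ => 1) : ℂ)
      = ((∑ w : Fin t → Fin m × Fin m, (∑ x ∈ c.support, c x * entryMean w x.1) ^ 2 : ℝ) : ℂ) := by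
    have h1 : ∑ x ∈ c.support, ∑ y ∈ c.support, ((c x : ℂ) * (c y : ℂ)) *
        (∑ σ ∈ partitions m t, traceCoeff m t σ * (realMean σ (fun _ => 1) : ℂ) *
        ((realMean σ x.1 : ℂ) * (realMean σ y.1 : ℂ)))
        = traceCoeff m t τ * (realMean τ (fun _ => 1) : ℂ) := by
      calc _ = ∑ σ ∈ partitions m t, traceCoeff m t σ * (realMean σ (fun _ => 1) : ℂ) *
            ((∑ x ∈ c.support, (c x : ℂ) * (realMean σ x.1 : ℂ)) *
              (∑ y ∈ c.support, (c y : ℂ) * (realMean σ y.1 : ℂ))) := by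
            simp only [Finset.mul_sum, Finset.sum_mul]
            rw [Finset.sum_congr rfl fun x _ => Finset.sum_comm, Finset.sum_comm]
            refine Finset.sum_congr rfl fun σ _ => ?_
            rw [Finset.sum_comm]
            refine Finset.sum_congr rfl fun y _ => Finset.sum_congr rfl fun x _ => ?_
            ring
        _ = ∑ σ ∈ partitions m t, traceCoeff m t σ * (realMean σ (fun _ => 1) : ℂ) *
            (if σ = τ then 1 else 0) := by
            refine Finset.sum_congr rfl fun σ hσ => ?_
            have := congrArg Complex.ofReal (hdual σ hσ)
            push_cast at this
            rw [this]
            split_ifs <;> simp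
        _ = _ := by simp [hτ]
    rw [← h1]
    simp only [fun x y : {x : Fin m → ℝ // ∀ i, 0 < x i} =>
      sum_traceCoeff_kernel (t := t) x.1 y.1 x.2]
    push_cast
    simp only [sq, Finset.mul_sum, Finset.sum_mul]
    rw [Finset.sum_congr rfl fun x _ => Finset.sum_comm, Finset.sum_comm]
    refine Finset.sum_congr rfl fun σ _ => ?_
    rw [Finset.sum_comm]
    refine Finset.sum_congr rfl fun y _ => Finset.sum_congr rfl fun x _ => ?_
    ring
  have hpos := realMean_one_pos (mem_partitions.1 hτ).2
  refine ⟨(∑ w : Fin t → Fin m × Fin m, (∑ x ∈ c.support, c x * entryMean w x.1) ^ 2) /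
    realMean τ (fun _ => 1), ?_, ?_⟩
  · exact div_nonneg (Finset.sum_nonneg fun w _ => sq_nonneg _) hpos.le
  · rw [Complex.ofReal_div, ← key, mul_div_cancel_right₀]
    exact_mod_cast hpos.ne'

/-! ### The raising operator -/

section RowMean
variable {m n : ℕ}

/-- The Gaussian mean of `p (lᵢ zᵢⱼ)` as a polynomial in the row scales `l`. -/
def rowMean (m n : ℕ) : MvPolynomial (Fin m × Fin n) ℂ →ₗ[ℂ] MvPolynomial (Fin m) ℂ :=
  (MvPolynomial.basisMonomials (Fin m × Fin n) ℂ).constr ℂ fun α =>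
    MvPolynomial.monomial (α.mapDomain Prod.fst) (moments α)

lemma rowMean_monomial (α : Fin m × Fin n →₀ ℕ) (c : ℂ) :
    rowMean m n (MvPolynomial.monomial α c)
      = MvPolynomial.monomial (α.mapDomain Prod.fst) (c * moments α) := by
  have h := (MvPolynomial.basisMonomials (Fin m × Fin n) ℂ).constr_basis ℂ (fun α =>
    (MvPolynomial.monomial (α.mapDomain Prod.fst) (moments α) : MvPolynomial (Fin m) ℂ)) α
  rw [MvPolynomial.coe_basisMonomials] at h
  have h2 : (MvPolynomial.monomial α c : MvPolynomial (Fin m × Fin n) ℂ)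
      = c • MvPolynomial.monomial α 1 := by simp [MvPolynomial.smul_monomial]
  rw [h2, map_smul, rowMean, h, MvPolynomial.smul_monomial, smul_eq_mul]

lemma eval_rowMean (l : Fin m → ℂ) (p : MvPolynomial (Fin m × Fin n) ℂ) :
    MvPolynomial.eval l (rowMean m n p)
      = ∫ z : Fin m × Fin n → ℝ, MvPolynomial.eval (fun ij => l ij.1 * (z ij : ℂ)) p
        ∂(gauss (Fin m × Fin n)) := by
  have hev : ∀ (p : MvPolynomial (Fin m × Fin n) ℂ) (z : Fin m × Fin n → ℝ),
      MvPolynomial.eval (fun ij => l ij.1 * (z ij : ℂ)) p = MvPolynomial.eval (fun ij => (z ij : ℂ))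
        (MvPolynomial.bind₁ (fun ij => MvPolynomial.C (l ij.1) * MvPolynomial.X ij) p) := by
    intro p z
    rw [MvPolynomial.eval, MvPolynomial.eval, MvPolynomial.eval₂Hom_bind₁]
    simp
  induction p using MvPolynomial.induction_on' with
  | monomial α c =>
    have h1 : ∀ z : Fin m × Fin n → ℝ, MvPolynomial.eval (fun ij => l ij.1 * (z ij : ℂ))
        (MvPolynomial.monomial α c) = MvPolynomial.eval (fun ij => (z ij : ℂ))
        (MvPolynomial.monomial α (c * α.prod fun ij k => l ij.1 ^ k)) := by
      intro z
      rw [MvPolynomial.eval_monomial, MvPolynomial.eval_monomial, mul_assoc, ← Finsupp.prod_mul]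
      simp only [mul_pow]
    simp only [h1]
    rw [← expect_apply, expect_monomial, rowMean_monomial, MvPolynomial.eval_monomial,
      Finsupp.prod_mapDomain_index (by simp) (by intros; rw [pow_add])]
    ring
  | add p q hp hq =>
    simp only [map_add, hp, hq]
    rw [integral_add]
    · simp only [hev]; exact integrable_eval _
    · simp only [hev]; exact integrable_eval _

/-- Two more factors `z i j` multiply the Gaussian moment by `α (i, j) + 1`. Summed over `j` this is
`n` plus the degree in the `i`-th scale, that is `n` plus the Euler operator. -/
lemma rowMean_sq_mul (i : Fin m) (p : MvPolynomial (Fin m × Fin n) ℂ) :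
    rowMean m n ((∑ j, MvPolynomial.X (i, j) ^ 2) * p)
      = MvPolynomial.X i ^ 2 * (MvPolynomial.C (n : ℂ) * rowMean m n p
        + MvPolynomial.X i * MvPolynomial.pderiv i (rowMean m n p)) := by
  induction p using MvPolynomial.induction_on' with
  | monomial α c =>
    have h1 : ∀ j : Fin n, rowMean m n (MvPolynomial.X (i, j) ^ 2 * MvPolynomial.monomial α c)
        = MvPolynomial.C ((α (i, j) : ℂ) + 1) *
          (MvPolynomial.X i ^ 2 * rowMean m n (MvPolynomial.monomial α c)) := by
      intro j
      have e1 : (MvPolynomial.X (i, j) ^ 2 * MvPolynomial.monomial α c :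
          MvPolynomial (Fin m × Fin n) ℂ) = MvPolynomial.monomial
            (α + Finsupp.single (i, j) 1 + Finsupp.single (i, j) 1) c := by
        rw [MvPolynomial.X, sq, mul_assoc, MvPolynomial.monomial_mul, MvPolynomial.monomial_mul]
        simp only [one_mul]
        congr 2
        abel
      have e2 : moments (α + Finsupp.single (i, j) 1 + Finsupp.single (i, j) 1)
          = ((α (i, j) : ℂ) + 1) * moments α := by
        rw [moments_add_single]
        simp
      rw [e1, rowMean_monomial, rowMean_monomial, e2, Finsupp.mapDomain_add, Finsupp.mapDomain_add,
        Finsupp.mapDomain_single, MvPolynomial.X, sq, MvPolynomial.monomial_mul,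
        MvPolynomial.monomial_mul, MvPolynomial.C_mul_monomial]
      simp only [one_mul]
      congr 1
      · congr 1
        abel
      · ring
    have h2 : ((Finsupp.mapDomain Prod.fst α) i : ℂ) = ∑ j : Fin n, (α (i, j) : ℂ) := by
      rw [Finsupp.mapDomain, Finsupp.sum_apply, Finsupp.sum_fintype _ _ (by simp),
        Fintype.sum_prod_type, Finset.sum_eq_single i]
      · simp
      · intro k _ hk
        simp [hk]
      · simp
    rw [Finset.sum_mul, map_sum]
    simp only [h1]
    rw [← Finset.sum_mul, rowMean_monomial, MvPolynomial.X_mul_pderiv_monomial, ← map_sum,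
      Finset.sum_add_distrib, ← h2]
    simp only [Finset.sum_const, Finset.card_univ, Fintype.card_fin, nsmul_eq_mul, mul_one, map_add,
      map_natCast]
    ring
  | add p q hp hq =>
    rw [mul_add, map_add, hp, hq, map_add, map_add]
    ring

end RowMean

/-- The derivation `∑ xᵢ² ∂ᵢ`. -/
def sqDeriv (m : ℕ) : Derivation ℂ (MvPolynomial (Fin m) ℂ) (MvPolynomial (Fin m) ℂ) :=
  MvPolynomial.mkDerivation ℂ fun i => MvPolynomial.X i ^ 2

lemma sqDeriv_apply {m : ℕ} (p : MvPolynomial (Fin m) ℂ) :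
    sqDeriv m p = ∑ i, MvPolynomial.X i ^ 2 * MvPolynomial.pderiv i p := by
  have h : sqDeriv m = ∑ i, (MvPolynomial.X i ^ 2 : MvPolynomial (Fin m) ℂ) •
      MvPolynomial.pderiv i := by
    refine MvPolynomial.derivation_ext fun j => ?_
    rw [sqDeriv, MvPolynomial.mkDerivation_X, ← Derivation.coeFnAddMonoidHom_apply, map_sum]
    simp [MvPolynomial.pderiv_X, Pi.single_apply, Finset.sum_apply]
  rw [h, ← Derivation.coeFnAddMonoidHom_apply, map_sum]
  simp

/-- The substitution `x = l²` doubles the Euler operator; this is how `n` becomes `n / 2`. -/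
lemma X_mul_pderiv_expand {m : ℕ} (i : Fin m) (p : MvPolynomial (Fin m) ℂ) :
    MvPolynomial.X i * MvPolynomial.pderiv i (MvPolynomial.expand 2 p)
      = MvPolynomial.expand 2 (2 * (MvPolynomial.X i * MvPolynomial.pderiv i p)) := by
  induction p using MvPolynomial.induction_on' with
  | monomial α c =>
    rw [MvPolynomial.expand_monomial, MvPolynomial.X_mul_pderiv_monomial,
      MvPolynomial.X_mul_pderiv_monomial, map_mul, map_nsmul, MvPolynomial.expand_monomial, map_ofNat]
    simp only [Finsupp.smul_apply, nsmul_eq_mul, smul_eq_mul]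
    push_cast
    ring
  | add p q hp hq =>
    rw [map_add, map_add, mul_add, hp, hq, ← map_add, map_add (MvPolynomial.pderiv i)]
    congr 1
    ring

lemma expand_two_injective (m : ℕ) :
    Function.Injective (MvPolynomial.expand 2 : MvPolynomial (Fin m) ℂ →ₐ[ℂ] _) := by
  intro p q h
  refine mvPolynomial_ext_pos fun z hz => ?_
  have h2 := congrArg (MvPolynomial.eval fun i => ((Real.sqrt (z i) : ℝ) : ℂ)) h
  have h3 : ∀ p : MvPolynomial (Fin m) ℂ, MvPolynomial.eval (fun i => ((Real.sqrt (z i) : ℝ) : ℂ))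
      (MvPolynomial.expand 2 p) = MvPolynomial.eval (fun i => (z i : ℂ)) p := by
    intro p
    rw [MvPolynomial.eval_expand]
    congr 2
    ext i
    simp only [Pi.pow_apply]
    rw [← Complex.ofReal_pow, Real.sq_sqrt (hz i).le]
  rwa [h3, h3] at h2

/-- `zonalMean σ (W Wᵀ)` as a polynomial in the entries of `W`. -/
lemma exists_gramPoly (m n : ℕ) (σ : Fin m → ℕ) : ∃ p : MvPolynomial (Fin m × Fin n) ℂ, ∀ w,
    MvPolynomial.eval w p
      = zonalMean σ (symCong (Matrix.of fun i j => w (i, j)) (symDiag fun _ : Fin n => 1)) := by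
  let v : Fin m × Fin n → (Fin m × Fin n → ℂ) → ℂ := fun i w => w i
  have h : (fun w : Fin m × Fin n → ℂ => zonalMean σ
      (symCong (Matrix.of fun i j => w (i, j)) (symDiag fun _ : Fin n => 1))) ∈ polyAlg v := by
    refine comp_mem_of_mem_polyAlg _ (zeta_mem_polyAlg σ) fun i j => ?_
    exact mul_mul_matrix_mem (polyAlg v) (fun w => Matrix.of fun i j => w (i, j))
      (fun _ => (symDiag fun _ : Fin n => 1 : SymMat n).1)
      (fun w => (Matrix.of fun i j => w (i, j))ᵀ)
      (fun i j => coord_mem_polyAlg v (i, j)) (fun _ _ => const_mem _ _)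
      (fun i j => coord_mem_polyAlg v (j, i)) i j
  obtain ⟨p, hp⟩ := mem_polyAlg.1 h
  exact ⟨p, fun w => (hp w).symm⟩

/-- `zonalMean σ (W Wᵀ)` as a polynomial in the entries of `W`. -/
def gramPoly (m n : ℕ) (σ : Fin m → ℕ) : MvPolynomial (Fin m × Fin n) ℂ :=
  (exists_gramPoly m n σ).choose

lemma eval_gramPoly {m n : ℕ} (σ : Fin m → ℕ) (w : Fin m × Fin n → ℂ) :
    MvPolynomial.eval w (gramPoly m n σ)
      = zonalMean σ (symCong (Matrix.of fun i j => w (i, j)) (symDiag fun _ : Fin n => 1)) :=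
  (exists_gramPoly m n σ).choose_spec w

/-- The mean value property at `diag(l)²`, with `ζ_σ(1_n)` evaluated by `zeta_one`. Positive `l`
suffice to compare polynomials and make `diag(l)` invertible. -/
lemma rowMean_gramPoly {m n t : ℕ} {σ : Fin m → ℕ} (hσ : σ ∈ partitions m t) :
    rowMean m n (gramPoly m n σ) = MvPolynomial.C (2 ^ t * risingPartition ((n : ℂ) / 2) σ) *
      MvPolynomial.expand 2 (zonalPoly σ) := by
  obtain ⟨rfl, hanti⟩ := mem_partitions.1 hσ
  refine mvPolynomial_ext_pos fun l hl => ?_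
  let L : GL (Fin m) ℝ := Matrix.GeneralLinearGroup.mkOfDetNeZero (Matrix.diagonal l) (by
      rw [Matrix.det_diagonal]
      exact Finset.prod_ne_zero_iff.2 fun i _ => (hl i).ne')
  have hLc : (L : Matrix (Fin m) (Fin m) ℝ).map Complex.ofReal
      = Matrix.diagonal fun i => (l i : ℂ) := map_ofReal_diagonal _
  have h1 : ∀ z : Fin m × Fin n → ℝ, MvPolynomial.eval (fun ij => (l ij.1 : ℂ) * (z ij : ℂ))
      (gramPoly m n σ) = zonalMean σ (symCong ((L : Matrix (Fin m) (Fin m) ℝ).map Complex.ofReal)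
        (symCong (gmat z) (symDiag fun _ => 1))) := by
    intro z
    rw [eval_gramPoly, ← symCong_mul, hLc]
    congr 2
    ext i j
    simp [Matrix.diagonal_mul, gmat]
  rw [eval_rowMean]
  simp only [h1]
  rw [integral_zonalSpace_conj (zonalMean_mem_zonalSpace σ), zeta_one n hanti, map_mul,
    MvPolynomial.eval_C, MvPolynomial.eval_expand, eval_zonalPoly, mul_comm]
  congr 2
  apply Subtype.ext
  rw [coe_symCong, hLc]
  simp [coe_symDiag, sq]

lemma sum_sq_mul_gramPoly {m n t : ℕ} {τ : Fin m → ℕ} {k : (Fin m → ℕ) → ℂ}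
    (hk : powerSum m * zonalPoly τ = ∑ σ ∈ partitions m t, MvPolynomial.C (k σ) * zonalPoly σ) :
    (∑ i, ∑ j, MvPolynomial.X (i, j) ^ 2) * gramPoly m n τ
      = ∑ σ ∈ partitions m t, MvPolynomial.C (k σ) * gramPoly m n σ := by
  refine MvPolynomial.funext fun w => ?_
  set Y : SymMat m := symCong (Matrix.of fun i j => w (i, j)) (symDiag fun _ : Fin n => 1) with hY
  obtain ⟨ev, hev⟩ := exists_eigenvalues (Y : Matrix (Fin m) (Fin m) ℂ)
  have htr : MvPolynomial.eval w (∑ i, ∑ j, MvPolynomial.X (i, j) ^ 2)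
      = (Y : Matrix (Fin m) (Fin m) ℂ).trace := by
    simp [hY, coe_symCong, coe_symDiag, Matrix.trace, Matrix.mul_apply, sq]
  rw [map_mul, htr, eval_gramPoly, trace_eq_sum_eigenvalues hev, ← eval_powerSum,
    zonalMean_eq_eval τ Y hev, ← map_mul, hk, map_sum, map_sum]
  refine Finset.sum_congr rfl fun σ _ => ?_
  rw [map_mul, map_mul, eval_gramPoly, ← hY, zonalMean_eq_eval σ Y hev, MvPolynomial.eval_C,
    MvPolynomial.eval_C]

/-- The operator `c (x₁ + ⋯ + x_m) + ∑ xᵢ² ∂ᵢ`. -/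
def raise (m : ℕ) (c : ℂ) : Module.End ℂ (MvPolynomial (Fin m) ℂ) :=
  LinearMap.mulLeft ℂ (MvPolynomial.C c * powerSum m) + (sqDeriv m : _ →ₗ[ℂ] _)

lemma raise_apply {m : ℕ} (c : ℂ) (p : MvPolynomial (Fin m) ℂ) :
    raise m c p = MvPolynomial.C c * powerSum m * p + sqDeriv m p := rfl

/-- Apply `rowMean` to the expansion of `tr(W Wᵀ) ζ_τ(W Wᵀ)`. On one side the trace acts, in `x =
l²`, as `∑ xᵢ (n + 2 xᵢ ∂ᵢ)`, twice the operator `raise m (n / 2)`; on the other each term acquires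
`2 ^ (t + 1) (n/2)_σ`. -/
lemma raise_zonalPoly_half {m t : ℕ} {τ : Fin m → ℕ} (hτ : τ ∈ partitions m t)
    {k : (Fin m → ℕ) → ℂ} (hk : powerSum m * zonalPoly τ
      = ∑ σ ∈ partitions m (t + 1), MvPolynomial.C (k σ) * zonalPoly σ) (n : ℕ) :
    MvPolynomial.C (risingPartition ((n : ℂ) / 2) τ) * raise m ((n : ℂ) / 2) (zonalPoly τ)
      = ∑ σ ∈ partitions m (t + 1), MvPolynomial.C (k σ * risingPartition ((n : ℂ) / 2) σ) *
        zonalPoly σ := by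
  have h := congrArg (rowMean m n) (sum_sq_mul_gramPoly (n := n) hk)
  rw [Finset.sum_mul, map_sum, map_sum] at h
  simp only [rowMean_sq_mul, rowMean_gramPoly hτ] at h
  have h2 : ∀ σ ∈ partitions m (t + 1), rowMean m n (MvPolynomial.C (k σ) * gramPoly m n σ)
      = MvPolynomial.C (k σ) * (MvPolynomial.C (2 ^ (t + 1) * risingPartition ((n : ℂ) / 2) σ) *
      MvPolynomial.expand 2 (zonalPoly σ)) := by
    intro σ hσ
    rw [← MvPolynomial.smul_eq_C_mul, map_smul, rowMean_gramPoly hσ, MvPolynomial.smul_eq_C_mul]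
  rw [Finset.sum_congr rfl h2] at h
  simp only [MvPolynomial.pderiv_C_mul] at h
  simp only [mul_left_comm (MvPolynomial.X _) (MvPolynomial.C _), X_mul_pderiv_expand] at h
  have h3 : ∑ i : Fin m, MvPolynomial.X i * (MvPolynomial.C (n : ℂ) *
            (MvPolynomial.C (2 ^ t * risingPartition ((n : ℂ) / 2) τ) * zonalPoly τ)
            + MvPolynomial.C (2 ^ t * risingPartition ((n : ℂ) / 2) τ) *
              (2 * (MvPolynomial.X i * MvPolynomial.pderiv i (zonalPoly τ))))
      = ∑ σ ∈ partitions m (t + 1), MvPolynomial.C (k σ) *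
        (MvPolynomial.C (2 ^ (t + 1) * risingPartition ((n : ℂ) / 2) σ) * zonalPoly σ) := by
    apply expand_two_injective m
    simp only [map_sum, map_add, map_mul, MvPolynomial.expand_C, MvPolynomial.expand_X,
      map_ofNat] at h ⊢
    exact h
  have h4 : (MvPolynomial.C ((2 : ℂ) ^ (t + 1)) : MvPolynomial (Fin m) ℂ) ≠ 0 := by
    rw [Ne, MvPolynomial.C_eq_zero]; exact pow_ne_zero _ two_ne_zero
  refine mul_left_cancel₀ h4 ?_
  have h5 : (MvPolynomial.C (n : ℂ) : MvPolynomial (Fin m) ℂ) = 2 * MvPolynomial.C ((n : ℂ) / 2) := by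
    rw [← map_ofNat MvPolynomial.C 2, ← map_mul]
    congr 1
    ring
  calc _ = ∑ i : Fin m, MvPolynomial.X i * (MvPolynomial.C (n : ℂ) *
            (MvPolynomial.C (2 ^ t * risingPartition ((n : ℂ) / 2) τ) * zonalPoly τ)
            + MvPolynomial.C (2 ^ t * risingPartition ((n : ℂ) / 2) τ) *
              (2 * (MvPolynomial.X i * MvPolynomial.pderiv i (zonalPoly τ)))) := by
        rw [raise_apply, sqDeriv_apply, powerSum, Finset.mul_sum, Finset.sum_mul,
          ← Finset.sum_add_distrib, Finset.mul_sum, Finset.mul_sum]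
        refine Finset.sum_congr rfl fun i _ => ?_
        rw [h5]
        simp only [map_mul, map_pow, map_ofNat]
        ring
    _ = _ := h3
    _ = _ := by
        rw [Finset.mul_sum]
        refine Finset.sum_congr rfl fun σ _ => ?_
        simp only [map_mul]
        ring

lemma exists_risingPoly {m : ℕ} (τ : Fin m → ℕ) :
    ∃ P : Polynomial ℂ, ∀ c, P.eval c = risingPartition c τ := by
  refine ⟨∏ i : Fin m, ∏ j ∈ Finset.range (τ i),
    (Polynomial.X - Polynomial.C (((i : ℕ) : ℂ) / 2) + Polynomial.C (j : ℂ)), fun c => ?_⟩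
  simp only [Polynomial.eval_prod, Polynomial.eval_add, Polynomial.eval_sub, Polynomial.eval_X,
    Polynomial.eval_C, risingPartition, rising]

/-- At each point both sides are polynomial in `c`, and they agree at the infinitely many values `n
/ 2`. -/
lemma raise_zonalPoly {m t : ℕ} {τ : Fin m → ℕ} (hτ : τ ∈ partitions m t)
    {k : (Fin m → ℕ) → ℂ} (hk : powerSum m * zonalPoly τ
      = ∑ σ ∈ partitions m (t + 1), MvPolynomial.C (k σ) * zonalPoly σ) (c : ℂ) :
    MvPolynomial.C (risingPartition c τ) * raise m c (zonalPoly τ)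
      = ∑ σ ∈ partitions m (t + 1), MvPolynomial.C (k σ * risingPartition c σ) * zonalPoly σ := by
  refine MvPolynomial.funext fun x => ?_
  choose P hP using fun τ : Fin m → ℕ => exists_risingPoly τ
  let p : Polynomial ℂ := P τ * (Polynomial.X * Polynomial.C (MvPolynomial.eval x (powerSum m) *
    MvPolynomial.eval x (zonalPoly τ)) + Polynomial.C (MvPolynomial.eval x (sqDeriv m (zonalPoly τ))))
  let q : Polynomial ℂ := ∑ σ ∈ partitions m (t + 1), Polynomial.C (k σ) * P σ *
    Polynomial.C (MvPolynomial.eval x (zonalPoly σ))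
  have hp : ∀ c, p.eval c = MvPolynomial.eval x
      (MvPolynomial.C (risingPartition c τ) * raise m c (zonalPoly τ)) := by
    intro c
    simp [p, hP, raise_apply, mul_assoc]
  have hq : ∀ c, q.eval c = MvPolynomial.eval x
      (∑ σ ∈ partitions m (t + 1), MvPolynomial.C (k σ * risingPartition c σ) * zonalPoly σ) := by
    intro c
    simp [q, hP, Polynomial.eval_finsetSum]
  rw [← hp, ← hq]
  congr 1
  refine Polynomial.eq_of_infinite_eval_eq _ _ ?_
  refine (Set.infinite_range_of_injective (f := fun n : ℕ => (n : ℂ) / 2) ?_).mono ?_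
  · intro a b h
    have h' : (a : ℂ) / 2 = (b : ℂ) / 2 := h
    have : (a : ℂ) = b := by linear_combination 2 * h'
    exact_mod_cast this
  · rintro _ ⟨n, rfl⟩
    show p.eval _ = q.eval _
    rw [hp, hq, raise_zonalPoly_half hτ hk]

/-! ### Kummer's transformation in each degree -/

/-- `g` arises from the symmetric polynomial `f` of degree `t` by multiplying its component along
`zonalPoly τ` by `(c)_τ`. -/
def RisingImage (m : ℕ) (c : ℂ) (t : ℕ) (f g : MvPolynomial (Fin m) ℂ) : Prop :=
  ∃ k : (Fin m → ℕ) → ℂ, f = ∑ τ ∈ partitions m t, MvPolynomial.C (k τ) * zonalPoly τ ∧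
    g = ∑ τ ∈ partitions m t, MvPolynomial.C (k τ * risingPartition c τ) * zonalPoly τ

lemma eq_of_sum_zonalPoly {m t : ℕ} {k k' : (Fin m → ℕ) → ℂ}
    (h : ∑ τ ∈ partitions m t, MvPolynomial.C (k τ) * zonalPoly τ
      = ∑ τ ∈ partitions m t, MvPolynomial.C (k' τ) * zonalPoly τ) :
    ∀ τ ∈ partitions m t, k τ = k' τ := by
  intro τ hτ
  refine sub_eq_zero.1 (eq_zero_of_sum_zonalPoly (fun τ => k τ - k' τ) ?_ τ hτ)
  simp only [map_sub, sub_mul, Finset.sum_sub_distrib, h, sub_self]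

namespace RisingImage
variable {m t : ℕ} {c : ℂ} {f g f' g' : MvPolynomial (Fin m) ℂ}

lemma smul (h : RisingImage m c t f g) (z : ℂ) : RisingImage m c t (z • f) (z • g) := by
  obtain ⟨k, rfl, rfl⟩ := h
  refine ⟨fun τ => z * k τ, ?_, ?_⟩ <;>
  · rw [Finset.smul_sum]
    refine Finset.sum_congr rfl fun τ _ => ?_
    rw [MvPolynomial.smul_eq_C_mul]
    simp only [map_mul]
    ring

lemma sum {ι : Type*} (s : Finset ι) {f g : ι → MvPolynomial (Fin m) ℂ}
    (h : ∀ i ∈ s, RisingImage m c t (f i) (g i)) :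
    RisingImage m c t (∑ i ∈ s, f i) (∑ i ∈ s, g i) := by
  choose! k hf hg using h
  refine ⟨fun τ => ∑ i ∈ s, k i τ, ?_, ?_⟩
  · rw [Finset.sum_congr rfl hf, Finset.sum_comm]
    simp only [map_sum, Finset.sum_mul]
  · rw [Finset.sum_congr rfl hg, Finset.sum_comm]
    simp only [map_sum, Finset.sum_mul]

lemma unique (h : RisingImage m c t f g) (h' : RisingImage m c t f g') : g = g' := by
  obtain ⟨k, h1, rfl⟩ := h
  obtain ⟨k', h2, rfl⟩ := h'
  refine Finset.sum_congr rfl fun τ hτ => ?_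
  rw [eq_of_sum_zonalPoly (h1.symm.trans h2) τ hτ]

lemma injective (hc : ∀ τ ∈ partitions m t, risingPartition c τ ≠ 0) (h : RisingImage m c t f g)
    (h' : RisingImage m c t f' g) : f = f' := by
  obtain ⟨k, rfl, h1⟩ := h
  obtain ⟨k', rfl, h2⟩ := h'
  refine Finset.sum_congr rfl fun τ hτ => ?_
  rw [mul_right_cancel₀ (hc τ hτ) (eq_of_sum_zonalPoly (h1.symm.trans h2) τ hτ)]

/-- The intertwining property: multiplication by the trace upstairs is `raise m c` downstairs. -/
lemma raise (h : RisingImage m c t f g) :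
    RisingImage m c (t + 1) (powerSum m * f) (KummerPearson.raise m c g) := by
  obtain ⟨k, rfl, rfl⟩ := h
  rw [Finset.mul_sum, map_sum]
  refine sum _ fun τ hτ => ?_
  obtain ⟨rfl, hanti⟩ := mem_partitions.1 hτ
  obtain ⟨k', hk'⟩ := exists_eq_sum_zonalPoly (p := powerSum m * zonalPoly τ)
    (Subalgebra.mul_mem (MvPolynomial.symmetricSubalgebra (Fin m) ℂ) (powerSum_isSymmetric m)
      (zonalPoly_isSymmetric τ))
    (t := (∑ i, τ i) + 1) (by
      rw [add_comm]; exact (powerSum_isHomogeneous m).mul (zonalPoly_isHomogeneous hanti))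
  have h1 : RisingImage m c (∑ i, τ i + 1) (powerSum m * zonalPoly τ)
      (MvPolynomial.C (risingPartition c τ) * KummerPearson.raise m c (zonalPoly τ)) :=
    ⟨k', hk', raise_zonalPoly hτ hk' c⟩
  convert h1.smul (k τ) using 1
  · rw [MvPolynomial.smul_eq_C_mul]; ring
  · rw [← MvPolynomial.smul_eq_C_mul, map_smul, mul_smul, MvPolynomial.smul_eq_C_mul (_ : _) (risingPartition c τ)]

lemma raise_iterate (h : RisingImage m c t f g) (j : ℕ) :
    RisingImage m c (t + j) (powerSum m ^ j * f) ((KummerPearson.raise m c ^ j) g) := by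
  induction j with
  | zero => simpa using h
  | succ j ih =>
    rw [pow_succ', pow_succ', mul_assoc]
    exact ih.raise

lemma one (m : ℕ) (c : ℂ) : RisingImage m c 0 1 1 := by
  obtain ⟨k, hk⟩ := exists_eq_sum_zonalPoly (m := m) (t := 0) (p := 1)
    (Subalgebra.one_mem (MvPolynomial.symmetricSubalgebra (Fin m) ℂ))
    (MvPolynomial.isHomogeneous_one _ _)
  refine ⟨k, hk, hk.trans (Finset.sum_congr rfl fun τ hτ => ?_)⟩
  have h0 : ∀ i, τ i = 0 := fun i => by
    have := (mem_partitions.1 hτ).1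
    simpa using (Finset.sum_eq_zero_iff.1 this) i (Finset.mem_univ i)
  have h1 : risingPartition c τ = 1 := by simp [risingPartition, rising, h0]
  rw [h1, mul_one]

end RisingImage

/-- The homogeneous component of degree `t` of `₁F₁(a; c; x)`, times `t!`. -/
def kummerPoly (m : ℕ) (a c : ℂ) (t : ℕ) : MvPolynomial (Fin m) ℂ :=
  ∑ τ ∈ partitions m t, MvPolynomial.C (traceCoeff m t τ * (risingPartition a τ / risingPartition c τ))
    * zonalPoly τ

/-- Multiplying by `(c)_τ` cancels the denominators and leaves the `(a)_τ`-image of the `t`-th power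
of the trace, which is `raise m a` iterated on `1`. -/
lemma risingImage_kummerPoly {m t : ℕ} (a : ℂ) {c : ℂ}
    (hc : ∀ τ ∈ partitions m t, risingPartition c τ ≠ 0) :
    RisingImage m c t (kummerPoly m a c t) ((raise m a ^ t) 1) := by
  refine ⟨_, rfl, ?_⟩
  have h1 := (RisingImage.one m a).raise_iterate t
  rw [zero_add, mul_one] at h1
  rw [h1.unique ⟨_, powerSum_pow_eq m t, rfl⟩]
  refine Finset.sum_congr rfl fun τ hτ => ?_
  rw [mul_assoc, div_mul_cancel₀ _ (hc τ hτ)]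

/-- Left and right multiplications commute even when `x` and `y` do not, so the binomial theorem
applies. -/
lemma mulLeft_sub_mulRight_pow {R : Type*} [Ring R] [Algebra ℂ R] (x y : R) (t : ℕ) :
    ((LinearMap.mulLeft ℂ y - LinearMap.mulRight ℂ x) ^ t) 1
      = ∑ k ∈ Finset.range (t + 1), ((-1) ^ k * (t.choose k : ℂ)) • (y ^ (t - k) * x ^ k) := by
  have hneg : LinearMap.mulLeft ℂ y - LinearMap.mulRight ℂ x
      = LinearMap.mulRight ℂ (-x) + LinearMap.mulLeft ℂ y := by
    ext z
    simp [sub_eq_neg_add]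
  rw [hneg, (LinearMap.commute_mulLeft_right _ _).symm.add_pow, LinearMap.sum_apply]
  refine Finset.sum_congr rfl fun k _ => ?_
  rw [Module.End.mul_apply, Module.End.natCast_apply, map_nsmul, Module.End.mul_apply,
    LinearMap.pow_mulLeft, LinearMap.mulLeft_apply, mul_one, LinearMap.pow_mulRight,
    ← Nat.cast_smul_eq_nsmul ℂ, mul_comm,
    mul_smul]
  congr 1
  rcases Nat.even_or_odd k with h | h <;> simp [h.neg_one_pow, h.neg_pow]

/-- By the Leibniz rule, `raise a g * f = raise c (g * f) - g * raise (c - a) f`. Hence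
multiplication by the iterates of `raise a` on `1` is produced by powers of `mulLeft (raise c) -
mulRight (raise (c - a))`. -/
lemma sum_raise_pow {m : ℕ} (a c : ℂ) (t : ℕ) (f : MvPolynomial (Fin m) ℂ) :
    ∑ k ∈ Finset.range (t + 1), ((-1) ^ k * (t.choose k : ℂ)) •
      (raise m c ^ (t - k)) ((raise m (c - a) ^ k) f) = (raise m a ^ t) 1 * f := by
  have h1 : ∀ (t : ℕ) (f : MvPolynomial (Fin m) ℂ),
      ((LinearMap.mulLeft ℂ (raise m c) - LinearMap.mulRight ℂ (raise m (c - a))) ^ t) 1 f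
        = (raise m a ^ t) 1 * f := by
    intro t
    induction t with
    | zero => intro f; rw [pow_zero, pow_zero, Module.End.one_apply, Module.End.one_apply,
        Module.End.one_apply, one_mul]
    | succ t ih =>
      intro f
      rw [pow_succ', Module.End.mul_apply, LinearMap.sub_apply, LinearMap.sub_apply,
        LinearMap.mulRight_apply, LinearMap.mulLeft_apply, Module.End.mul_apply,
        Module.End.mul_apply, ih, ih, pow_succ', Module.End.mul_apply, raise_apply, raise_apply,
        raise_apply, Derivation.leibniz]
      simp only [smul_eq_mul, map_sub]
      ring
  rw [← h1, mulLeft_sub_mulRight_pow, LinearMap.sum_apply]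
  refine Finset.sum_congr rfl fun k _ => ?_
  rw [LinearMap.smul_apply, Module.End.mul_apply]

/-- The homogeneous form of Kummer's transformation. -/
lemma kummerPoly_eq {m : ℕ} (a : ℂ) {c : ℂ} (hc : ∀ τ : Fin m → ℕ, risingPartition c τ ≠ 0) (t : ℕ) :
    kummerPoly m a c t = ∑ k ∈ Finset.range (t + 1), ((-1) ^ k * (t.choose k : ℂ)) •
      (powerSum m ^ (t - k) * kummerPoly m (c - a) c k) := by
  have h1 := risingImage_kummerPoly (t := t) a fun τ _ => hc τ
  rw [← mul_one ((raise m a ^ t) 1), ← sum_raise_pow a c t 1] at h1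
  -- Both sides have the same `(c)_τ`-image, and no `(c)_τ` vanishes.
  refine RisingImage.injective (fun τ _ => hc τ) h1 (RisingImage.sum _ fun k hk => ?_)
  have hk' : k + (t - k) = t := by have := Finset.mem_range.1 hk; omega
  have h2 := (risingImage_kummerPoly (t := k) (c - a) fun τ _ => hc τ).raise_iterate (t - k)
  rw [hk'] at h2
  exact h2.smul _

/-! ### Growth of rising factorials and absolute convergence -/

lemma rising_succ (b : ℂ) (t : ℕ) : rising b (t + 1) = rising b t * (b + t) :=
  Finset.prod_range_succ _ _

lemma rising_add (b : ℂ) (k j : ℕ) : rising b (k + j) = rising b k * rising (b + k) j := by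
  rw [rising, Finset.prod_range_add, rising, rising]
  congr 1
  exact Finset.prod_congr rfl fun i _ => by push_cast; ring

lemma rising_one (t : ℕ) : rising 1 t = (t.factorial : ℂ) := by
  induction t with
  | zero => simp [rising]
  | succ t ih => rw [rising_succ, ih, Nat.factorial_succ]; push_cast; ring

lemma rising_eq_eval (b : ℂ) (t : ℕ) : rising b t = (ascPochhammer ℂ t).eval b := by
  induction t with
  | zero => simp [rising]
  | succ t ih => rw [rising_succ, ih, ascPochhammer_succ_eval]

lemma add_natCast_ne_zero {γ : ℂ} (hγ : 0 < γ.re) (k : ℕ) : γ + k ≠ 0 := by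
  intro h
  have := congrArg Complex.re h
  simp at this
  have := k.cast_nonneg (α := ℝ)
  linarith

lemma rising_ne_zero {γ : ℂ} (hγ : 0 < γ.re) (k : ℕ) : rising γ k ≠ 0 :=
  Finset.prod_ne_zero_iff.2 fun j _ => add_natCast_ne_zero hγ j

lemma exists_norm_rising_le (α : ℂ) {γ : ℂ} (hγ : 0 < γ.re) {r : ℝ} (hr : 1 < r) :
    ∃ K : ℝ, 0 ≤ K ∧ ∀ k, ‖rising α k‖ ≤ K * r ^ k * ‖rising γ k‖ := by
  have hr0 : 0 < r := by linarith
  -- From this index on `‖α‖ + k ≤ r (k - ‖γ‖)`, so the normalized quotient `u` no longer increases.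
  obtain ⟨N, hN⟩ := exists_nat_gt ((‖α‖ + r * ‖γ‖) / (r - 1))
  rw [div_lt_iff₀ (by linarith)] at hN
  have hq : ∀ k, N ≤ k → ‖α + k‖ ≤ r * ‖γ + k‖ := by
    intro k hk
    have hk' : (N : ℝ) ≤ k := by exact_mod_cast hk
    have h1 : ‖α + k‖ ≤ ‖α‖ + k := (norm_add_le _ _).trans_eq (by simp)
    have h2 : (k : ℝ) - ‖γ‖ ≤ ‖γ + k‖ := by
      have := norm_sub_norm_le (k : ℂ) (-γ)
      rw [sub_neg_eq_add, norm_neg, add_comm] at this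
      simpa using this
    nlinarith
  let u : ℕ → ℝ := fun k => ‖rising α k‖ / (r ^ k * ‖rising γ k‖)
  have hden : ∀ k, 0 < r ^ k * ‖rising γ k‖ := fun k =>
    mul_pos (pow_pos hr0 k) (norm_pos_iff.2 (rising_ne_zero hγ k))
  have hu0 : ∀ k, 0 ≤ u k := fun k => div_nonneg (norm_nonneg _) (hden k).le
  have hmono : ∀ k, N ≤ k → u k ≤ u N := by
    intro k hk
    induction k, hk using Nat.le_induction with
    | base => exact le_refl _
    | succ k hk ih =>
      refine le_trans ?_ ih
      simp only [u]
      rw [div_le_div_iff₀ (hden _) (hden _), rising_succ, rising_succ, norm_mul, norm_mul, pow_succ]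
      have := mul_le_mul_of_nonneg_left (hq k hk)
        (mul_nonneg (norm_nonneg (rising α k)) (hden k).le)
      linarith
  refine ⟨∑ j ∈ Finset.range (N + 1), u j, Finset.sum_nonneg fun j _ => hu0 j, fun k => ?_⟩
  rw [mul_assoc, ← div_le_iff₀ (hden k)]
  have hsingle : ∀ j ≤ N, u j ≤ ∑ j ∈ Finset.range (N + 1), u j := fun j hj =>
    Finset.single_le_sum (f := u) (fun i _ => hu0 i) (Finset.mem_range.2 (by omega))
  rcases le_total k N with h | h
  · exact hsingle k h
  · exact (hmono k h).trans (hsingle N le_rfl)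

lemma exists_norm_rising_le_factorial (b : ℂ) {r : ℝ} (hr : 1 < r) :
    ∃ K : ℝ, 0 ≤ K ∧ ∀ k, ‖rising b k‖ ≤ K * r ^ k * k.factorial := by
  obtain ⟨K, hK, h⟩ := exists_norm_rising_le b (γ := 1) (by simp) hr
  refine ⟨K, hK, fun k => (h k).trans_eq ?_⟩
  rw [rising_one]
  simp

lemma re_sub_half_pos {m : ℕ} {c : ℂ} (hc : ((m : ℝ) - 1) / 2 < c.re) (i : Fin m) :
    0 < (c - ((i : ℕ) : ℂ) / 2).re := by
  have h1 : (((i : ℕ) : ℂ) / 2).re = (i : ℕ) / 2 := by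
    rw [show ((i : ℕ) : ℂ) / 2 = (((i : ℕ) / 2 : ℝ) : ℂ) by push_cast; ring, Complex.ofReal_re]
  have h2 : ((i : ℕ) : ℝ) + 1 ≤ m := by exact_mod_cast i.2
  rw [Complex.sub_re, h1]
  linarith

lemma risingPartition_ne_zero {m : ℕ} {c : ℂ} (hc : ((m : ℝ) - 1) / 2 < c.re) (τ : Fin m → ℕ) :
    risingPartition c τ ≠ 0 :=
  Finset.prod_ne_zero_iff.2 fun i _ => rising_ne_zero (re_sub_half_pos hc i) _

lemma exists_norm_risingPartition_div_le {m : ℕ} (a : ℂ) {c : ℂ} (hc : ((m : ℝ) - 1) / 2 < c.re)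
    {r : ℝ} (hr : 1 < r) : ∃ K : ℝ, 0 ≤ K ∧ ∀ t, ∀ τ ∈ partitions m t,
      ‖risingPartition a τ / risingPartition c τ‖ ≤ K * r ^ t := by
  choose K hK0 hK using fun i : Fin m =>
    exists_norm_rising_le (a - ((i : ℕ) : ℂ) / 2) (re_sub_half_pos hc i) hr
  refine ⟨∏ i, K i, Finset.prod_nonneg fun i _ => hK0 i, fun t τ hτ => ?_⟩
  rw [norm_div, div_le_iff₀ (norm_pos_iff.2 (risingPartition_ne_zero hc τ)), risingPartition,
    risingPartition, norm_prod, norm_prod, ← (mem_partitions.1 hτ).1, ← Finset.prod_pow_eq_pow_sum,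
    ← Finset.prod_mul_distrib, ← Finset.prod_mul_distrib]
  exact Finset.prod_le_prod (fun i _ => norm_nonneg _) fun i _ => hK i _

/-- Nonnegativity of all coefficients allows each eigenvalue to be replaced by its modulus, after
which the sum is a power of the trace. This yields the radius `∑ |λᵢ|`. -/
lemma sum_norm_traceCoeff_mul_zonalPoly_le {m t : ℕ} (ev : Fin m → ℂ) :
    ∑ τ ∈ partitions m t, ‖traceCoeff m t τ * MvPolynomial.eval ev (zonalPoly τ)‖
      ≤ (∑ i, ‖ev i‖) ^ t := by
  have h1 : ∀ τ ∈ partitions m t, (((‖traceCoeff m t τ‖ * realMean τ fun i => ‖ev i‖) : ℝ) : ℂ)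
      = MvPolynomial.eval (fun i => ((‖ev i‖ : ℝ) : ℂ))
        (MvPolynomial.C (traceCoeff m t τ) * zonalPoly τ) := by
    intro τ hτ
    obtain ⟨r, hr, h⟩ := traceCoeff_nonneg hτ
    rw [map_mul, MvPolynomial.eval_C, eval_zonalPoly_ofReal, h, Complex.norm_real, Real.norm_eq_abs,
      abs_of_nonneg hr, Complex.ofReal_mul]
  have h2 : ∑ τ ∈ partitions m t, ‖traceCoeff m t τ‖ * realMean τ (fun i => ‖ev i‖)
      = (∑ i, ‖ev i‖) ^ t := by
    have h3 : ((∑ τ ∈ partitions m t, ‖traceCoeff m t τ‖ * realMean τ (fun i => ‖ev i‖) : ℝ) : ℂ)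
        = (((∑ i, ‖ev i‖) ^ t : ℝ) : ℂ) := by
      rw [Complex.ofReal_sum, Finset.sum_congr rfl h1, ← map_sum, ← powerSum_pow_eq, map_pow,
        eval_powerSum]
      push_cast
      rfl
    exact_mod_cast h3
  rw [← h2]
  refine Finset.sum_le_sum fun τ _ => ?_
  rw [norm_mul, eval_zonalPoly]
  exact mul_le_mul_of_nonneg_left (norm_zonalMean_le τ ev) (norm_nonneg _)

lemma exists_norm_kummerPoly_le {m : ℕ} (a : ℂ) {c : ℂ} (hc : ((m : ℝ) - 1) / 2 < c.re)
    {r : ℝ} (hr : 1 < r) (ev : Fin m → ℂ) : ∃ K : ℝ, 0 ≤ K ∧ ∀ t,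
      ‖MvPolynomial.eval ev (kummerPoly m a c t)‖ ≤ K * (r * ∑ i, ‖ev i‖) ^ t := by
  obtain ⟨K, hK0, hK⟩ := exists_norm_risingPartition_div_le a hc hr
  refine ⟨K, hK0, fun t => ?_⟩
  rw [kummerPoly, map_sum]
  refine (norm_sum_le _ _).trans ?_
  have h0 : 0 ≤ K * r ^ t := mul_nonneg hK0 (by positivity)
  calc _ ≤ ∑ τ ∈ partitions m t, K * r ^ t *
          ‖traceCoeff m t τ * MvPolynomial.eval ev (zonalPoly τ)‖ := by
        refine Finset.sum_le_sum fun τ hτ => ?_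
        rw [map_mul, MvPolynomial.eval_C, mul_right_comm, norm_mul, mul_comm]
        exact mul_le_mul_of_nonneg_right (hK t τ hτ) (norm_nonneg _)
    _ ≤ _ := by
        rw [← Finset.mul_sum, mul_pow, ← mul_assoc]
        exact mul_le_mul_of_nonneg_left (sum_norm_traceCoeff_mul_zonalPoly_le ev) h0

lemma sum_zonal_eq {m : ℕ} (a c : ℂ) (X : SymMat m) {ev : Fin m → ℂ}
    (hev : (X : Matrix (Fin m) (Fin m) ℂ).charpoly.roots = Finset.univ.val.map ev) (t : ℕ) :
    ∑ τ ∈ partitions m t, risingPartition a τ / risingPartition c τ * zonal τ X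
      = MvPolynomial.eval ev (kummerPoly m a c t) := by
  rw [kummerPoly, map_sum]
  refine Finset.sum_congr rfl fun τ hτ => ?_
  rw [zonal_eq hτ, map_mul, MvPolynomial.eval_C, zonalMean_eq_eval τ X hev]
  ring

lemma sum_zonal_neg_eq {m : ℕ} (a c : ℂ) (X : SymMat m) {ev : Fin m → ℂ}
    (hev : (X : Matrix (Fin m) (Fin m) ℂ).charpoly.roots = Finset.univ.val.map ev) (t : ℕ) :
    ∑ τ ∈ partitions m t, risingPartition a τ / risingPartition c τ * zonal τ (-X)
      = (-1) ^ t * MvPolynomial.eval ev (kummerPoly m a c t) := by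
  rw [← sum_zonal_eq a c X hev, Finset.mul_sum]
  refine Finset.sum_congr rfl fun τ hτ => ?_
  obtain ⟨hsum, hanti⟩ := mem_partitions.1 hτ
  rw [zonal_eq hτ, zonal_eq hτ, ← neg_one_smul ℂ X, zonalMean_smul hanti, hsum]
  ring

lemma absEigenvalueSum_eq {m : ℕ} (X : SymMat m) {ev : Fin m → ℂ}
    (hev : (X : Matrix (Fin m) (Fin m) ℂ).charpoly.roots = Finset.univ.val.map ev) :
    absEigenvalueSum X = ∑ i, ‖ev i‖ := by
  rw [absEigenvalueSum, hev, Multiset.map_map]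
  rfl

/-- A power series with coefficients `(b)_t Aₜ / t!` converges where `Aₜ` is dominated. -/
lemma summable_rising_mul {b : ℂ} {A : ℕ → ℂ} {Λ : ℝ}
    (hA : ∀ r : ℝ, 1 < r → ∃ K : ℝ, 0 ≤ K ∧ ∀ t, ‖A t‖ ≤ K * (r * Λ) ^ t) (hΛ : 0 ≤ Λ) {z : ℂ}
    (hz : Λ < ‖z‖) : Summable fun t => rising b t / (t.factorial : ℂ) * A t * (z ^ t)⁻¹ := by
  have hz0 : 0 < ‖z‖ := hΛ.trans_lt hz
  -- One factor `r` pays for the growth of `(b)_t / t!`, the other for that of `A t`.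
  obtain ⟨r, hr, hrz⟩ : ∃ r : ℝ, 1 < r ∧ r * r * Λ < ‖z‖ := by
    have hcont : ContinuousAt (fun r : ℝ => r * r * Λ) 1 := by fun_prop
    have h1 : ∀ᶠ r in nhds (1 : ℝ), r * r * Λ < ‖z‖ :=
      hcont.eventually_lt continuousAt_const (by simpa using hz)
    obtain ⟨r, h, h'⟩ := ((h1.filter_mono nhdsWithin_le_nhds).and
      (self_mem_nhdsWithin (s := Set.Ioi 1))).exists
    exact ⟨r, h', h⟩
  obtain ⟨K, hK0, hK⟩ := hA r hr
  obtain ⟨K', hK0', hK'⟩ := exists_norm_rising_le_factorial b hr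
  have hr0 : 0 ≤ r := by linarith
  refine Summable.of_norm_bounded (g := fun t => K' * K * (r * r * Λ / ‖z‖) ^ t) ?_ fun t => ?_
  · refine (summable_geometric_of_lt_one (by positivity) ?_).mul_left _
    rwa [div_lt_one hz0]
  · rw [norm_mul, norm_mul, norm_inv, norm_pow, norm_div, Complex.norm_natCast, div_pow]
    have hf : (0 : ℝ) < t.factorial := by positivity
    have h1 : ‖rising b t‖ / t.factorial ≤ K' * r ^ t := by
      rw [div_le_iff₀ hf]; exact hK' t
    calc _ ≤ K' * r ^ t * (K * (r * Λ) ^ t) * (‖z‖ ^ t)⁻¹ := by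
          gcongr
          exact hK t
      _ = _ := by
          rw [mul_pow, mul_pow, mul_pow]
          ring

/-! ### The binomial series and rearrangement for large arguments -/

lemma hasSum_rising (β : ℂ) {y : ℂ} (hy : ‖y‖ < 1) :
    HasSum (fun j : ℕ => rising β j / (j.factorial : ℂ) * y ^ j) ((1 - y) ^ (-β)) := by
  have h := (Complex.one_div_one_sub_cpow_hasFPowerSeriesOnBall_zero β).hasSum (y := y) (by
    rw [mem_eball_zero_iff, ← ofReal_norm]
    exact ENNReal.ofReal_lt_one.2 hy)
  rw [zero_add, one_div, ← Complex.cpow_neg] at h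
  have hterm : ∀ j : ℕ, rising β j / (j.factorial : ℂ) * y ^ j
      = (FormalMultilinearSeries.ofScalars ℂ fun n => Ring.choose (β + (n : ℂ) - 1) n) j
        fun _ => y := by
    intro j
    have h1 := Ring.factorial_nsmul_multichoose_eq_ascPochhammer β j
    rw [Polynomial.ascPochhammer_smeval_eq_eval, ← rising_eq_eval] at h1
    have hf0 : (j.factorial : ℂ) ≠ 0 := by exact_mod_cast j.factorial_ne_zero
    rw [FormalMultilinearSeries.ofScalars_apply_eq, Ring.choose, smul_eq_mul, ← h1, nsmul_eq_mul,
      mul_div_cancel_left₀ _ hf0]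
    congr 2
    ring
  simpa only [hterm] using h

lemma tsum_antidiagonal {f : ℕ × ℕ → ℂ} (hf : Summable f) :
    ∑' t, ∑ p ∈ Finset.HasAntidiagonal.antidiagonal t, f p = ∑' p, f p := by
  have hs : Summable fun c : Σ t : ℕ, Finset.HasAntidiagonal.antidiagonal t =>
      f (Finset.HasAntidiagonal.sigmaAntidiagonalEquivProd c) :=
    Finset.HasAntidiagonal.sigmaAntidiagonalEquivProd.summable_iff.2 hf
  rw [← Finset.HasAntidiagonal.sigmaAntidiagonalEquivProd.tsum_eq f,
    hs.tsum_sigma' fun t => (hasSum_fintype _).summable]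
  refine tsum_congr fun t => ?_
  rw [tsum_fintype, ← Finset.sum_coe_sort]
  rfl

lemma factorial_add_le (k j : ℕ) :
    ((k + j).factorial : ℝ) ≤ 2 ^ (k + j) * (k.factorial * j.factorial) := by
  have h1 := Nat.add_choose_mul_factorial_mul_factorial k j
  have h2 : (k + j).choose j ≤ 2 ^ (k + j) := Nat.choose_le_two_pow _ _
  rw [← h1]
  push_cast
  rw [mul_assoc]
  gcongr
  exact_mod_cast h2

/-- Rearrangement of the series for a large argument. -/
lemma exists_tsum_eq_of_large (b σ : ℂ) {A B : ℕ → ℂ}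
    (hAB : ∀ t, A t = ∑ k ∈ Finset.range (t + 1), (t.choose k : ℂ) * σ ^ (t - k) * B k)
    {K R : ℝ} (hR : 0 ≤ R) (hB : ∀ k, ‖B k‖ ≤ K * R ^ k) :
    ∃ M : ℝ, ∀ x : ℂ, M < ‖x‖ →
      ∑' t, rising b t / (t.factorial : ℂ) * A t * (x ^ t)⁻¹
        = (1 - σ / x) ^ (-b) * ∑' k, rising b k / (k.factorial : ℂ) * B k * ((x - σ) ^ k)⁻¹ := by
  obtain ⟨K', hK0', hK'⟩ := exists_norm_rising_le_factorial b one_lt_two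
  -- A factor `2` comes from the bound on `(b)_t / t!`, another from `(k + j)! ≤ 2 ^ (k + j) k! j!`;
  -- beyond this radius both resulting geometric series converge.
  refine ⟨4 * R + 4 * ‖σ‖, fun x hx => ?_⟩
  have hσ0 := norm_nonneg σ
  have hx0 : 0 < ‖x‖ := by linarith
  have hxne : x ≠ 0 := norm_pos_iff.1 hx0
  have hσx : ‖σ / x‖ < 1 := by rw [norm_div, div_lt_one hx0]; linarith
  have hxσ : x - σ ≠ 0 := by
    intro h
    rw [sub_eq_zero.1 h] at hx
    linarith
  let f : ℕ × ℕ → ℂ := fun p => rising b (p.1 + p.2) / ((p.1.factorial : ℂ) * p.2.factorial) *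
    σ ^ p.2 * B p.1 * (x ^ (p.1 + p.2))⁻¹
  have hf : Summable f := by
    have hg : Summable fun p : ℕ × ℕ => (K' * K * (4 * R / ‖x‖) ^ p.1) * (4 * ‖σ‖ / ‖x‖) ^ p.2 := by
      refine Summable.mul_of_nonneg (f := fun k => K' * K * (4 * R / ‖x‖) ^ k)
        (g := fun j => (4 * ‖σ‖ / ‖x‖) ^ j) ?_ ?_ ?_ ?_
      · refine (summable_geometric_of_lt_one (by positivity) ?_).mul_left _
        rw [div_lt_one hx0]; linarith
      · refine summable_geometric_of_lt_one (by positivity) ?_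
        rw [div_lt_one hx0]; linarith
      · intro k
        have hK : 0 ≤ K := by simpa using (norm_nonneg _).trans (hB 0)
        simp only [Pi.zero_apply]
        positivity
      · intro j
        simp only [Pi.zero_apply]
        positivity
    refine Summable.of_norm_bounded hg fun ⟨k, j⟩ => ?_
    simp only [f, norm_mul, norm_div, norm_inv, norm_pow, Complex.norm_natCast]
    have h1 : ‖rising b (k + j)‖ / (k.factorial * j.factorial) ≤ K' * 4 ^ (k + j) := by
      rw [div_le_iff₀ (by positivity)]
      calc _ ≤ K' * 2 ^ (k + j) * (k + j).factorial := hK' _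
        _ ≤ K' * 2 ^ (k + j) * (2 ^ (k + j) * (k.factorial * j.factorial)) := by
            gcongr
            exact factorial_add_le k j
        _ = _ := by
            rw [show (4 : ℝ) = 2 * 2 by norm_num, mul_pow]
            ring
    calc _ ≤ K' * 4 ^ (k + j) * ‖σ‖ ^ j * (K * R ^ k) * (‖x‖ ^ (k + j))⁻¹ := by
          gcongr
          exact hB k
      _ = _ := by
          simp only [div_pow, mul_pow, pow_add, mul_inv]
          ring
  have hL : ∀ t, rising b t / (t.factorial : ℂ) * A t * (x ^ t)⁻¹
      = ∑ p ∈ Finset.HasAntidiagonal.antidiagonal t, f p := by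
    intro t
    rw [Finset.Nat.sum_antidiagonal_eq_sum_range_succ_mk, hAB, Finset.mul_sum, Finset.sum_mul]
    refine Finset.sum_congr rfl fun k hk => ?_
    have hk' : k ≤ t := by have := Finset.mem_range.1 hk; omega
    have hkt : k + (t - k) = t := by omega
    simp only [f, hkt]
    have hf0 : ∀ j : ℕ, (j.factorial : ℂ) ≠ 0 := fun j => by exact_mod_cast j.factorial_ne_zero
    have hch : (t.choose k : ℂ) * (k.factorial * (t - k).factorial) = t.factorial := by
      rw [← mul_assoc]
      exact_mod_cast Nat.choose_mul_factorial_mul_factorial hk'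
    rw [← hch]
    have : (t.choose k : ℂ) ≠ 0 := by exact_mod_cast (Nat.choose_pos hk').ne'
    field_simp
  rw [tsum_congr hL, tsum_antidiagonal hf, hf.tsum_prod, ← tsum_mul_left]
  refine tsum_congr fun k => ?_
  -- Since `(b)_{k+j} = (b)_k (b + k)_j`, the sum over `j` is the binomial series of exponent `-(b +
  -- k)`.
  have hrow : ∀ j, f (k, j) = (rising b k / (k.factorial : ℂ) * B k * (x ^ k)⁻¹) *
      (rising (b + k) j / (j.factorial : ℂ) * (σ / x) ^ j) := by
    intro j
    simp only [f, rising_add, pow_add, mul_inv, div_eq_mul_inv]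
    ring
  have hne : 1 - σ / x ≠ 0 := by
    rw [Ne, sub_eq_zero]
    intro h
    rw [← h] at hσx
    simp at hσx
  rw [tsum_congr hrow, tsum_mul_left, (hasSum_rising (b + k) hσx).tsum_eq, neg_add,
    Complex.cpow_add _ _ hne, Complex.cpow_neg _ (k : ℂ), Complex.cpow_natCast]
  have : x ^ k * (1 - σ / x) ^ k = (x - σ) ^ k := by
    rw [← mul_pow, mul_sub, mul_one, mul_div_cancel₀ _ hxne]
  rw [← this, mul_inv]
  ring

/-! ### Analytic continuation along a ray -/

section InvPow
variable {α : ℕ → ℂ} {ρ : ℝ}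

lemma norm_mul_inv_pow_le (hρ : 0 < ρ) {x : ℂ} (hx : ρ ≤ ‖x‖) (t : ℕ) :
    ‖α t * (x ^ t)⁻¹‖ ≤ ‖α t‖ * (ρ ^ t)⁻¹ := by
  rw [norm_mul, norm_inv, norm_pow]
  gcongr

lemma differentiableOn_tsum_inv_pow (hρ : 0 < ρ) (h : Summable fun t => ‖α t‖ * (ρ ^ t)⁻¹) :
    DifferentiableOn ℂ (fun x : ℂ => ∑' t, α t * (x ^ t)⁻¹) {x | ρ < ‖x‖} := by
  refine Complex.differentiableOn_tsum_of_summable_norm h (fun t => ?_)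
    (isOpen_lt continuous_const continuous_norm) fun t x hx => norm_mul_inv_pow_le hρ (le_of_lt hx) t
  intro x hx
  have hx0 : x ≠ 0 := norm_pos_iff.1 (hρ.trans hx)
  exact ((differentiableAt_const _).mul ((differentiableAt_id.pow t).inv
    (pow_ne_zero t hx0))).differentiableWithinAt

/-- Absolute convergence at radius `ρ` gives uniform convergence up to and including the circle, so
no Abel-type theorem is needed at the boundary. -/
lemma continuousOn_tsum_inv_pow (hρ : 0 < ρ) (h : Summable fun t => ‖α t‖ * (ρ ^ t)⁻¹) :
    ContinuousOn (fun x : ℂ => ∑' t, α t * (x ^ t)⁻¹) {x | ρ ≤ ‖x‖} := by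
  refine continuousOn_tsum (fun t => ?_) h fun t x hx => norm_mul_inv_pow_le hρ hx t
  intro x hx
  have hx0 : x ≠ 0 := norm_pos_iff.1 (hρ.trans_le hx)
  exact (continuousAt_const.mul ((continuousAt_id.pow t).inv₀
    (pow_ne_zero t hx0))).continuousWithinAt

end InvPow

lemma norm_lt_norm_add_mul {w u : ℂ} (hu : u ≠ 0) (h : 0 ≤ (u * (starRingEnd ℂ) w).re) {r : ℝ}
    (hr : 0 < r) : ‖w‖ < ‖w + r * u‖ := by
  have h1 : Complex.normSq (w + r * u)
      = Complex.normSq w + 2 * r * (u * (starRingEnd ℂ) w).re + r ^ 2 * Complex.normSq u := by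
    simp only [Complex.normSq_apply, Complex.mul_re, Complex.mul_im, Complex.add_re, Complex.add_im,
      Complex.conj_re, Complex.conj_im, Complex.ofReal_re, Complex.ofReal_im]
    ring
  have h2 : 0 < r ^ 2 * Complex.normSq u := mul_pos (by positivity) (Complex.normSq_pos.2 hu)
  have h3 : 0 ≤ 2 * r * (u * (starRingEnd ℂ) w).re := by positivity
  rw [← sq_lt_sq₀ (norm_nonneg _) (norm_nonneg _), ← Complex.normSq_eq_norm_sq,
    ← Complex.normSq_eq_norm_sq]
  linarith

lemma re_mul_conj_pos {w u : ℂ} (hu : u ≠ 0) (h : 0 ≤ (u * (starRingEnd ℂ) w).re) {r : ℝ}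
    (hr : 0 < r) : 0 < ((w + r * u) * (starRingEnd ℂ) u).re := by
  have h1 : ((w + r * u) * (starRingEnd ℂ) u).re
      = (u * (starRingEnd ℂ) w).re + r * Complex.normSq u := by
    simp only [Complex.normSq_apply, Complex.mul_re, Complex.mul_im, Complex.add_re, Complex.add_im,
      Complex.conj_re, Complex.conj_im, Complex.ofReal_re, Complex.ofReal_im]
    ring
  rw [h1]
  have := mul_pos hr (Complex.normSq_pos.2 hu)
  linarith

/-- Two points of a common open half-plane through `0` cannot have a quotient in `(-∞, 0]`. -/
lemma div_mem_slitPlane {x y u : ℂ} (hx : 0 < (x * (starRingEnd ℂ) u).re)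
    (hy : 0 < (y * (starRingEnd ℂ) u).re) : y / x ∈ Complex.slitPlane := by
  have hx0 : x ≠ 0 := by rintro rfl; simp at hx
  by_contra hcon
  rw [Complex.mem_slitPlane_iff, not_or, not_lt, not_not] at hcon
  have h1 : y / x = (((y / x).re : ℝ) : ℂ) := by
    apply Complex.ext <;> simp [hcon.2]
  have h2 : y = (((y / x).re : ℝ) : ℂ) * x := by rw [← h1, div_mul_cancel₀ _ hx0]
  rw [h2, mul_assoc, Complex.re_ofReal_mul] at hy
  nlinarith [hcon.1]

/-- There is a direction along which both `1` and `w` move away from `0`, and along which the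
principal power of the quotient is continuous. -/
lemma exists_direction {w : ℂ} (hw : w ≠ 0) (b : ℂ) : ∃ u : ℂ, u ≠ 0 ∧ 0 ≤ u.re ∧
    0 ≤ (u * (starRingEnd ℂ) w).re ∧
    Filter.Tendsto (fun r : ℝ => ((w + r * u) / (1 + r * u)) ^ b) (nhdsWithin 0 (Set.Ioi 0))
      (nhds (w ^ b)) := by
  have hcont : ∀ u : ℂ, ContinuousAt (fun r : ℝ => (w + r * u) / (1 + r * u)) 0 := by
    intro u
    refine ContinuousAt.div (by fun_prop) (by fun_prop) (by simp)
  have hlim : ∀ u : ℂ, Filter.Tendsto (fun r : ℝ => (w + r * u) / (1 + r * u))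
      (nhdsWithin 0 (Set.Ioi 0)) (nhds w) := by
    intro u
    have := (hcont u).tendsto
    simp only [Complex.ofReal_zero, zero_mul, add_zero, div_one] at this
    exact this.mono_left nhdsWithin_le_nhds
  by_cases hs : w ∈ Complex.slitPlane
  · have hn : 0 < ‖w‖ := norm_pos_iff.2 hw
    -- The bisector of the directions of `1` and `w`; it is nonzero because `w` is not a negative
    -- real.
    refine ⟨‖w‖ + w, ?_, ?_, ?_, ?_⟩
    · intro h
      have h1 : w = ((-‖w‖ : ℝ) : ℂ) := by push_cast; linear_combination h
      rw [h1, Complex.ofReal_mem_slitPlane] at hs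
      linarith
    · have := (abs_le.1 (Complex.abs_re_le_norm w)).1
      simp only [Complex.add_re, Complex.ofReal_re]
      linarith
    · have h1 := (abs_le.1 (Complex.abs_re_le_norm w)).1
      rw [add_mul, Complex.mul_conj, Complex.add_re, Complex.re_ofReal_mul, Complex.conj_re,
        Complex.ofReal_re, Complex.normSq_eq_norm_sq]
      nlinarith
    · exact (continuousAt_cpow_const hs).tendsto.comp (hlim _)
  · rw [Complex.mem_slitPlane_iff, not_or, not_lt, not_not] at hs
    have hre : w.re < 0 := lt_of_le_of_ne hs.1 fun h => hw (Complex.ext h hs.2)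
    -- Now `w` is a negative real and `I` is orthogonal to both `1` and `w`. With `I` rather than
    -- `-I` the quotient approaches `w` from the upper half-plane, where the principal argument
    -- tends to `π = arg w`.
    refine ⟨Complex.I, Complex.I_ne_zero, by simp, by simp [hs.2], ?_⟩
    have him : ∀ r : ℝ, 0 < r → 0 ≤ ((w + r * Complex.I) / (1 + r * Complex.I)).im := by
      intro r hr
      rw [Complex.div_im]
      simp only [Complex.add_im, Complex.add_re, Complex.mul_re, Complex.mul_im, Complex.ofReal_re,
        Complex.ofReal_im, Complex.I_re, Complex.I_im, Complex.one_re, Complex.one_im, hs.2]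
      rw [← sub_div]
      refine div_nonneg ?_ (Complex.normSq_nonneg _)
      nlinarith
    have hlog : Filter.Tendsto (fun r : ℝ => Complex.log ((w + r * Complex.I) / (1 + r * Complex.I)))
        (nhdsWithin 0 (Set.Ioi 0)) (nhds (Complex.log w)) := by
      refine (Complex.continuousWithinAt_log_of_re_neg_of_im_zero hre hs.2).tendsto.comp ?_
      refine tendsto_nhdsWithin_iff.2 ⟨hlim _, ?_⟩
      filter_upwards [self_mem_nhdsWithin] with r hr using him r hr
    have hexp := (Complex.continuous_exp.tendsto _).comp (hlog.mul_const b)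
    rw [← Complex.cpow_def_of_ne_zero hw] at hexp
    refine hexp.congr' ?_
    filter_upwards [self_mem_nhdsWithin] with r hr
    have hr' : (0 : ℝ) < r := hr
    rw [Function.comp_apply, ← Complex.cpow_def_of_ne_zero]
    refine div_ne_zero (fun h => ?_) fun h => ?_
    · have := congrArg Complex.im h
      simp [hs.2] at this
      linarith
    · have := congrArg Complex.re h
      simp at this

/-- The rearranged series agree wherever both converge absolutely. -/
theorem tsum_rising_eq (b σ : ℂ) {A B : ℕ → ℂ}
    (hAB : ∀ t, A t = ∑ k ∈ Finset.range (t + 1), (t.choose k : ℂ) * σ ^ (t - k) * B k)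
    {K R : ℝ} (hR : 0 ≤ R) (hB : ∀ k, ‖B k‖ ≤ K * R ^ k) (hσ : 1 - σ ≠ 0)
    (hSA : Summable fun t => rising b t / (t.factorial : ℂ) * A t)
    (hSB : Summable fun k => rising b k / (k.factorial : ℂ) * B k * ((1 - σ) ^ k)⁻¹) :
    ∑' t, rising b t / (t.factorial : ℂ) * A t
      = (1 - σ) ^ (-b) * ∑' k, rising b k / (k.factorial : ℂ) * B k * ((1 - σ) ^ k)⁻¹ := by
  -- The ray is `x = 1 + r u`. For `r > 0` both `x` and `x - σ` lie strictly outside the circles on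
  -- which absolute convergence is assumed, and their quotient avoids the branch cut.
  obtain ⟨u, hu, hu1, huw, hlim⟩ := exists_direction hσ (-b)
  obtain ⟨M, hM⟩ := exists_tsum_eq_of_large b σ hAB hR hB
  let F : ℂ → ℂ := fun x => ∑' t, rising b t / (t.factorial : ℂ) * A t * (x ^ t)⁻¹
  let G : ℂ → ℂ := fun x => ∑' k, rising b k / (k.factorial : ℂ) * B k * (x ^ k)⁻¹
  have hw : 0 < ‖1 - σ‖ := norm_pos_iff.2 hσ
  have hSA' : Summable fun t => ‖rising b t / (t.factorial : ℂ) * A t‖ * ((1 : ℝ) ^ t)⁻¹ := by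
    simpa using hSA.norm
  have hSB' : Summable fun t => ‖rising b t / (t.factorial : ℂ) * B t‖ * (‖1 - σ‖ ^ t)⁻¹ := by
    simpa only [norm_mul, norm_inv, norm_pow] using hSB.norm
  have hu1' : 0 ≤ (u * (starRingEnd ℂ) 1).re := by simpa using hu1
  have hx : ∀ r : ℝ, 0 < r → 1 < ‖1 + r * u‖ := fun r hr => by
    simpa using norm_lt_norm_add_mul hu hu1' hr
  have hy : ∀ r : ℝ, 0 < r → ‖1 - σ‖ < ‖1 - σ + r * u‖ := fun r hr =>
    norm_lt_norm_add_mul hu huw hr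
  have hslit : ∀ r : ℝ, 0 < r → (1 - σ + r * u) / (1 + r * u) ∈ Complex.slitPlane := fun r hr =>
    div_mem_slitPlane (re_mul_conj_pos hu hu1' hr) (re_mul_conj_pos hu huw hr)
  let f : ℝ → ℂ := fun r => F (1 + r * u)
  let g : ℝ → ℂ := fun r => ((1 - σ + r * u) / (1 + r * u)) ^ (-b) * G (1 - σ + r * u)
  have hline : ∀ (p : ℂ) (r : ℝ), AnalyticAt ℝ (fun r : ℝ => p + r * u) r := fun p r =>
    analyticAt_const.add ((Complex.ofRealCLM.analyticAt r).mul analyticAt_const)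
  have hf : AnalyticOnNhd ℝ f (Set.Ioi 0) := by
    intro r hr
    have h1 : AnalyticAt ℂ F (1 + r * u) :=
      (differentiableOn_tsum_inv_pow one_pos hSA').analyticAt
        ((isOpen_lt continuous_const continuous_norm).mem_nhds (hx r hr))
    exact (h1.restrictScalars (𝕜 := ℝ)).comp_of_eq (hline 1 r) rfl
  have hg : AnalyticOnNhd ℝ g (Set.Ioi 0) := by
    intro r hr
    have h1 : AnalyticAt ℂ G (1 - σ + r * u) :=
      (differentiableOn_tsum_inv_pow hw hSB').analyticAt
        ((isOpen_lt continuous_const continuous_norm).mem_nhds (hy r hr))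
    have hne : (1 + r * u : ℂ) ≠ 0 := norm_pos_iff.1 (zero_lt_one.trans (hx r hr))
    have h2 : AnalyticAt ℂ (fun z : ℂ => z ^ (-b)) ((1 - σ + r * u) / (1 + r * u)) :=
      analyticAt_id.cpow analyticAt_const (hslit r hr)
    exact ((h2.restrictScalars (𝕜 := ℝ)).comp_of_eq ((hline (1 - σ) r).div (hline 1 r) hne) rfl).mul
      ((h1.restrictScalars (𝕜 := ℝ)).comp_of_eq (hline (1 - σ) r) rfl)
  have hlarge : ∀ r : ℝ, 0 < r → M < ‖1 + r * u‖ → f r = g r := by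
    intro r hr hMr
    have hne : (1 + r * u : ℂ) ≠ 0 := norm_pos_iff.1 (zero_lt_one.trans (hx r hr))
    have h1 : (1 + r * u : ℂ) - σ = 1 - σ + r * u := by ring
    have h2 : 1 - σ / (1 + r * u) = (1 - σ + r * u) / (1 + r * u) := by
      rw [← h1, sub_div, div_self hne]
    have := hM _ hMr
    rw [h1, h2] at this
    exact this
  obtain ⟨r₀, hr₀, hev⟩ : ∃ r₀ : ℝ, 0 < r₀ ∧ M < ‖1 + r₀ * u‖ := by
    have hun : 0 < ‖u‖ := norm_pos_iff.2 hu
    refine ⟨(|M| + 2) / ‖u‖, by positivity, ?_⟩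
    have h1 := norm_sub_norm_le ((((|M| + 2) / ‖u‖ : ℝ) : ℂ) * u) (-1)
    rw [norm_mul, Complex.norm_real, Real.norm_eq_abs, abs_of_nonneg (by positivity),
      div_mul_cancel₀ _ hun.ne', norm_neg, norm_one, sub_neg_eq_add, add_comm _ (1 : ℂ)] at h1
    have := le_abs_self M
    linarith
  -- Identity theorem for real-analytic functions of `r`, starting from a neighbourhood of a large
  -- `r₀`.
  have heq : Set.EqOn f g (Set.Ioi 0) := by
    refine hf.eqOn_of_preconnected_of_eventuallyEq hg isPreconnected_Ioi (z₀ := r₀) hr₀ ?_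
    have hcont : Continuous fun r : ℝ => ‖(1 + r * u : ℂ)‖ := by fun_prop
    filter_upwards [isOpen_Ioi.mem_nhds hr₀,
      (isOpen_lt continuous_const hcont).mem_nhds hev] with r h1 h2 using hlarge r h1 h2
  have hlimline : ∀ p : ℂ, Filter.Tendsto (fun r : ℝ => p + r * u) (nhdsWithin 0 (Set.Ioi 0))
      (nhds p) := by
    intro p
    have : Continuous fun r : ℝ => p + r * u := by fun_prop
    simpa using (this.tendsto 0).mono_left nhdsWithin_le_nhds
  -- Passage to the endpoint `r = 0`, where the arguments are exactly `1` and `1 - σ`.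
  have hf0 : Filter.Tendsto f (nhdsWithin 0 (Set.Ioi 0)) (nhds (F 1)) := by
    have hc := continuousOn_tsum_inv_pow one_pos hSA' 1 (by simp)
    refine hc.tendsto.comp (tendsto_nhdsWithin_iff.2 ⟨hlimline 1, ?_⟩)
    filter_upwards [self_mem_nhdsWithin] with r hr using (hx r hr).le
  have hg0 : Filter.Tendsto g (nhdsWithin 0 (Set.Ioi 0)) (nhds ((1 - σ) ^ (-b) * G (1 - σ))) := by
    have hc := continuousOn_tsum_inv_pow hw hSB' (1 - σ) (le_refl ‖1 - σ‖)
    refine hlim.mul (hc.tendsto.comp (tendsto_nhdsWithin_iff.2 ⟨hlimline (1 - σ), ?_⟩))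
    filter_upwards [self_mem_nhdsWithin] with r hr using (hy r hr).le
  have hfg : Filter.Tendsto f (nhdsWithin 0 (Set.Ioi 0)) (nhds ((1 - σ) ^ (-b) * G (1 - σ))) :=
    hg0.congr' (by filter_upwards [self_mem_nhdsWithin] with r hr using (heq hr).symm)
  have := tendsto_nhds_unique hf0 hfg
  simpa only [F, G, one_pow, inv_one, mul_one] using this

/-! ### Assembly: the terms of the two series and the prefactor -/

lemma mul_cpow_neg {x y b : ℂ} (hx : x ≠ 0) (hy : y ≠ 0)
    (h : x.arg + y.arg ∈ Set.Ioc (-Real.pi) Real.pi ∨ ∃ n : ℤ, b = n) :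
    x ^ (-b) * y ^ (-b) = (x * y) ^ (-b) := by
  rcases h with h | ⟨n, rfl⟩
  · rw [Complex.cpow_def_of_ne_zero hx, Complex.cpow_def_of_ne_zero hy,
      Complex.cpow_def_of_ne_zero (mul_ne_zero hx hy), Complex.log_mul hx hy h, ← Complex.exp_add,
      add_mul]
  · rw [← Int.cast_neg, Complex.cpow_intCast, Complex.cpow_intCast, Complex.cpow_intCast, mul_zpow]

section Terms
variable {m : ℕ} {X : SymMat m} {ev : Fin m → ℂ} (a b c : ℂ)

lemma oneP1Term_eq
    (hev : (X : Matrix (Fin m) (Fin m) ℂ).charpoly.roots = Finset.univ.val.map ev)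
    {d : ℂ} (hd : d ≠ 0) (t : ℕ) :
    oneP1Term (fun t => rising b t * d ^ (-b - (t : ℂ))) a c X t
      = d ^ (-b) * (rising b t / (t.factorial : ℂ) *
        MvPolynomial.eval ev (kummerPoly m a c t) * (d ^ t)⁻¹) := by
  rw [oneP1Term, sum_zonal_eq a c X hev, Complex.cpow_sub _ _ hd, Complex.cpow_natCast]
  ring

lemma oneP1Term_neg_eq
    (hev : (X : Matrix (Fin m) (Fin m) ℂ).charpoly.roots = Finset.univ.val.map ev)
    (z : ℂ) (t : ℕ) :
    oneP1Term (fun t => rising b t * z ^ (-(t : ℤ))) a c (-X) t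
      = rising b t / (t.factorial : ℂ) *
        ((-1) ^ t * MvPolynomial.eval ev (kummerPoly m a c t)) * (z ^ t)⁻¹ := by
  rw [oneP1Term, sum_zonal_neg_eq a c X hev, zpow_neg, zpow_natCast]
  ring

lemma eval_kummerPoly_eq {c : ℂ} (hc : ((m : ℝ) - 1) / 2 < c.re) (ev : Fin m → ℂ) (t : ℕ) :
    MvPolynomial.eval ev (kummerPoly m a c t) = ∑ k ∈ Finset.range (t + 1), (t.choose k : ℂ) *
      (∑ i, ev i) ^ (t - k) * ((-1) ^ k * MvPolynomial.eval ev (kummerPoly m (c - a) c k)) := by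
  rw [kummerPoly_eq a (risingPartition_ne_zero hc) t, map_sum]
  refine Finset.sum_congr rfl fun k _ => ?_
  rw [MvPolynomial.smul_eval, map_mul, map_pow, eval_powerSum]
  ring

end Terms

end KummerPearson

end

open KummerPearson in
theorem mainTheorem2 (m : ℕ) (X : SymMat m)
    (hX : ((X : Matrix (Fin m) (Fin m) ℂ).map Complex.re).PosDef)
    (a c : ℂ) (ha : ((m : ℝ) - 1) / 2 < a.re) (hc : ((m : ℝ) - 1) / 2 < c.re)
    (b d s : ℂ) (hs : s = (X : Matrix (Fin m) (Fin m) ℂ).trace) :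
    (absEigenvalueSum X < ‖d‖ →
      Summable (oneP1Term (fun t => rising b t * d ^ (-b - (t : ℂ))) a c X)) ∧
    (absEigenvalueSum X < ‖d - s‖ →
      Summable (oneP1Term (fun t => rising b t * (d - s) ^ (-(t : ℤ))) (c - a) c (-X))) ∧
    (d ≠ 0 → d ≠ s →
      (d.arg + (1 - s / d).arg ∈ Set.Ioc (-Real.pi) Real.pi ∨ ∃ n : ℤ, b = n) →
      Summable (oneP1Term (fun t => rising b t * d ^ (-b - (t : ℂ))) a c X) →
      Summable (oneP1Term (fun t => rising b t * (d - s) ^ (-(t : ℤ))) (c - a) c (-X)) →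
      oneP1 (fun t => rising b t * d ^ (-b - (t : ℂ))) a c X =
        (d - s) ^ (-b) *
          oneP1 (fun t => rising b t * (d - s) ^ (-(t : ℤ))) (c - a) c (-X)) := by
  obtain ⟨ev, hev⟩ := exists_eigenvalues (X : Matrix (Fin m) (Fin m) ℂ)
  rw [trace_eq_sum_eigenvalues hev] at hs
  have hΛ : 0 ≤ ∑ i, ‖ev i‖ := Finset.sum_nonneg fun i _ => norm_nonneg _
  have hneg : ∀ (z : ℂ) (k : ℕ), ‖(-1) ^ k * z‖ = ‖z‖ := fun z k => by simp
  rw [absEigenvalueSum_eq X hev]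
  refine ⟨fun hd => ?_, fun hd => ?_, fun hd hds harg hSA hSB => ?_⟩
  · have hd0 : d ≠ 0 := norm_pos_iff.1 (hΛ.trans_lt hd)
    refine ((summable_rising_mul (b := b)
      (fun r hr => exists_norm_kummerPoly_le a hc hr ev) hΛ hd).mul_left (d ^ (-b))).congr
      fun t => (oneP1Term_eq a b c hev hd0 t).symm
  · refine (summable_rising_mul (b := b)
      (A := fun k => (-1) ^ k * MvPolynomial.eval ev (kummerPoly m (c - a) c k))
      (fun r hr => ?_) hΛ hd).congr fun t => (oneP1Term_neg_eq (c - a) b c hev (d - s) t).symm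
    simp only [hneg]
    exact exists_norm_kummerPoly_le (c - a) hc hr ev
  -- Everything is normalized by `d`: the continuation theorem is applied with `σ = s / d`, and the
  -- powers of `d` are absorbed into `A` and `B`.
  · have hw : 1 - s / d = (d - s) / d := by rw [sub_div, div_self hd]
    have hw0 : 1 - s / d ≠ 0 := by rw [hw]; exact div_ne_zero (sub_ne_zero.2 hds) hd
    have hdb : d ^ (-b) ≠ 0 := fun h => hd (Complex.cpow_eq_zero_iff _ _ |>.1 h).1
    have hmul : ∀ k : ℕ, d ^ k * (1 - s / d) ^ k = (d - s) ^ k := fun k => by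
      rw [← mul_pow, hw, mul_div_cancel₀ _ hd]
    obtain ⟨K, -, hK⟩ := exists_norm_kummerPoly_le (c - a) hc one_lt_two ev
    have hA : ∀ t, oneP1Term (fun t => rising b t * d ^ (-b - (t : ℂ))) a c X t
        = d ^ (-b) * (rising b t / (t.factorial : ℂ) *
          (MvPolynomial.eval ev (kummerPoly m a c t) * (d ^ t)⁻¹)) := fun t => by
      rw [oneP1Term_eq a b c hev hd, mul_assoc (rising b t / _)]
    have hB : ∀ k, oneP1Term (fun t => rising b t * (d - s) ^ (-(t : ℤ))) (c - a) c (-X) k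
        = rising b k / (k.factorial : ℂ) * ((-1) ^ k * MvPolynomial.eval ev
          (kummerPoly m (c - a) c k) * (d ^ k)⁻¹) * ((1 - s / d) ^ k)⁻¹ := fun k => by
      rw [oneP1Term_neg_eq (c - a) b c hev, ← hmul, mul_inv]
      ring
    -- The `2` in `R` is the growth rate `r = 2` chosen for `hK`; any geometric bound would do,
    -- since `R` only fixes where the rearrangement starts to hold.
    have key := tsum_rising_eq b (s / d)
      (A := fun t => MvPolynomial.eval ev (kummerPoly m a c t) * (d ^ t)⁻¹)
      (B := fun k => (-1) ^ k * MvPolynomial.eval ev (kummerPoly m (c - a) c k) * (d ^ k)⁻¹)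
      (K := K) (R := 2 * (∑ i, ‖ev i‖) / ‖d‖) (fun t => ?_) (by positivity) (fun k => ?_) hw0
      ((summable_mul_left_iff hdb).1 (hSA.congr hA)) (hSB.congr hB)
    -- The argument condition, or integrality of `b`, is what merges `d ^ (-b)` and `(1 - s / d) ^
    -- (-b)` into `(d - s) ^ (-b)`.
    · rw [oneP1, oneP1, tsum_congr hA, tsum_congr hB, tsum_mul_left, key, ← mul_assoc,
        mul_cpow_neg hd hw0 harg, hw, mul_div_cancel₀ _ hd]
    · simp only [eval_kummerPoly_eq a hc ev t, Finset.sum_mul, ← hs]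
      refine Finset.sum_congr rfl fun k hk => ?_
      have hkt : k ≤ t := Nat.lt_succ_iff.1 (Finset.mem_range.1 hk)
      rw [div_pow, pow_sub₀ d hd hkt]
      field_simp
    · rw [norm_mul, hneg, norm_inv, norm_pow, div_pow, ← mul_div_assoc, div_eq_mul_inv]
      exact mul_le_mul_of_nonneg_right (hK k) (by positivity)
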